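/- **Setting.** Let $Q(v,v_1,v_2,v_{12};\alpha_1,\alpha_2)$ be a polynomial in $v,v_1,v_2,v_{12}\in\mathbb C$ of degree at most one in each of them, whose coefficients are holomorphic functions of the parameters $(\alpha_1,\alpha_2)\in\mathbb C^2$, and which has the symmetry of the square, $$Q(v,v_1,v_2,v_{12};\alpha_1,\alpha_2)=\varepsilon\,Q(v,v_2,v_1,v_{12};\alpha_2,\alpha_1)=\sigma\,Q(v_1,v,v_{12},v_2;\alpha_1,\alpha_2),\qquad \varepsilon,\sigma=\pm1 .$$ A pair $(\alpha_1,\alpha_2)$ is called nondegenerate if $Q(\cdot\,;\alpha_1,\alpha_2)$ is an irreducible polynomial in the four fields. "Generic" means: outside the zero set of some nonzero polynomial. The equation $Q=0$ is 3D-consistent: whenever $\alpha_1,\alpha_2,\alpha_3$ are pairwise nondegenerate, for generic $(v,v_1,v_2,v_3)\in\mathbb C^4$ the equations $Q(v,v_i,v_j,v_{ij};\alpha_i,\alpha_j)=0$ ($1\le i<j\le3$) determine $v_{12},v_{13},v_{23}$ uniquely, and each of the three equations $Q(v_k,v_{ik},v_{jk},v_{123};\alpha_i,\alpha_j)=0$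 ($\{i,j,k\}=\{1,2,3\}$, $i<j$, $v_{ij}=v_{ji}$) then determines $v_{123}$ uniquely, with the same value. Let $\Gamma$ be a finite simply connected planar quad-graph, that is, a finite connected plane graph all of whose faces except the outer one are quadrilaterals. A strip (characteristic) is a class of edges under the equivalence relation generated by being opposite edges of a quadrilateral; assume that no strip is self-intersecting, i.e. adjacent edges of a quadrilateral always belong to different strips. Give each strip a parameter in $\mathbb C$ so that the two parameters on every quadrilateral form a nondegenerate pair. A solution on $\Gamma$ is a function $u:V(\Gamma)\to\mathbb C$ such that $Q=0$ holds on every quadrilateral and, at each of its four vertices, the value of $u$ is the only one that satisfies this equation given the values at the three other vertices. Let $P$ be a simple path in $\Gamma$, with vertices $x_0,\dots,x_n$; the Cauchy problem with initial data $p\in\mathbb C^{n+1}$ asks for a solution $u$ with $u(x_i)=p_i$ for all $i$. A strip meets $P$ in those edges of $P$ that belong to the strip. **Theorem.** 1. If each strip meets $P$ in exactly one edge, then for generic initial data the Cauchy problem has exactly one solution. 2. If some strip meets $P$ in more than one edge, then the Cauchy problem is overdetermined: for generic initial data it has no solution. 3. If some strip does not meet $P$, then the Cauchy problem is underdetermined: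 for generic initial data, if it has a solution, then it has another one. -/

import Mathlib

/-- The equation `Q(v, v₁, v₂, v₁₂; α₁, α₂) = 0` on an elementary quadrilateral.  The field variables
are numbered `0, 1, 2, 3` for `v, v₁, v₂, v₁₂`; the parameter `α₁` belongs to the opposite edges
`v v₁`, `v₂ v₁₂`, and `α₂` to the opposite edges `v v₂`, `v₁ v₁₂`. -/
structure QuadEquation where
  /-- the polynomial in the four fields, for given values of the two parameters -/
  Q : ℂ → ℂ → MvPolynomial (Fin 4) ℂ
  /-- the coefficients are holomorphic functions of the parameters -/
  holomorphic : ∀ m : Fin 4 →₀ ℕ, Differentiable ℂ fun z : ℂ × ℂ => (Q z.1 z.2).coeff m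
  /-- `Q` is affine linear in each field variable -/
  degree_le_one : ∀ (α β : ℂ) (i : Fin 4), (Q α β).degreeOf i ≤ 1
  /-- invariance under the reflection of the square in the diagonal through `v` and `v₁₂` -/
  symm_diag : ∃ ε : ℂ, (ε = 1 ∨ ε = -1) ∧ ∀ α β v v₁ v₂ v₁₂ : ℂ,
    MvPolynomial.eval ![v, v₁, v₂, v₁₂] (Q α β)
      = ε * MvPolynomial.eval ![v, v₂, v₁, v₁₂] (Q β α)
  /-- invariance under the reflection of the square that exchanges `v, v₁` and `v₂, v₁₂` -/
  symm_side : ∃ σ : ℂ, (σ = 1 ∨ σ = -1) ∧ ∀ α β v v₁ v₂ v₁₂ : ℂ,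
    MvPolynomial.eval ![v, v₁, v₂, v₁₂] (Q α β)
      = σ * MvPolynomial.eval ![v₁, v, v₁₂, v₂] (Q α β)

namespace QuadEquation

/-- The value of `Q(v, v₁, v₂, v₁₂; α, β)`. -/
noncomputable def val (E : QuadEquation) (α β v v₁ v₂ v₁₂ : ℂ) : ℂ :=
  MvPolynomial.eval ![v, v₁, v₂, v₁₂] (E.Q α β)

/-- `y` is the one and only value of `v₁₂` that solves the equation for the given `v, v₁, v₂`. -/
def Determines (E : QuadEquation) (α β v v₁ v₂ y : ℂ) : Prop :=
  ∀ t : ℂ, E.val α β v v₁ v₂ t = 0 ↔ t = y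

/-- The equation does not split (as, for example, `(v₁₂ - v) * (v₂ - v₁) = 0` does)
at this pair of parameters. -/
def Nondegenerate (E : QuadEquation) (α β : ℂ) : Prop :=
  Irreducible (E.Q α β)

/-- Three-dimensional consistency: for generic `v, v₁, v₂, v₃` the three equations on the faces of a
cube at the vertex `v` determine `v₁₂, v₁₃, v₂₃`, and then each of the three equations on the
opposite faces determines `v₁₂₃`, with the same value. -/
def Consistent3D (E : QuadEquation) : Prop :=
  ∀ α₁ α₂ α₃ : ℂ, E.Nondegenerate α₁ α₂ → E.Nondegenerate α₁ α₃ → E.Nondegenerate α₂ α₃ →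
    ∃ g : MvPolynomial (Fin 4) ℂ, g ≠ 0 ∧
      ∀ v v₁ v₂ v₃ : ℂ, MvPolynomial.eval ![v, v₁, v₂, v₃] g ≠ 0 →
        ∃ v₁₂ v₁₃ v₂₃ v₁₂₃ : ℂ,
          E.Determines α₁ α₂ v v₁ v₂ v₁₂ ∧
          E.Determines α₁ α₃ v v₁ v₃ v₁₃ ∧
          E.Determines α₂ α₃ v v₂ v₃ v₂₃ ∧
          E.Determines α₁ α₂ v₃ v₁₃ v₂₃ v₁₂₃ ∧
          E.Determines α₁ α₃ v₂ v₁₂ v₂₃ v₁₂₃ ∧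
          E.Determines α₂ α₃ v₁ v₁₂ v₁₃ v₁₂₃

end QuadEquation

/-- A finite simply connected planar quad-graph: a finite connected graph drawn in the plane all of
whose faces, except the outer one, are quadrilaterals.  The drawing is given combinatorially: `V` is
the set of vertices, `D` the set of darts (oriented edges), `src` the initial vertex of a dart, `rev`
reverses a dart and `rot` turns a dart to the next one around its initial vertex.  The cycles of
`rot * rev` are the faces; the Euler formula says that the surface is the sphere, and the region
outside the outer face is filled by quadrilaterals, so that it has no holes. -/
structure PlaneQuadGraph (V D : Type*) where
  src : D → V
  rev : Equiv.Perm D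
  rot : Equiv.Perm D
  rev_rev : ∀ d, rev (rev d) = d
  rev_ne : ∀ d, rev d ≠ d
  /-- the cycles of `rot` are the sets of darts with a common initial vertex -/
  src_eq_iff : ∀ d d', src d = src d' ↔ rot.SameCycle d d'
  connected : ∀ x y : V, Relation.ReflTransGen (fun z w => ∃ d, src d = z ∧ src (rev d) = w) x y
  /-- `|V| - |E| + |F| = 2`, doubled -/
  euler : 2 * Nat.card V
      + 2 * Nat.card (Quotient (Equiv.Perm.SameCycle.setoid (rot * rev))) = Nat.card D + 4
  /-- a dart of the outer face -/
  outer : D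
  quad : ∀ d, ¬ (rot * rev).SameCycle outer d → Function.minimalPeriod (rot * rev) d = 4

namespace PlaneQuadGraph

variable {V D : Type*} (G : PlaneQuadGraph V D)

/-- The terminal vertex of a dart. -/
def tgt (d : D) : V := G.src (G.rev d)

/-- The next dart along the boundary of the face of `d`; it starts where `d` ends. -/
def next (d : D) : D := (G.rot * G.rev) d

/-- The face of `d` is one of the quadrilaterals. -/
def Inner (d : D) : Prop := ¬ (G.rot * G.rev).SameCycle G.outer d

/-- One step along a strip: the two orientations of an edge, or opposite edges of a
quadrilateral. -/
def StripStep (d d' : D) : Prop := d' = G.rev d ∨ (G.Inner d ∧ d' = G.next (G.next d))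

/-- The strips (characteristics), as the sets of edges crossed by them. -/
def Strip : Type _ := Quotient (Relation.EqvGen.setoid G.StripStep)

/-- The strip that crosses the edge of `d`. -/
def strip (d : D) : G.Strip := Quotient.mk (Relation.EqvGen.setoid G.StripStep) d

/-- No strip passes twice through the same quadrilateral. -/
def NoSelfIntersection : Prop := ∀ d, G.Inner d → G.strip d ≠ G.strip (G.next d)

/-- A simple path with `n` edges: its vertices `vert 0, …, vert n` are distinct, and `edge i` leads
from `vert i` to `vert (i + 1)`. -/
structure SimplePath (n : ℕ) where
  vert : Fin (n + 1) → V
  edge : Fin n → D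
  src_edge : ∀ i, G.src (edge i) = vert i.castSucc
  tgt_edge : ∀ i, G.tgt (edge i) = vert i.succ
  injective : Function.Injective vert

/-- The parameters `a`, one for each strip, make the equation nondegenerate on every
quadrilateral. -/
def Admissible (E : QuadEquation) (a : G.Strip → ℂ) : Prop :=
  ∀ d, G.Inner d → E.Nondegenerate (a (G.strip d)) (a (G.strip (G.next d)))

/-- `u` solves the equation on every quadrilateral, and at each of the four vertices the value of `u`
is the only one that solves it for the values at the three others.  The dart `d` singles out a corner
of its quadrilateral; the vertices `v, v₁, v₁₂, v₂` are met in this order along its boundary. -/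
def IsSolution (E : QuadEquation) (a : G.Strip → ℂ) (u : V → ℂ) : Prop :=
  ∀ d, G.Inner d →
    E.Determines (a (G.strip d)) (a (G.strip (G.next d)))
      (u (G.src d)) (u (G.src (G.next d))) (u (G.src (G.next (G.next (G.next d)))))
      (u (G.src (G.next (G.next d))))

/-- `u` solves the Cauchy problem with initial data `p` on the path `P`. -/
def SolvesCauchy (E : QuadEquation) (a : G.Strip → ℂ) {n : ℕ} (P : G.SimplePath n)
    (p : Fin (n + 1) → ℂ) (u : V → ℂ) : Prop :=
  G.IsSolution E a u ∧ ∀ i, u (P.vert i) = p i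

end PlaneQuadGraph

/-- A property holds for generic data `p` in `ℂᵐ`: it holds wherever a certain nonzero polynomial
does not vanish. -/
def HoldsGenerically {m : ℕ} (A : (Fin m → ℂ) → Prop) : Prop :=
  ∃ g : MvPolynomial (Fin m) ℂ, g ≠ 0 ∧ ∀ p : Fin m → ℂ, MvPolynomial.eval p g ≠ 0 → A p

/-!
# The Cauchy problem for 3D-consistent quad-equations

In homogeneous coordinates the polynomial `Q` is a quadrilinear form, and for given `v, v₁` the map
`v₂ ↦ v₁₂` is a projective map of the line with matrix `E.transfer α β v v₁`. The idea of the proof is to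
use *Bäcklund transformations* of a solution `u`: put a second copy of the graph above the first
one, with a vertical parameter `γ`, and continue a value above one vertex along the edges by the maps
`E.transfer (a (strip d)) γ (u (src d)) (u (tgt d))`. Three-dimensional consistency says that these
maps are flat around every quadrilateral (`QuadEquation.transfer_flat`) and that the new function solves the
equation again (`QuadEquation.form_transfer_eq_zero`). The Euler formula makes the quadrilaterals fill
a disk, so that flat data are exact (`PlaneQuadGraph.exists_potential`, a discrete Poincaré lemma), and
the map from the values above `x` to those above `y` does not depend on the path. The same lemma with
values in `ℤ/2` shows that a strip has two sides.

The useful parameter is `γ = a s`, the parameter of a strip `s`: on the quadrilaterals of `s`, the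
transfer matrices with this parameter are those of the equation itself, so that going along `s` they
carry the values of `u` on one side to each other (`PlaneQuadGraph.IsSolution.exists_rail`). Some
matrices may be singular at this value of `γ`, but the independence of the path persists as an
identity between continuous functions of `γ`, in the limit from nearby values
(`ProjEq.of_frequently`); nearby values are harmless as nondegeneracy is a condition on finitely many
discriminants, which are entire functions of the parameter (`QuadEquation.eventually_nondegenerate`).

* *Uniqueness.* Suppose that two solutions agree on a connected set of vertices that contains an
  edge of `s`, and let another edge of `s` lead out of this set. The value at its end is obtained from
  the value at the first edge by a product of matrices along the strip, hence also by a product along a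
  path within the set, which is the same for both solutions
  (`PlaneQuadGraph.IsSolution.eq_tgt_of_reachable`).
* *Overdetermined data.* Among the pairs of edges of the path that belong to the same strip,
  take one that is as close as possible, of a strip `s` say. The strips between the two edges are
  different and all cross `s`, and the same comparison of two paths gives a relation between the initial
  data, which is not trivial (`PlaneQuadGraph.SimplePath.not_solvesCauchy`).
* *Existence.* Start from a constant function with a transcendental value and add the strips one by one.
  To add `s`, keep the function on one side of `s`, and replace it on the other side by its Bäcklund
  transform with parameter `a s` and a new transcendental initial value. The strips in use beyond
  `s` cross `s`, so all the parameters that are needed form nondegenerate pairs, and the values remain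
  algebraically independent along every edge (`PlaneQuadGraph.IsGenericSolution.exists_insert`). The
  result is a solution over a field of rational functions in one variable more than there are strips,
  which can be specialised (`PlaneQuadGraph.IsGenericSolution.exists_specialization`). A strip that the
  path does not meet contributes a free variable, and two of its values give two solutions.
-/

/-! ### Parent functions and rotations -/

/-- If every point is joined to `root` by a chain of `r`-steps, the length of a shortest chain is a
depth function for which every other point has a neighbour of smaller depth. -/
theorem exists_depth {X : Type*} (r : X → X → Prop) (root : X)
    (h : ∀ x, Relation.ReflTransGen r x root) :
    ∃ depth : X → ℕ, ∀ x, x ≠ root → ∃ y, r x y ∧ depth y < depth x := by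
  classical
  let C : ℕ → X → Prop := fun n =>
    Nat.rec (motive := fun _ => X → Prop) (fun x => x = root) (fun _ C x => ∃ y, r x y ∧ C y) n
  have hC : ∀ x, ∃ n, C n x := by
    intro x
    induction h x using Relation.ReflTransGen.head_induction_on with
    | refl => exact ⟨0, rfl⟩
    | head hxy _ ih => obtain ⟨n, hn⟩ := ih; exact ⟨n + 1, _, hxy, hn⟩
  refine ⟨fun x : X => Nat.find (hC x), fun x hx => ?_⟩
  have hs := Nat.find_spec (hC x)
  rcases hn : Nat.find (hC x) with _ | m
  · rw [hn] at hs; exact absurd hs hx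
  · rw [hn] at hs
    obtain ⟨y, hy, hm⟩ := hs
    refine ⟨y, hy, ?_⟩
    change Nat.find (hC y) < Nat.find (hC x)
    rw [hn]
    exact Nat.lt_succ_of_le (Nat.find_min' (hC y) hm)

/-- Going once around a cycle of a permutation, a property that changes at most at one place
of the cycle does not change there either. -/
theorem Equiv.Perm.iff_apply_of_forall_ne {D : Type*} [Finite D] (f : Equiv.Perm D) (χ : D → Prop)
    (d : D) (h : ∀ e, f.SameCycle d e → e ≠ d → (χ e ↔ χ (f e))) : χ d ↔ χ (f d) := by
  have hpos : 0 < Function.minimalPeriod f d :=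
    Function.minimalPeriod_pos_of_mem_periodicPts
      (f.injective.mem_periodicPts d)
  have key : ∀ i, i + 1 ≤ Function.minimalPeriod f d → (χ (f^[i + 1] d) ↔ χ (f d)) := by
    intro i
    induction i with
    | zero => intro _; rfl
    | succ i ih =>
      intro hi
      rw [Function.iterate_succ_apply', ← ih (by omega)]
      refine (h _ ⟨(i + 1 : ℕ), ?_⟩ ?_).symm
      · rw [zpow_natCast, ← Equiv.Perm.iterate_eq_pow f (i + 1)]
      · intro he
        have : Function.IsPeriodicPt f (i + 1) d := he
        have := this.minimalPeriod_le (Nat.succ_pos i)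
        omega
  have := key (Function.minimalPeriod f d - 1) (by omega)
  rwa [Nat.sub_add_cancel hpos, Function.iterate_minimalPeriod] at this

/-- Recursion along a parent function. -/
theorem exists_eq_parent_rec {X H : Type*} (root : X) (depth : X → ℕ) (par : X → X)
    (hpar : ∀ x, x ≠ root → depth (par x) < depth x) (h0 : H) (F : X → H → H) :
    ∃ φ : X → H, ∀ x, x ≠ root → φ x = F x (φ (par x)) := by
  classical
  let φ : X → H := (measure depth).wf.fix fun x ih =>
    if hx : x = root then h0 else F x (ih (par x) (hpar x hx))
  refine ⟨φ, fun x hx => ?_⟩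
  change (measure depth).wf.fix _ x = _
  rw [WellFounded.fix_eq, dif_neg hx]

namespace PlaneQuadGraph

variable {V D : Type*} (G : PlaneQuadGraph V D)

/-! ### Darts, faces and their corners -/

theorem src_rot (d : D) : G.src (G.rot d) = G.src d :=
  (G.src_eq_iff _ _).2 ((Equiv.Perm.sameCycle_apply_left).2 (Equiv.Perm.SameCycle.refl _ _))

theorem src_next (d : D) : G.src (G.next d) = G.tgt d := G.src_rot _

theorem tgt_rev (d : D) : G.tgt (G.rev d) = G.src d := by rw [tgt, G.rev_rev]

theorem src_rev (d : D) : G.src (G.rev d) = G.tgt d := rfl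

theorem inner_next {d : D} (hd : G.Inner d) : G.Inner (G.next d) := fun h =>
  hd (Equiv.Perm.sameCycle_apply_right.1 h)

theorem minimalPeriod_next {d : D} (hd : G.Inner d) : Function.minimalPeriod G.next d = 4 :=
  G.quad d hd

theorem next_four {d : D} (hd : G.Inner d) : G.next (G.next (G.next (G.next d))) = d := by
  have := Function.iterate_minimalPeriod (f := G.next) (x := d)
  rwa [G.minimalPeriod_next hd] at this

theorem tgt_next_three {d : D} (hd : G.Inner d) : G.tgt (G.next (G.next (G.next d))) = G.src d := by
  rw [← G.src_next, G.next_four hd]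

theorem iterate_next_ne {d : D} (hd : G.Inner d) {k : ℕ} (hk0 : k ≠ 0) (hk : k < 4) :
    G.next^[k] d ≠ d := fun h =>
  hk0 (Function.IsPeriodicPt.eq_zero_of_lt_minimalPeriod h (by rwa [G.minimalPeriod_next hd]))

theorem reflTransGen_to (x y : V) :
    Relation.ReflTransGen (fun z w => ∃ d, G.src d = z ∧ G.tgt d = w) x y :=
  G.connected x y

/-! ### The discrete Poincaré lemma -/

/-- The face on the left of a dart. -/
def face (d : D) : Quotient (Equiv.Perm.SameCycle.setoid (G.rot * G.rev)) := Quotient.mk _ d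

theorem face_eq_iff {d e : D} : G.face d = G.face e ↔ (G.rot * G.rev).SameCycle d e := Quotient.eq

theorem face_rot (d : D) : G.face (G.rot d) = G.face (G.rev d) := by
  rw [G.face_eq_iff]
  have : G.rot d = (G.rot * G.rev) (G.rev d) := by
    rw [Equiv.Perm.mul_apply, G.rev_rev]
  rw [this]
  exact Equiv.Perm.sameCycle_apply_left.2 (Equiv.Perm.SameCycle.refl _ _)

theorem inner_iff_face {d : D} : G.Inner d ↔ G.face d ≠ G.face G.outer := by
  rw [Ne, G.face_eq_iff, Inner, not_iff_not]
  exact ⟨fun h => h.symm, fun h => h.symm⟩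

/-- The darts that do not belong to a spanning tree, given by the dart from each vertex to its
parent, connect all the faces: a set of faces that can only be left across tree edges cannot be left
at all.  The membership of the face in such a set changes an even number of times around each vertex,
so at the last vertices of the tree first, it does not change across the edge to the parent. -/
theorem face_reachable [Finite V] [Finite D] (root : V) (depth : V → ℕ) (pd : V → D)
    (hsrc : ∀ x, x ≠ root → G.src (pd x) = x)
    (hdepth : ∀ x, x ≠ root → depth (G.tgt (pd x)) < depth x) (d : D) :
    Relation.ReflTransGen (fun f f' => ∃ e, (∀ x, x ≠ root → e ≠ pd x ∧ e ≠ G.rev (pd x)) ∧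
      G.face e = f ∧ G.face (G.rev e) = f') (G.face d) (G.face G.outer) := by
  set r := fun f f' => ∃ e, (∀ x, x ≠ root → e ≠ pd x ∧ e ≠ G.rev (pd x)) ∧
      G.face e = f ∧ G.face (G.rev e) = f'
  set χ : D → Prop := fun d => Relation.ReflTransGen r (G.face d) (G.face G.outer) with hχ
  have hU : ∀ e, (∀ x, x ≠ root → e ≠ pd x ∧ e ≠ G.rev (pd x)) → (χ (G.rev e) → χ e) :=
    fun e he h => Relation.ReflTransGen.head ⟨e, he, rfl, rfl⟩ h
  have hU' : ∀ e, (∀ x, x ≠ root → e ≠ pd x ∧ e ≠ G.rev (pd x)) → (χ e ↔ χ (G.rev e)) := by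
    intro e he
    refine ⟨fun h => hU _ (fun x hx => ⟨fun h => (he x hx).2 ?_, fun h => (he x hx).1 ?_⟩) ?_, hU e he⟩
    · rw [← h, G.rev_rev]
    · exact G.rev.injective h
    · rwa [G.rev_rev]
  have hrot : ∀ e, χ (G.rot e) ↔ χ (G.rev e) := fun e => by simp only [hχ, G.face_rot]
  obtain ⟨N, hN⟩ : ∃ N, ∀ x, depth x ≤ N := by
    obtain ⟨N, hN⟩ := (Set.finite_range depth).bddAbove
    exact ⟨N, fun x => hN ⟨x, rfl⟩⟩
  have hT : ∀ k x, N - depth x = k → x ≠ root → (χ (pd x) ↔ χ (G.rev (pd x))) := by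
    intro k
    induction k using Nat.strong_induction_on with
    | _ k ih =>
      intro x hk hx
      rw [← hrot]
      refine G.rot.iff_apply_of_forall_ne χ (pd x) fun e he hne => ?_
      have hes : G.src e = x := by rw [← hsrc x hx]; exact ((G.src_eq_iff _ _).2 he).symm
      rw [hrot]
      by_cases hTe : ∀ y, y ≠ root → e ≠ pd y ∧ e ≠ G.rev (pd y)
      · exact hU' e hTe
      · push Not at hTe
        obtain ⟨y, hy, hye⟩ := hTe
        by_cases h1 : e = pd y
        · have : y = x := by rw [← hsrc y hy, ← h1, hes]
          exact absurd (this ▸ h1) hne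
        · have h2 := hye h1
          have h3 := hdepth y hy
          have h4 : G.tgt (pd y) = x := by rw [← hes, h2]; rfl
          rw [h4] at h3
          have := ih (N - depth y) (by have := hN y; have := hN x; omega) y rfl hy
          rw [h2, G.rev_rev, this]
  have hall : ∀ e, χ e ↔ χ (G.rev e) := by
    intro e
    by_cases hTe : ∀ y, y ≠ root → e ≠ pd y ∧ e ≠ G.rev (pd y)
    · exact hU' e hTe
    · push Not at hTe
      obtain ⟨y, hy, hye⟩ := hTe
      by_cases h1 : e = pd y
      · rw [h1]; exact hT _ y rfl hy
      · rw [hye h1, G.rev_rev]; exact (hT _ y rfl hy).symm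
  have hcyc : ∀ e e', G.src e = G.src e' → χ e → χ e' := by
    intro e e' h he
    obtain ⟨i, hi⟩ := ((G.src_eq_iff _ _).1 h).exists_nat_pow_eq
    have : ∀ i : ℕ, χ ((G.rot ^ i) e) := by
      intro i
      induction i with
      | zero => simpa using he
      | succ i ih => rw [pow_succ', Equiv.Perm.mul_apply, hrot, ← hall]; exact ih
    rw [← hi]; exact this i
  have hv : ∀ x, ∀ e, G.src e = x → χ e := by
    intro x
    induction G.reflTransGen_to (G.src G.outer) x with
    | refl => intro e he; exact hcyc G.outer e he.symm Relation.ReflTransGen.refl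
    | tail _ hyz ih =>
      obtain ⟨c, hc1, hc2⟩ := hyz
      intro e he
      exact hcyc (G.rev c) e (by rw [he, ← hc2]; rfl) ((hall c).1 (ih c hc1))
  exact hv _ d rfl

/-- A dart and its reverse for each member of a set of edges given by one dart each. -/
theorem card_darts_and_reverses {ι : Type*} [Finite ι] [Finite D] (p : ι → D)
    (hp : Function.Injective p) (hpr : ∀ i j, p i ≠ G.rev (p j)) :
    Nat.card {d // ∃ i, d = p i ∨ d = G.rev (p i)} = 2 * Nat.card ι := by
  have : Function.Bijective (fun z : ι ⊕ ι => (⟨Sum.elim p (fun i => G.rev (p i)) z, by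
      rcases z with i | i
      · exact ⟨i, Or.inl rfl⟩
      · exact ⟨i, Or.inr rfl⟩⟩ : {d // ∃ i, d = p i ∨ d = G.rev (p i)})) := by
    constructor
    · rintro (i | i) (j | j) h <;> simp only [Subtype.mk.injEq, Sum.elim_inl, Sum.elim_inr] at h
      · rw [hp h]
      · exact absurd h (hpr _ _)
      · exact absurd h.symm (hpr _ _)
      · rw [hp (G.rev.injective h)]
    · rintro ⟨d, i, h | h⟩
      · exact ⟨Sum.inl i, Subtype.ext h.symm⟩
      · exact ⟨Sum.inr i, Subtype.ext h.symm⟩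
  rw [← Nat.card_eq_of_bijective _ this, Nat.card_sum]
  ring

/-- **Discrete Poincaré lemma.** A group-valued function on the darts which is flat around the
quadrilaterals is the increment of a function on the vertices, as the quadrilaterals fill a disk.
By the Euler formula there are as many edges outside a spanning tree as there are quadrilaterals, so
these edges are the ones that lead from each quadrilateral to its parent in a tree of faces rooted at
the outer face.  After a change of gauge the function is trivial on the spanning tree; from the last
quadrilaterals of the tree of faces down to the root, flatness makes it trivial on all other
edges. -/
theorem exists_potential [Finite V] [Finite D] {H : Type*} [Group H] (g : D → H)
    (hrev : ∀ d, g (G.rev d) = (g d)⁻¹)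
    (hflat : ∀ d, G.Inner d →
      g (G.next (G.next (G.next d))) * g (G.next (G.next d)) * g (G.next d) * g d = 1) :
    ∃ φ : V → H, ∀ d, φ (G.tgt d) = g d * φ (G.src d) := by
  classical
  set root := G.src G.outer with hroot
  obtain ⟨depth, hdepth⟩ := exists_depth _ root (fun x => G.reflTransGen_to x root)
  have : ∀ x, ∃ d, x ≠ root → G.src d = x ∧ depth (G.tgt d) < depth x := by
    intro x
    by_cases hx : x = root
    · exact ⟨G.outer, fun h => absurd hx h⟩
    · obtain ⟨y, ⟨d, hd, rfl⟩, hlt⟩ := hdepth x hx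
      exact ⟨d, fun _ => ⟨hd, hlt⟩⟩
  choose pd hpd using this
  have hreach := G.face_reachable root depth pd (fun x hx => (hpd x hx).1) (fun x hx => (hpd x hx).2)
  obtain ⟨fdepth, hfdepth⟩ := exists_depth _ (G.face G.outer)
    (fun f => Quotient.inductionOn f hreach)
  have : ∀ f, ∃ d, f ≠ G.face G.outer →
      (∀ x, x ≠ root → d ≠ pd x ∧ d ≠ G.rev (pd x)) ∧ G.face d = f ∧
        fdepth (G.face (G.rev d)) < fdepth f := by
    intro f
    by_cases hf : f = G.face G.outer
    · exact ⟨G.outer, fun h => absurd hf h⟩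
    · obtain ⟨y, ⟨d, hd, hd', rfl⟩, hlt⟩ := hfdepth f hf
      exact ⟨d, fun _ => ⟨hd, hd', hlt⟩⟩
  choose pf hpf using this
  -- the two trees use up all edges
  have hcover : ∀ d, (∃ x : {x // x ≠ root}, d = pd x ∨ d = G.rev (pd x)) ∨
      ∃ f : {f // f ≠ G.face G.outer}, d = pf f ∨ d = G.rev (pf f) := by
    have c1 := G.card_darts_and_reverses (fun x : {x // x ≠ root} => pd x)
      (fun x y h => Subtype.ext (by rw [← (hpd x x.2).1, ← (hpd y y.2).1]; exact congrArg _ h))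
      (fun x y h => by
        have hx := hpd x x.2
        have hy := hpd y y.2
        rw [h] at hx
        rw [G.tgt_rev, hy.1, G.src_rev] at hx
        have := hx.2
        rw [← hx.1] at this
        omega)
    have c2 := G.card_darts_and_reverses (fun f : {f // f ≠ G.face G.outer} => pf f)
      (fun x y h => Subtype.ext (by
        rw [← (hpf x x.2).2.1, ← (hpf y y.2).2.1]; exact congrArg _ h))
      (fun x y h => by
        have hx := (hpf x x.2).2
        have hy := (hpf y y.2).2
        rw [h] at hx
        rw [G.rev_rev, hy.1] at hx
        have := hx.2
        rw [← hx.1] at this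
        omega)
    have cV : Nat.card {x // x ≠ root} + 1 = Nat.card V := by
      have := Fintype.ofFinite V
      rw [Nat.card_eq_fintype_card, Nat.card_eq_fintype_card, Fintype.card_subtype_compl,
        Fintype.card_subtype_eq]
      have : 0 < Fintype.card V := Fintype.card_pos_iff.2 ⟨root⟩
      omega
    have cF : Nat.card {f // f ≠ G.face G.outer} + 1
        = Nat.card (Quotient (Equiv.Perm.SameCycle.setoid (G.rot * G.rev))) := by
      have := Fintype.ofFinite (Quotient (Equiv.Perm.SameCycle.setoid (G.rot * G.rev)))
      rw [Nat.card_eq_fintype_card, Nat.card_eq_fintype_card, Fintype.card_subtype_compl,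
        Fintype.card_subtype_eq]
      have : 0 < Fintype.card (Quotient (Equiv.Perm.SameCycle.setoid (G.rot * G.rev))) :=
        Fintype.card_pos_iff.2 ⟨G.face G.outer⟩
      omega
    set T := {d | ∃ x : {x // x ≠ root}, d = pd x ∨ d = G.rev (pd x)}
    set U := {d | ∃ f : {f // f ≠ G.face G.outer}, d = pf f ∨ d = G.rev (pf f)}
    have hdisj : Disjoint T U := by
      rw [Set.disjoint_left]
      rintro d ⟨x, hx⟩ ⟨f, hf⟩
      have := (hpf f f.2).1 x x.2
      rcases hx with hx | hx <;> rcases hf with hf | hf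
      · exact this.1 (hf.symm.trans hx)
      · exact this.2 (by rw [← hx, hf, G.rev_rev])
      · exact this.2 (hf.symm.trans hx)
      · exact this.1 (G.rev.injective (hf.symm.trans hx))
    have hTU : T ∪ U = Set.univ := by
      apply Set.eq_of_subset_of_ncard_le (Set.subset_univ _) _ (Set.finite_univ)
      rw [Set.ncard_union_eq hdisj (Set.toFinite _) (Set.toFinite _), Set.ncard_univ]
      have e1 : T.ncard = _ := c1
      have e2 : U.ncard = _ := c2
      rw [e1, e2]
      have := G.euler
      omega
    intro d
    have : d ∈ T ∪ U := by rw [hTU]; trivial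
    exact this
  obtain ⟨φ, hφ⟩ := exists_eq_parent_rec root depth (fun x => G.tgt (pd x))
    (fun x hx => (hpd x hx).2) (1 : H) (fun x h => (g (pd x))⁻¹ * h)
  set k : D → H := fun d => (φ (G.tgt d))⁻¹ * g d * φ (G.src d) with hk
  have krev : ∀ d, k (G.rev d) = (k d)⁻¹ := by
    intro d
    simp only [hk, G.tgt_rev, G.src_rev, hrev, mul_inv_rev, inv_inv, mul_assoc]
  have ktree : ∀ x, x ≠ root → k (pd x) = 1 := by
    intro x hx
    simp only [hk, (hpd x hx).1, hφ x hx]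
    group
  have kflat : ∀ d, G.Inner d →
      k (G.next (G.next (G.next d))) * k (G.next (G.next d)) * k (G.next d) * k d = 1 := by
    intro d hd
    simp only [hk, G.src_next, G.tgt_next_three hd]
    have := hflat d hd
    calc _ = (φ (G.src d))⁻¹ * (g (G.next (G.next (G.next d))) * g (G.next (G.next d)) *
          g (G.next d) * g d) * φ (G.src d) := by group
      _ = 1 := by rw [this]; group
  have hfin : Finite (Quotient (Equiv.Perm.SameCycle.setoid (G.rot * G.rev))) := inferInstance
  obtain ⟨N, hN⟩ : ∃ N, ∀ f, fdepth f ≤ N := by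
    obtain ⟨N, hN⟩ := (Set.finite_range fdepth).bddAbove
    exact ⟨N, fun x => hN ⟨x, rfl⟩⟩
  have kface : ∀ m f, N - fdepth f = m → f ≠ G.face G.outer → k (pf f) = 1 := by
    intro m
    induction m using Nat.strong_induction_on with
    | _ m ih =>
      intro f hm hf
      obtain ⟨-, hff, hlt⟩ := hpf f hf
      have hinner : G.Inner (pf f) := G.inner_iff_face.2 (by rwa [hff])
      have other : ∀ e, G.face e = f → e ≠ pf f → k e = 1 := by
        intro e he hne
        rcases hcover e with ⟨x, hx | hx⟩ | ⟨f', hx | hx⟩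
        · rw [hx]; exact ktree x x.2
        · rw [hx, krev, ktree x x.2, inv_one]
        · have : (f' : Quotient _) = f := by rw [← (hpf f' f'.2).2.1, ← hx, he]
          exact absurd (this ▸ hx) hne
        · have h3 := (hpf f' f'.2).2.2
          rw [← hx, he] at h3
          rw [hx, krev, ih (N - fdepth f') (by have := hN f; have := hN f'; omega) f' rfl f'.2,
            inv_one]
      have same : ∀ d, G.face (G.next d) = G.face d := fun d =>
        G.face_eq_iff.2 (Equiv.Perm.sameCycle_apply_left.2 (Equiv.Perm.SameCycle.refl _ _))
      have h1 := other (G.next (pf f)) (by rw [same, hff])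
        (G.iterate_next_ne hinner (k := 1) (by norm_num) (by norm_num))
      have h2 := other (G.next (G.next (pf f))) (by rw [same, same, hff])
        (G.iterate_next_ne hinner (k := 2) (by norm_num) (by norm_num))
      have h3 := other (G.next (G.next (G.next (pf f)))) (by rw [same, same, same, hff])
        (G.iterate_next_ne hinner (k := 3) (by norm_num) (by norm_num))
      have := kflat _ hinner
      rwa [h1, h2, h3, one_mul, one_mul, one_mul] at this
  have kall : ∀ d, k d = 1 := by
    intro d
    rcases hcover d with ⟨x, hx | hx⟩ | ⟨f, hx | hx⟩
    · rw [hx]; exact ktree x x.2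
    · rw [hx, krev, ktree x x.2, inv_one]
    · rw [hx]; exact kface _ f rfl f.2
    · rw [hx, krev, kface _ f rfl f.2, inv_one]
  refine ⟨φ, fun d => ?_⟩
  have := kall d
  simp only [hk, mul_assoc] at this
  exact (inv_mul_eq_one.1 this)

end PlaneQuadGraph

namespace PlaneQuadGraph

variable {V D : Type*} (G : PlaneQuadGraph V D)

/-! ### Strips and their two sides -/

theorem strip_rev (d : D) : G.strip (G.rev d) = G.strip d :=
  (Quotient.sound (s := Relation.EqvGen.setoid G.StripStep)
    (Relation.EqvGen.rel d _ (Or.inl rfl))).symm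

theorem strip_next_next {d : D} (hd : G.Inner d) : G.strip (G.next (G.next d)) = G.strip d :=
  (Quotient.sound (s := Relation.EqvGen.setoid G.StripStep)
    (Relation.EqvGen.rel d _ (Or.inr ⟨hd, rfl⟩))).symm

/-- Two darts cross a strip in the same direction: one leads to the other through
quadrilaterals, always passing to the opposite edge. -/
def Coherent : D → D → Prop :=
  Relation.EqvGen fun d d' => G.Inner d ∧ d' = G.rev (G.next (G.next d))

theorem Coherent.symm {d d' : D} (h : G.Coherent d d') : G.Coherent d' d :=
  Relation.EqvGen.symm _ _ h

theorem Coherent.trans {d d' d'' : D} (h : G.Coherent d d') (h' : G.Coherent d' d'') :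
    G.Coherent d d'' :=
  Relation.EqvGen.trans _ _ _ h h'

theorem Coherent.strip_eq {d d' : D} (h : G.Coherent d d') : G.strip d = G.strip d' := by
  induction h with
  | rel d d' h => rw [h.2, G.strip_rev, G.strip_next_next h.1]
  | refl => rfl
  | symm _ _ _ ih => exact ih.symm
  | trans _ _ _ _ _ ih1 ih2 => exact ih1.trans ih2

theorem Coherent.rev {d d' : D} (h : G.Coherent d d') : G.Coherent (G.rev d) (G.rev d') := by
  induction h with
  | rel d d' h =>
    obtain ⟨hd, rfl⟩ := h
    refine (Relation.EqvGen.rel _ _ ⟨?_, ?_⟩).symm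
    · rw [G.rev_rev]; exact G.inner_next (G.inner_next hd)
    · rw [G.rev_rev, G.next_four hd]
  | refl => exact Relation.EqvGen.refl _
  | symm _ _ _ ih => exact Coherent.symm G ih
  | trans _ _ _ _ _ ih1 ih2 => exact ih1.trans G ih2

theorem coherent_or {d d' : D} (h : G.strip d = G.strip d') :
    G.Coherent d d' ∨ G.Coherent d (G.rev d') := by
  have h' : Relation.EqvGen G.StripStep d d' := Quotient.exact h
  clear h
  induction h' with
  | rel d d' h =>
    rcases h with rfl | ⟨hd, rfl⟩
    · exact Or.inr (by rw [G.rev_rev]; exact Relation.EqvGen.refl _)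
    · exact Or.inr (Relation.EqvGen.rel _ _ ⟨hd, rfl⟩)
  | refl => exact Or.inl (Relation.EqvGen.refl _)
  | symm _ _ _ ih =>
    rcases ih with h | h
    · exact Or.inl (h.symm G)
    · exact Or.inr (by have := (Coherent.rev G h).symm G; rwa [G.rev_rev] at this)
  | trans _ _ _ _ _ ih1 ih2 =>
    rcases ih1 with h | h <;> rcases ih2 with h' | h'
    · exact Or.inl (h.trans G h')
    · exact Or.inr (h.trans G h')
    · exact Or.inr (h.trans G (Coherent.rev G h'))
    · exact Or.inl (by have := h.trans G (Coherent.rev G h'); rwa [G.rev_rev] at this)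

open Classical in
/-- The two sides of a strip: the parity of the number of times that a path from a base point crosses
the strip depends on the end of the path only. -/
theorem exists_side [Finite V] [Finite D] (s : G.Strip) :
    ∃ φ : V → ZMod 2, ∀ d, φ (G.tgt d) = (if G.strip d = s then 1 else 0) + φ (G.src d) := by
  obtain ⟨φ, hφ⟩ := G.exists_potential
    (fun d => Multiplicative.ofAdd (if G.strip d = s then (1 : ZMod 2) else 0))
    (fun d => by
      rw [G.strip_rev, ← ofAdd_neg]
      congr 1
      split_ifs <;> decide)
    (fun d hd => by
      rw [G.strip_next_next hd, G.strip_next_next (G.inner_next hd), ← ofAdd_add, ← ofAdd_add,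
        ← ofAdd_add]
      split_ifs <;> decide)
  exact ⟨fun x => (φ x).toAdd, fun d => congrArg Multiplicative.toAdd (hφ d)⟩

/-- The side of a strip on which a vertex lies. -/
noncomputable def side [Finite V] [Finite D] (s : G.Strip) : V → ZMod 2 :=
  (G.exists_side s).choose

section Side

variable [Finite V] [Finite D]

theorem side_tgt {s : G.Strip} {d : D} (h : G.strip d = s) :
    G.side s (G.tgt d) = 1 + G.side s (G.src d) := by
  rw [side, (G.exists_side s).choose_spec d, if_pos h]

theorem side_tgt_of_ne {s : G.Strip} {d : D} (h : G.strip d ≠ s) :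
    G.side s (G.tgt d) = G.side s (G.src d) := by
  rw [side, (G.exists_side s).choose_spec d, if_neg h, zero_add]

theorem side_tgt_ne {s : G.Strip} {d : D} (h : G.strip d = s) :
    G.side s (G.tgt d) ≠ G.side s (G.src d) := by
  rw [G.side_tgt h]
  generalize G.side s (G.src d) = z
  revert z; decide

theorem side_eq_of_ne_of_ne {s : G.Strip} {x y z : V} (h1 : G.side s x ≠ G.side s z)
    (h2 : G.side s y ≠ G.side s z) : G.side s x = G.side s y := by
  generalize G.side s x = a at *
  generalize G.side s y = b at *
  generalize G.side s z = c at *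
  revert a b c; decide

/-- If the sources of coherent darts are on different sides of a strip `s`, then `s` crosses their
strip. -/
theorem Coherent.exists_crossing {s : G.Strip} {d d' : D} (h : G.Coherent d d')
    (hs : G.side s (G.src d) ≠ G.side s (G.src d')) :
    ∃ f, G.Inner f ∧ G.strip f = G.strip d ∧ G.strip (G.next f) = s := by
  induction h with
  | rel d d' h =>
    obtain ⟨hd, rfl⟩ := h
    refine ⟨d, hd, rfl, ?_⟩
    by_contra hne
    apply hs
    rw [G.src_rev, ← G.src_next, ← G.tgt_next_three hd, G.side_tgt_of_ne]
    rwa [G.strip_next_next (G.inner_next hd)]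
  | refl => exact absurd rfl hs
  | symm _ _ h ih =>
    obtain ⟨f, h1, h2, h3⟩ := ih hs.symm
    exact ⟨f, h1, h2.trans (Coherent.strip_eq G h), h3⟩
  | trans x y z h1 h2 ih1 ih2 =>
    by_cases hxy : G.side s (G.src x) = G.side s (G.src y)
    · obtain ⟨f, h3, h4, h5⟩ := ih2 (hxy ▸ hs)
      exact ⟨f, h3, h4.trans (Coherent.strip_eq G h1).symm, h5⟩
    · exact ih1 hxy

/-- A strip with edges on both sides of another strip `s` is crossed by `s`. -/
theorem exists_crossing {s : G.Strip} {d d' : D} (h : G.strip d = G.strip d') (hd : G.strip d ≠ s)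
    (hs : G.side s (G.src d) ≠ G.side s (G.src d')) :
    ∃ f, G.Inner f ∧ G.strip f = G.strip d ∧ G.strip (G.next f) = s := by
  rcases G.coherent_or h with h1 | h1
  · exact Coherent.exists_crossing G h1 hs
  · refine Coherent.exists_crossing G h1 ?_
    rwa [G.src_rev, G.side_tgt_of_ne (by rwa [← h])]

variable {G}

/-- Coherent darts start on the same side of their strip, as the strip does not intersect itself. -/
theorem Coherent.side_src (hG : G.NoSelfIntersection) {d d' : D} (h : G.Coherent d d') :
    G.side (G.strip d) (G.src d) = G.side (G.strip d) (G.src d') := by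
  by_contra hne
  obtain ⟨f, hf, h1, h2⟩ := Coherent.exists_crossing G h hne
  exact hG f hf (h1.trans h2.symm)

theorem coherent_of_side (hG : G.NoSelfIntersection) {d d' : D} (h : G.strip d = G.strip d')
    (hs : G.side (G.strip d) (G.src d) = G.side (G.strip d) (G.src d')) : G.Coherent d d' := by
  rcases G.coherent_or h with h1 | h1
  · exact h1
  · have := Coherent.side_src hG h1
    rw [hs, G.src_rev] at this
    exact absurd this.symm (G.side_tgt_ne h.symm)

end Side

/-- The edge of `d` belongs to a quadrilateral. -/
def Bordering (d : D) : Prop := G.Inner d ∨ G.Inner (G.rev d)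

theorem bordering_rev {d : D} : G.Bordering (G.rev d) ↔ G.Bordering d := by
  rw [Bordering, Bordering, G.rev_rev, or_comm]

theorem Inner.bordering {G : PlaneQuadGraph V D} {d : D} (h : G.Inner d) : G.Bordering d := Or.inl h

/-- An edge that belongs to no quadrilateral is a strip by itself. -/
theorem eq_or_eq_rev_of_not_bordering {d d' : D} (hd : ¬ G.Bordering d)
    (h : G.strip d = G.strip d') : d' = d ∨ d' = G.rev d := by
  have key : ∀ {e e'}, G.Coherent e e' → (e = d ∨ e = G.rev d) ∨ (e' = d ∨ e' = G.rev d) →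
      e = e' := by
    intro e e' h
    induction h with
    | rel e e' h =>
      obtain ⟨he, rfl⟩ := h
      have h2 := G.inner_next (G.inner_next he)
      rintro ((rfl | rfl) | (h | h))
      · exact absurd (Or.inl he) hd
      · exact absurd (Or.inr he) hd
      · rw [← h, G.bordering_rev] at hd; exact absurd (Or.inl h2) hd
      · rw [G.rev.injective h] at h2; exact absurd (Or.inl h2) hd
    | refl => exact fun _ => rfl
    | symm _ _ _ ih => exact fun h => (ih h.symm).symm
    | trans x y z _ _ ih1 ih2 =>
      rintro (h | h)
      · have := ih1 (Or.inl h); exact this.trans (ih2 (Or.inl (this ▸ h)))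
      · have := ih2 (Or.inr h); exact (ih1 (Or.inr (this.symm ▸ h))).trans this
  rcases G.coherent_or h with h | h
  · exact Or.inl (key h (Or.inl (Or.inl rfl))).symm
  · right
    rw [key h (Or.inl (Or.inl rfl)), G.rev_rev]

end PlaneQuadGraph

open MvPolynomial in
/-- A polynomial of degree at most one in each of four variables is the sum of its sixteen terms. -/
theorem MvPolynomial.eq_sum_of_degreeOf_le_one {R : Type*} [CommSemiring R]
    (q : MvPolynomial (Fin 4) R) (hq : ∀ i, q.degreeOf i ≤ 1) :
    q = ∑ i : Fin 2, ∑ j : Fin 2, ∑ k : Fin 2, ∑ l : Fin 2,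
      monomial (Finsupp.equivFunOnFinite.symm ![(i : ℕ), (j : ℕ), (k : ℕ), (l : ℕ)])
        (q.coeff (Finsupp.equivFunOnFinite.symm ![(i : ℕ), (j : ℕ), (k : ℕ), (l : ℕ)])) := by
  classical
  set idx : Fin 2 × Fin 2 × Fin 2 × Fin 2 → Fin 4 →₀ ℕ := fun t =>
    Finsupp.equivFunOnFinite.symm ![(t.1 : ℕ), (t.2.1 : ℕ), (t.2.2.1 : ℕ), (t.2.2.2 : ℕ)] with hidx
  have hinj : Function.Injective idx := by
    rintro ⟨i, j, k, l⟩ ⟨i', j', k', l'⟩ h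
    have h' := Finsupp.equivFunOnFinite.symm.injective h
    have h0 := congrFun h' 0
    have h1 := congrFun h' 1
    have h2 := congrFun h' 2
    have h3 := congrFun h' 3
    simp only [Matrix.cons_val] at h0 h1 h2 h3
    simp only [Prod.mk.injEq]
    exact ⟨Fin.ext h0, Fin.ext h1, Fin.ext h2, Fin.ext h3⟩
  have hsub : q.support ⊆ Finset.univ.image idx := by
    intro m hm
    have hle : ∀ i, m i < 2 := fun i =>
      Nat.lt_succ_of_le ((MvPolynomial.degreeOf_le_iff.1 (hq i)) m hm)
    refine Finset.mem_image.2 ⟨(⟨m 0, hle 0⟩, ⟨m 1, hle 1⟩, ⟨m 2, hle 2⟩, ⟨m 3, hle 3⟩),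
      Finset.mem_univ _, ?_⟩
    ext i
    fin_cases i <;> rfl
  conv_lhs => rw [← q.support_sum_monomial_coeff]
  rw [Finset.sum_subset hsub (fun m _ hm => by rw [notMem_support_iff.1 hm, monomial_zero]),
    Finset.sum_image (fun a _ b _ h => hinj h)]
  simp only [Fintype.sum_prod_type, hidx]

/-- The representative `(1, t)` of the point `t` of the projective line. -/
def vec {R : Type*} [One R] (t : R) : Fin 2 → R := ![1, t]

@[simp] theorem vec_zero {R : Type*} [One R] (t : R) : vec t 0 = 1 := rfl

@[simp] theorem vec_one {R : Type*} [One R] (t : R) : vec t 1 = t := rfl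

/-- The wedge product of two vectors of the plane; it vanishes if they represent the same point of
the projective line. -/
def wedge {R : Type*} [CommRing R] (u w : Fin 2 → R) : R := u 0 * w 1 - u 1 * w 0

namespace QuadEquation

variable (E : QuadEquation)

/-! ### The equation as a quadrilinear form -/

/-- The coefficients of the polynomial `Q`, indexed by the degrees in the four fields. -/
noncomputable def coef (α β : ℂ) (i j k l : Fin 2) : ℂ :=
  (E.Q α β).coeff (Finsupp.equivFunOnFinite.symm ![(i : ℕ), (j : ℕ), (k : ℕ), (l : ℕ)])

section Form

variable {R S : Type*} [CommRing R] [Algebra ℂ R] [CommRing S] [Algebra ℂ S]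

/-- The bilinear form in the fields `v₂, v₁₂`, in homogeneous coordinates, which the multilinear
polynomial `Q` becomes when `v, v₁` are fixed. -/
noncomputable def edgeForm (α β : ℂ) (x y : Fin 2 → R) (k l : Fin 2) : R :=
  ∑ i, ∑ j, algebraMap ℂ R (E.coef α β i j k l) * (x i * y j)

/-- The quadrilinear form obtained from `Q` by passing to homogeneous coordinates in each field. -/
noncomputable def form (α β : ℂ) (x y z w : Fin 2 → R) : R :=
  ∑ k, ∑ l, E.edgeForm α β x y k l * (z k * w l)

/-- The matrix of the projective map `v₂ ↦ v₁₂` which the equation defines for given `v, v₁`. -/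
noncomputable def transfer (α β : ℂ) (x y : Fin 2 → R) : Matrix (Fin 2) (Fin 2) R :=
  !![E.edgeForm α β x y 0 1, E.edgeForm α β x y 1 1;
    -E.edgeForm α β x y 0 0, -E.edgeForm α β x y 1 0]

theorem map_edgeForm (f : R →ₐ[ℂ] S) (α β : ℂ) (x y : Fin 2 → R) (k l : Fin 2) :
    f (E.edgeForm α β x y k l) = E.edgeForm α β (f ∘ x) (f ∘ y) k l := by
  simp [edgeForm]

theorem map_form (f : R →ₐ[ℂ] S) (α β : ℂ) (x y z w : Fin 2 → R) :
    f (E.form α β x y z w) = E.form α β (f ∘ x) (f ∘ y) (f ∘ z) (f ∘ w) := by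
  simp [form, map_edgeForm]

theorem map_transfer (f : R →ₐ[ℂ] S) (α β : ℂ) (x y : Fin 2 → R) :
    (E.transfer α β x y).map f = E.transfer α β (f ∘ x) (f ∘ y) := by
  ext i j
  fin_cases i <;> fin_cases j <;> simp [transfer, map_edgeForm]

theorem comp_transfer_mulVec (f : R →ₐ[ℂ] S) (α β : ℂ) (x y z : Fin 2 → R) :
    f ∘ (E.transfer α β x y).mulVec z = (E.transfer α β (f ∘ x) (f ∘ y)).mulVec (f ∘ z) := by
  rw [← map_transfer]
  exact RingHom.map_mulVec f.toRingHom _ _ |> fun h => funext (h ·)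

theorem comp_vec (f : R →ₐ[ℂ] S) (t : R) : f ∘ vec t = vec (f t) := by
  ext i
  fin_cases i <;> simp [vec]

theorem edgeForm_smul_left (α β : ℂ) (c : R) (x y : Fin 2 → R) (k l : Fin 2) :
    E.edgeForm α β (c • x) y k l = c * E.edgeForm α β x y k l := by
  simp only [edgeForm, Fin.sum_univ_two, Pi.smul_apply, smul_eq_mul]
  ring

theorem edgeForm_smul_right (α β : ℂ) (c : R) (x y : Fin 2 → R) (k l : Fin 2) :
    E.edgeForm α β x (c • y) k l = c * E.edgeForm α β x y k l := by
  simp only [edgeForm, Fin.sum_univ_two, Pi.smul_apply, smul_eq_mul]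
  ring

theorem transfer_smul_right (α β : ℂ) (c : R) (x y : Fin 2 → R) :
    E.transfer α β x (c • y) = c • E.transfer α β x y := by
  ext i j
  fin_cases i <;> fin_cases j <;> simp [transfer, edgeForm_smul_right]

theorem form_smul_smul_smul_smul (α β : ℂ) (a b c d : R) (x y z w : Fin 2 → R) :
    E.form α β (a • x) (b • y) (c • z) (d • w) = a * b * c * d * E.form α β x y z w := by
  simp only [form, edgeForm_smul_left, edgeForm_smul_right, Fin.sum_univ_two, Pi.smul_apply,
    smul_eq_mul]
  ring

theorem det_transfer (α β : ℂ) (x y : Fin 2 → R) :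
    (E.transfer α β x y).det = E.edgeForm α β x y 0 0 * E.edgeForm α β x y 1 1
      - E.edgeForm α β x y 0 1 * E.edgeForm α β x y 1 0 := by
  rw [Matrix.det_fin_two, transfer]
  simp only [Matrix.of_apply, Matrix.cons_val', Matrix.cons_val_zero, Matrix.cons_val_one,
    Matrix.cons_val_fin_one]
  ring

theorem transfer_mulVec_zero (α β : ℂ) (x y z : Fin 2 → R) :
    (E.transfer α β x y).mulVec z 0 = E.form α β x y z ![0, 1] := by
  simp only [transfer, form, Matrix.mulVec, dotProduct, Fin.sum_univ_two, Matrix.of_apply,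
    Matrix.cons_val', Matrix.cons_val_zero, Matrix.cons_val_one, Matrix.cons_val_fin_one]
  ring

theorem transfer_mulVec_one (α β : ℂ) (x y z : Fin 2 → R) :
    (E.transfer α β x y).mulVec z 1 = -E.form α β x y z ![1, 0] := by
  simp only [transfer, form, Matrix.mulVec, dotProduct, Fin.sum_univ_two, Matrix.of_apply,
    Matrix.cons_val', Matrix.cons_val_zero, Matrix.cons_val_one, Matrix.cons_val_fin_one]
  ring

/-- The form is the wedge product of `w` with the image of `z` under the transfer matrix. -/
theorem form_eq_wedge (α β : ℂ) (x y z w : Fin 2 → R) :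
    E.form α β x y z w = wedge ((E.transfer α β x y).mulVec z) w := by
  rw [wedge, transfer_mulVec_zero, transfer_mulVec_one]
  simp only [form, Fin.sum_univ_two, Matrix.cons_val_zero, Matrix.cons_val_one,
    Matrix.cons_val_fin_one]
  ring

/-- On a solution the first term vanishes, so that the determinant of the transfer matrix is minus the
product of the derivatives with respect to `v₁₂` and `v₂`. -/
theorem det_transfer_vec (α β : ℂ) (x y : Fin 2 → R) (c d : R) :
    (E.transfer α β x y).det = E.form α β x y (vec c) (vec d) * E.form α β x y ![0, 1] ![0, 1]
      - E.form α β x y (vec c) ![0, 1] * E.form α β x y ![0, 1] (vec d) := by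
  rw [det_transfer]
  simp only [form, Fin.sum_univ_two, Matrix.cons_val_zero, Matrix.cons_val_one,
    Matrix.cons_val_fin_one, vec_zero, vec_one]
  ring

end Form

open MvPolynomial in
/-- The polynomial `Q` is the form at the generic point. -/
theorem Q_eq_form (α β : ℂ) : E.Q α β = E.form α β (R := MvPolynomial (Fin 4) ℂ)
    (vec (X 0)) (vec (X 1)) (vec (X 2)) (vec (X 3)) := by
  have h : ∀ (i j k l : Fin 2) (c : ℂ), monomial (Finsupp.equivFunOnFinite.symm
      ![(i : ℕ), (j : ℕ), (k : ℕ), (l : ℕ)]) c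
      = algebraMap ℂ (MvPolynomial (Fin 4) ℂ) c * (vec (X 0) i * vec (X 1) j) *
        (vec (X 2) k * vec (X 3) l) := by
    intro i j k l c
    have hv : ∀ (n : Fin 4) (i : Fin 2), (vec (X n : MvPolynomial (Fin 4) ℂ)) i = X n ^ (i : ℕ) := by
      intro n i
      fin_cases i <;> simp [vec]
    rw [monomial_eq, Finsupp.prod_fintype _ _ (fun i => by simp), Fin.prod_univ_four]
    simp only [hv, Finsupp.equivFunOnFinite_symm_apply_apply, Matrix.cons_val, algebraMap_eq]
    ring
  conv_lhs => rw [MvPolynomial.eq_sum_of_degreeOf_le_one _ (E.degree_le_one α β)]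
  simp only [h, form, edgeForm, coef, Fin.sum_univ_two]
  ring

theorem val_eq_form (α β a b c d : ℂ) :
    E.val α β a b c d = E.form α β (vec a) (vec b) (vec c) (vec d) := by
  rw [val, Q_eq_form, ← MvPolynomial.coe_aeval_eq_eval]
  change MvPolynomial.aeval ![a, b, c, d] _ = _
  rw [map_form]
  simp only [comp_vec, MvPolynomial.aeval_X, Matrix.cons_val]

/-- The sixteen coefficients of a multilinear polynomial are determined by its values. -/
theorem eq_of_forall_sum_eq {c c' : Fin 2 → Fin 2 → Fin 2 → Fin 2 → ℂ}
    (h : ∀ a b d e : ℂ, ∑ k, ∑ l, (∑ i, ∑ j, c i j k l * (vec a i * vec b j)) * (vec d k * vec e l)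
      = ∑ k, ∑ l, (∑ i, ∑ j, c' i j k l * (vec a i * vec b j)) * (vec d k * vec e l)) (i j k l) :
    c i j k l = c' i j k l := by
  simp only [Fin.sum_univ_two, vec_zero, vec_one] at h
  have h0000 := h 0 0 0 0
  have h1000 := h 1 0 0 0
  have h0100 := h 0 1 0 0
  have h1100 := h 1 1 0 0
  have h0010 := h 0 0 1 0
  have h1010 := h 1 0 1 0
  have h0110 := h 0 1 1 0
  have h1110 := h 1 1 1 0
  have h0001 := h 0 0 0 1
  have h1001 := h 1 0 0 1
  have h0101 := h 0 1 0 1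
  have h1101 := h 1 1 0 1
  have h0011 := h 0 0 1 1
  have h1011 := h 1 0 1 1
  have h0111 := h 0 1 1 1
  have h1111 := h 1 1 1 1
  clear h
  fin_cases i <;> fin_cases j <;> fin_cases k <;> fin_cases l <;>
    simp only [Fin.zero_eta, Fin.mk_one, Fin.isValue] <;> grind

theorem exists_coef_diag : ∃ ε : ℂ, (ε = 1 ∨ ε = -1) ∧ ∀ α β i j k l,
    E.coef α β i j k l = ε * E.coef β α i k j l := by
  obtain ⟨ε, hε, h⟩ := E.symm_diag
  refine ⟨ε, hε, fun α β i j k l => ?_⟩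
  refine eq_of_forall_sum_eq (c := fun i j k l => E.coef α β i j k l)
    (c' := fun i j k l => ε * E.coef β α i k j l) (fun a b d e => ?_) i j k l
  have := h α β a b d e
  change E.val α β a b d e = ε * E.val β α a d b e at this
  rw [val_eq_form, val_eq_form] at this
  simp only [form, edgeForm, Fin.sum_univ_two, Algebra.algebraMap_self, RingHom.id_apply] at this ⊢
  rw [this]
  ring

theorem exists_coef_side : ∃ σ : ℂ, (σ = 1 ∨ σ = -1) ∧ ∀ α β i j k l,
    E.coef α β i j k l = σ * E.coef α β j i l k := by
  obtain ⟨ε, hε, h⟩ := E.symm_side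
  refine ⟨ε, hε, fun α β i j k l => ?_⟩
  refine eq_of_forall_sum_eq (c := fun i j k l => E.coef α β i j k l)
    (c' := fun i j k l => ε * E.coef α β j i l k) (fun a b d e => ?_) i j k l
  have := h α β a b d e
  change E.val α β a b d e = ε * E.val α β b a e d at this
  rw [val_eq_form, val_eq_form] at this
  simp only [form, edgeForm, Fin.sum_univ_two, Algebra.algebraMap_self, RingHom.id_apply] at this ⊢
  rw [this]
  ring

section Symmetry

variable {R : Type*} [CommRing R] [Algebra ℂ R]

theorem exists_form_diag : ∃ ε : ℂ, ε ≠ 0 ∧ ∀ α β (x y z w : Fin 2 → R),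
    E.form α β x y z w = algebraMap ℂ R ε * E.form β α x z y w := by
  obtain ⟨ε, hε, h⟩ := E.exists_coef_diag
  refine ⟨ε, by rcases hε with rfl | rfl <;> norm_num, fun α β x y z w => ?_⟩
  simp only [form, edgeForm, Fin.sum_univ_two, h α β, map_mul]
  ring

theorem exists_form_side : ∃ σ : ℂ, σ ≠ 0 ∧ ∀ α β (x y z w : Fin 2 → R),
    E.form α β x y z w = algebraMap ℂ R σ * E.form α β y x w z := by
  obtain ⟨σ, hσ, h⟩ := E.exists_coef_side
  refine ⟨σ, by rcases hσ with rfl | rfl <;> norm_num, fun α β x y z w => ?_⟩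
  have key : ∀ k l, E.edgeForm α β x y k l = algebraMap ℂ R σ * E.edgeForm α β y x l k := by
    intro k l
    simp only [edgeForm, Fin.sum_univ_two, h α β _ _ k l, map_mul]
    ring
  simp only [form, Fin.sum_univ_two, key]
  ring

/-- The equation of a quadrilateral does not depend on the corner from which it is read. -/
theorem exists_form_rotate : ∃ τ : ℂ, τ ≠ 0 ∧ ∀ α β (x y z w : Fin 2 → R),
    E.form β α y w x z = algebraMap ℂ R τ * E.form α β x y z w := by
  obtain ⟨ε, hε, h⟩ := E.exists_form_diag (R := R)
  obtain ⟨σ, hσ, h'⟩ := E.exists_form_side (R := R)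
  refine ⟨ε * σ, mul_ne_zero hε hσ, fun α β x y z w => ?_⟩
  rw [h β α, h' α β y x, map_mul, mul_assoc]

/-- Reversing an edge inverts its transfer matrix, up to a scalar factor. -/
theorem exists_transfer_swap : ∃ σ : ℂ, σ ≠ 0 ∧ ∀ α β (x y : Fin 2 → R),
    E.transfer α β y x = algebraMap ℂ R σ • (E.transfer α β x y).adjugate := by
  obtain ⟨σ, hσ', h⟩ := E.exists_coef_side
  have hσ : σ ≠ 0 := by rcases hσ' with rfl | rfl <;> norm_num
  refine ⟨-σ, neg_ne_zero.2 hσ, fun α β x y => ?_⟩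
  have key : ∀ k l, E.edgeForm α β y x k l = algebraMap ℂ R σ * E.edgeForm α β x y l k := by
    intro k l
    simp only [edgeForm, Fin.sum_univ_two, h α β _ _ k l, map_mul]
    ring
  ext i j
  fin_cases i <;> fin_cases j <;> simp [transfer, key, Matrix.adjugate_fin_two]

end Symmetry

end QuadEquation

/-! ### Nondegenerate parameters -/

namespace MvPolynomial

variable {σ : Type*}

/-- The discriminant of a polynomial of degree at most one in the variables `i` and `j`: it vanishes if
the polynomial is a product of factors that depend on one of the two variables only. -/
noncomputable def biaffineDisc (i j : σ) (q : MvPolynomial σ ℂ) : MvPolynomial σ ℂ :=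
  q * pderiv i (pderiv j q) - pderiv i q * pderiv j q

theorem pderiv_pderiv_comm (i j : σ) (q : MvPolynomial σ ℂ) :
    pderiv i (pderiv j q) = pderiv j (pderiv i q) := by
  have h : (⁅pderiv (R := ℂ) i, pderiv j⁆ : Derivation ℂ (MvPolynomial σ ℂ) _) = 0 := by
    apply MvPolynomial.derivation_ext
    intro k
    classical
    rw [Derivation.commutator_apply, pderiv_X, pderiv_X]
    simp [Pi.single_apply, apply_ite]
  have := congrArg (fun D : Derivation ℂ (MvPolynomial σ ℂ) (MvPolynomial σ ℂ) => D q) h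
  rw [Derivation.commutator_apply] at this
  exact sub_eq_zero.1 this

theorem degreeOf_pderiv_lt {i : σ} {q : MvPolynomial σ ℂ} (hq : q.degreeOf i ≤ 1) :
    (pderiv i q).degreeOf i = 0 := by
  classical
  have h : ∀ m ∈ q.support, (pderiv i (monomial m (q.coeff m))).degreeOf i = 0 := by
    intro m hm
    rw [pderiv_monomial]
    have hmi := degreeOf_le_iff.1 hq m hm
    refine Nat.le_zero.1 ((degreeOf_le_iff).2 fun m' hm' => ?_)
    have := Finset.mem_singleton.1 (support_monomial_subset hm')
    rw [this, Finsupp.tsub_apply, Finsupp.single_eq_same]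
    omega
  rw [q.as_sum, map_sum]
  exact Nat.le_zero.1 ((degreeOf_sum_le i _ _).trans (Finset.sup_le fun m hm => (h m hm).le))

theorem pderiv_eq_zero_of_degreeOf_eq_zero {i : σ} {q : MvPolynomial σ ℂ} (hq : q.degreeOf i = 0) :
    pderiv i q = 0 :=
  pderiv_eq_zero_of_notMem_vars fun h => by
    classical
    rw [vars_def, Multiset.mem_toFinset, ← Multiset.count_pos] at h
    rw [degreeOf_def] at hq
    omega

/-- An irreducible multilinear polynomial does not divide products of its derivatives, as they
have lower degree. -/
theorem biaffineDisc_ne_zero {q : MvPolynomial σ ℂ} (hirr : Irreducible q)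
    (hdeg : ∀ i, q.degreeOf i ≤ 1) {i j : σ} (hi : pderiv i q ≠ 0) (hj : pderiv j q ≠ 0) :
    biaffineDisc i j q ≠ 0 := by
  have aux : ∀ i, pderiv i q ≠ 0 → ¬ q ∣ pderiv i q := by
    intro i hi ⟨c, hc⟩
    have h1 := degreeOf_pderiv_lt (hdeg i)
    have hc0 : c ≠ 0 := by rintro rfl; rw [mul_zero] at hc; exact hi hc
    rw [hc, degreeOf_mul_eq hirr.ne_zero hc0] at h1
    exact hi (pderiv_eq_zero_of_degreeOf_eq_zero (by omega))
  intro h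
  have hdvd : q ∣ pderiv i q * pderiv j q := ⟨_, (sub_eq_zero.1 h).symm⟩
  rcases (UniqueFactorizationMonoid.irreducible_iff_prime.1 hirr).dvd_or_dvd hdvd with h | h
  · exact aux i hi h
  · exact aux j hj h

theorem exists_degreeOf_pos {q : MvPolynomial σ ℂ} (hq0 : q ≠ 0) (hq : ¬ IsUnit q) :
    ∃ i, 0 < q.degreeOf i := by
  by_contra! h
  have h0 : ∀ i, q.degreeOf i = 0 := fun i => Nat.le_zero.1 (h i)
  have hv : q.vars = ∅ := by
    classical
    ext i
    simp only [Finset.notMem_empty, iff_false]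
    intro hi
    rw [vars_def, Multiset.mem_toFinset, ← Multiset.count_pos] at hi
    have := h0 i
    rw [degreeOf_def] at this
    omega
  obtain ⟨c, rfl⟩ : ∃ c, q = C c := by
    exact ⟨q.coeff 0, vars_eq_empty_iff_eq_C.1 hv⟩
  have hc : c ≠ 0 := by rintro rfl; exact hq0 C_0
  exact hq ((isUnit_iff_ne_zero.2 hc).map C)

/-- A multilinear polynomial all of whose discriminants are nonzero is irreducible: factors depend
on disjoint sets of variables. -/
theorem irreducible_of_biaffineDisc_ne_zero {q : MvPolynomial σ ℂ} (hdeg : ∀ i, q.degreeOf i ≤ 1)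
    {a b : σ} (hab : a ≠ b) (h : ∀ i j, i ≠ j → biaffineDisc i j q ≠ 0) : Irreducible q := by
  have hq0 : q ≠ 0 := by
    rintro rfl
    exact h a b hab (by simp [biaffineDisc])
  refine ⟨fun hu => ?_, fun f g hfg => ?_⟩
  · obtain ⟨c, -, rfl⟩ := isUnit_iff_eq_C_of_isReduced.1 hu
    exact h a b hab (by simp [biaffineDisc])
  · by_contra! hfg'
    have hf0 : f ≠ 0 := by rintro rfl; exact hq0 (by rw [hfg, zero_mul])
    have hg0 : g ≠ 0 := by rintro rfl; exact hq0 (by rw [hfg, mul_zero])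
    obtain ⟨i, hi⟩ := exists_degreeOf_pos hf0 hfg'.1
    obtain ⟨j, hj⟩ := exists_degreeOf_pos hg0 hfg'.2
    have hdi := hdeg i
    have hdj := hdeg j
    rw [hfg, degreeOf_mul_eq hf0 hg0] at hdi hdj
    have hij : i ≠ j := by rintro rfl; omega
    have h1 : pderiv i g = 0 := pderiv_eq_zero_of_degreeOf_eq_zero (by omega)
    have h2 : pderiv j f = 0 := pderiv_eq_zero_of_degreeOf_eq_zero (by omega)
    refine h i j hij ?_
    have h3 := pderiv_pderiv_comm i j g
    rw [biaffineDisc, hfg]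
    simp only [pderiv_mul, h1, h2, h3, map_zero, mul_zero, zero_mul, add_zero, zero_add]
    ring

theorem degreeOf_eq_zero_of_pderiv_eq_zero {i : σ} {q : MvPolynomial σ ℂ} (h : pderiv i q = 0) :
    q.degreeOf i = 0 := by
  classical
  refine Nat.le_zero.1 (degreeOf_le_iff.2 fun m hm => ?_)
  by_contra hmi
  have hmi' : 1 ≤ m i := by omega
  have h1 := coeff_pderiv (i := i) q (m - Finsupp.single i 1)
  rw [tsub_add_cancel_of_le (Finsupp.single_le_iff.2 hmi')] at h1
  rw [h, coeff_zero] at h1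
  rcases mul_eq_zero.1 h1.symm with h2 | h2
  · exact (mem_support_iff.1 hm) h2
  · exact Nat.cast_add_one_ne_zero _ h2

end MvPolynomial

namespace QuadEquation

variable (E : QuadEquation)

theorem pderiv_ne_zero {E : QuadEquation} {α β : ℂ} (h : E.Nondegenerate α β) (i : Fin 4) :
    MvPolynomial.pderiv i (E.Q α β) ≠ 0 := by
  intro hi
  have hdeg := MvPolynomial.degreeOf_eq_zero_of_pderiv_eq_zero hi
  have hz : ∀ m : Fin 4 →₀ ℕ, m i = 1 → (E.Q α β).coeff m = 0 := by
    intro m hm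
    by_contra hc
    have := MvPolynomial.degreeOf_le_iff.1 hdeg.le m (MvPolynomial.mem_support_iff.2 hc)
    omega
  obtain ⟨ε, hε, hd⟩ := E.exists_coef_diag
  obtain ⟨σ, hσ, hs⟩ := E.exists_coef_side
  have ho : ∀ i j k l, E.coef α β i j k l = ε * σ * ε * E.coef α β k l i j := fun i j k l => by
    rw [hd, hs, hd]; ring
  have h0 : ∀ j k l, E.coef α β 1 j k l = 0 := by
    fin_cases i
    · exact fun j k l => hz _ rfl
    · intro j k l
      have : E.coef α β j 1 l k = 0 := hz _ rfl
      rw [hs, this, mul_zero]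
    · intro j k l
      have : E.coef α β k l 1 j = 0 := hz _ rfl
      rw [ho, this, mul_zero]
    · intro j k l
      have : E.coef α β l k j 1 = 0 := hz _ rfl
      rw [hs, ho, this, mul_zero, mul_zero]
  have h1 : ∀ i k l, E.coef α β i 1 k l = 0 := fun i k l => by rw [hs, h0, mul_zero]
  have h2 : ∀ i j l, E.coef α β i j 1 l = 0 := fun i j l => by rw [ho, h0, mul_zero]
  have h3 : ∀ i j k, E.coef α β i j k 1 = 0 := fun i j k => by rw [hs, h2, mul_zero]
  have hQ : E.Q α β = MvPolynomial.C (E.coef α β 0 0 0 0) := by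
    rw [Q_eq_form]
    simp [form, edgeForm, h0, h1, h2, h3, MvPolynomial.algebraMap_eq]
  have hirr : Irreducible (E.Q α β) := h
  by_cases hc : E.coef α β 0 0 0 0 = 0
  · exact hirr.ne_zero (by rw [hQ, hc, MvPolynomial.C_0])
  · exact hirr.not_isUnit (by rw [hQ]; exact (isUnit_iff_ne_zero.2 hc).map MvPolynomial.C)

theorem biaffineDisc_ne_zero {E : QuadEquation} {α β : ℂ} (h : E.Nondegenerate α β) (i j : Fin 4) :
    MvPolynomial.biaffineDisc i j (E.Q α β) ≠ 0 :=
  MvPolynomial.biaffineDisc_ne_zero h (E.degree_le_one α β) (pderiv_ne_zero h i) (pderiv_ne_zero h j)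

theorem differentiable_coef (α : ℂ) (i j k l : Fin 2) :
    Differentiable ℂ fun β => E.coef α β i j k l := by
  have := E.holomorphic (Finsupp.equivFunOnFinite.symm ![(i : ℕ), (j : ℕ), (k : ℕ), (l : ℕ)])
  exact this.comp (f := fun β : ℂ => (α, β)) (by fun_prop)

/-- A linear functional of the polynomial `Q` is an entire function of the second parameter. -/
theorem differentiable_linear (α : ℂ) (Λ : MvPolynomial (Fin 4) ℂ →ₗ[ℂ] ℂ) :
    Differentiable ℂ fun β => Λ (E.Q α β) := by
  have h : ∀ β, Λ (E.Q α β) = ∑ i : Fin 2, ∑ j : Fin 2, ∑ k : Fin 2, ∑ l : Fin 2,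
      E.coef α β i j k l * Λ (MvPolynomial.monomial
        (Finsupp.equivFunOnFinite.symm ![(i : ℕ), (j : ℕ), (k : ℕ), (l : ℕ)]) 1) := by
    intro β
    conv_lhs => rw [MvPolynomial.eq_sum_of_degreeOf_le_one _ (E.degree_le_one α β)]
    simp only [map_sum]
    refine Finset.sum_congr rfl fun i _ => Finset.sum_congr rfl fun j _ =>
      Finset.sum_congr rfl fun k _ => Finset.sum_congr rfl fun l _ => ?_
    rw [coef, ← smul_eq_mul, ← map_smul, MvPolynomial.smul_monomial, smul_eq_mul, mul_one]
  simp only [h]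
  have := E.differentiable_coef α
  fun_prop

end QuadEquation

section

open Filter Topology

/-- An entire function that is not identically zero has isolated zeros. -/
theorem Differentiable.eventually_ne_zero {f : ℂ → ℂ} (hf : Differentiable ℂ f) {b : ℂ}
    (hb : f b ≠ 0) (a : ℂ) : ∀ᶠ z in 𝓝[≠] a, f z ≠ 0 := by
  by_contra h
  rw [Filter.not_eventually] at h
  have hf' : AnalyticOnNhd ℂ f Set.univ := fun z _ => hf.analyticAt z
  have := AnalyticOnNhd.eq_of_frequently_eq (g := fun _ => 0) hf' analyticOnNhd_const
    (h.mono fun z hz => by simpa using hz)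
  exact hb (congrFun this b)

namespace QuadEquation

/-- Nondegeneracy is preserved under a generic change of the second parameter. -/
theorem eventually_nondegenerate {E : QuadEquation} {α β : ℂ} (h : E.Nondegenerate α β) (a : ℂ) :
    ∀ᶠ z in 𝓝[≠] a, E.Nondegenerate α z := by
  have key : ∀ i j, ∀ᶠ z in 𝓝[≠] a, MvPolynomial.biaffineDisc i j (E.Q α z) ≠ 0 := by
    intro i j
    obtain ⟨p, hp⟩ : ∃ p, MvPolynomial.eval p (MvPolynomial.biaffineDisc i j (E.Q α β)) ≠ 0 := by
      by_contra! hall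
      exact biaffineDisc_ne_zero h i j (MvPolynomial.funext fun p => by rw [hall p, map_zero])
    have hd : Differentiable ℂ fun z => MvPolynomial.eval p
        (MvPolynomial.biaffineDisc i j (E.Q α z)) := by
      let ev := (MvPolynomial.aeval (R := ℂ) p).toLinearMap
      let di : MvPolynomial (Fin 4) ℂ →ₗ[ℂ] MvPolynomial (Fin 4) ℂ := (MvPolynomial.pderiv i).toLinearMap
      let dj : MvPolynomial (Fin 4) ℂ →ₗ[ℂ] MvPolynomial (Fin 4) ℂ := (MvPolynomial.pderiv j).toLinearMap
      have h1 := E.differentiable_linear α ev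
      have h2 := E.differentiable_linear α (ev ∘ₗ di)
      have h3 := E.differentiable_linear α (ev ∘ₗ dj)
      have h4 := E.differentiable_linear α (ev ∘ₗ di ∘ₗ dj)
      have hev : ∀ z, MvPolynomial.eval p (MvPolynomial.biaffineDisc i j (E.Q α z))
          = ev (E.Q α z) * (ev ∘ₗ di ∘ₗ dj) (E.Q α z)
            - (ev ∘ₗ di) (E.Q α z) * (ev ∘ₗ dj) (E.Q α z) := fun z => by
        rw [← MvPolynomial.coe_aeval_eq_eval, MvPolynomial.biaffineDisc]
        simp only [map_sub, map_mul]
        rfl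
      simp only [hev]
      exact (h1.mul h4).sub (h2.mul h3)
    exact (hd.eventually_ne_zero hp a).mono fun z hz h0 => hz (by rw [h0, map_zero])
  have := Filter.eventually_all.2 fun i => Filter.eventually_all.2 (key i)
  exact this.mono fun z hz => MvPolynomial.irreducible_of_biaffineDisc_ne_zero
    (E.degree_le_one α z) (a := 0) (b := 1) (by decide) fun i j _ => hz i j

open MvPolynomial in
/-- The transfer matrix at nondegenerate parameters is invertible for generic fields. -/
theorem det_transfer_X_ne_zero {E : QuadEquation} {α β : ℂ} (h : E.Nondegenerate α β)
    {R : Type*} [CommRing R] [Algebra ℂ R] {a b : R}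
    (hab : ∀ f : MvPolynomial (Fin 2) ℂ, f ≠ 0 → aeval ![a, b] f ≠ 0) :
    (E.transfer α β (vec a) (vec b)).det ≠ 0 := by
  have h0 : (E.transfer α β (vec (X 0 : MvPolynomial (Fin 2) ℂ)) (vec (X 1))).det ≠ 0 := by
    intro h0
    apply biaffineDisc_ne_zero h 2 3
    have h1 : (E.transfer α β (vec (X 0 : MvPolynomial (Fin 4) ℂ)) (vec (X 1))).det = 0 := by
      have := congrArg (rename (R := ℂ) ![(0 : Fin 4), 1]) h0
      rw [map_zero, AlgHom.map_det, AlgHom.mapMatrix_apply, map_transfer, comp_vec, comp_vec,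
        rename_X, rename_X] at this
      exact this
    rw [det_transfer] at h1
    have hq : ∀ k l, pderiv 2 (E.edgeForm α β (vec (X 0 : MvPolynomial (Fin 4) ℂ)) (vec (X 1)) k l) = 0
        ∧ pderiv 3 (E.edgeForm α β (vec (X 0 : MvPolynomial (Fin 4) ℂ)) (vec (X 1)) k l) = 0 := by
      intro k l
      simp [edgeForm, pderiv_X, algebraMap_eq]
    rw [biaffineDisc, Q_eq_form]
    simp only [form, Fin.sum_univ_two, map_add, pderiv_mul, hq, vec_zero, vec_one, pderiv_X_self,
      pderiv_X_of_ne (R := ℂ) (show (3 : Fin 4) ≠ 2 by decide),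
      pderiv_X_of_ne (R := ℂ) (show (2 : Fin 4) ≠ 3 by decide), pderiv_one, map_zero]
    linear_combination h1
  have := hab _ h0
  rwa [AlgHom.map_det, AlgHom.mapMatrix_apply, map_transfer, comp_vec, comp_vec, aeval_X,
    aeval_X] at this

end QuadEquation

end

/-! ### Generic pairs of fields -/

theorem algebraicIndependent_pair_iff {F K : Type*} [CommRing F] [CommRing K] [Algebra F K] {a b : K} :
    AlgebraicIndependent F ![a, b] ↔
      Transcendental F a ∧ Transcendental (Algebra.adjoin F {a}) b := by
  rw [AlgebraicIndependent.iff_transcendental_adjoin_image 1]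
  have h1 : (![a, b] '' {1}ᶜ : Set K) = {a} := by
    ext z
    simp only [Set.mem_image, Set.mem_compl_iff, Set.mem_singleton_iff, Fin.exists_fin_two]
    simp [eq_comm]
  rw [h1]
  have : Unique {j : Fin 2 // j ≠ 1} :=
    ⟨⟨⟨0, by decide⟩⟩, fun ⟨j, hj⟩ => by
      fin_cases j
      · rfl
      · exact absurd rfl hj⟩
  rw [algebraicIndependent_unique_type_iff, Subsingleton.elim default (⟨0, by decide⟩ : {j : Fin 2 // j ≠ 1})]
  exact Iff.rfl

theorem AlgebraicIndependent.aeval_pair_ne_zero {F K : Type*} [CommRing F] [CommRing K] [Algebra F K]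
    {a b : K} (h : AlgebraicIndependent F ![a, b]) (f : MvPolynomial (Fin 2) F) (hf : f ≠ 0) :
    MvPolynomial.aeval ![a, b] f ≠ 0 := fun h0 =>
  hf (algebraicIndependent_iff.1 h f h0)

section

variable {K : Type*} [Field K] [Algebra ℂ K]

theorem Transcendental.of_intermediateField {L : IntermediateField ℂ K} {τ : K}
    (h : Transcendental L τ) : Transcendental ℂ τ :=
  Transcendental.restrictScalars (algebraMap ℂ L).injective h

theorem Transcendental.of_adjoin_le {L : IntermediateField ℂ K} {τ : K} (h : Transcendental L τ)
    {s : Set K} (hs : s ⊆ L) : Transcendental (Algebra.adjoin ℂ s) τ :=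
  Transcendental.of_tower_top_of_subalgebra_le (A := Algebra.adjoin ℂ s) (B := L.toSubalgebra)
    (Algebra.adjoin_le hs) h

theorem algebraicIndependent_pair_of_transcendental {L : IntermediateField ℂ K} {a τ : K} (ha : a ∈ L)
    (ha' : Transcendental ℂ a) (h : Transcendental L τ) : AlgebraicIndependent ℂ ![a, τ] :=
  algebraicIndependent_pair_iff.2 ⟨ha', h.of_adjoin_le (by simpa using ha)⟩

/-- If `a, b` are independent and lie in a field over which `τ` is transcendental, then they remain
independent over the elements that are algebraic over `ℂ(τ)`. -/
theorem AlgebraicIndependent.of_transcendental {L : IntermediateField ℂ K} {a b τ : K}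
    (hab : AlgebraicIndependent ℂ ![a, b]) (ha : a ∈ L) (hb : b ∈ L) (h : Transcendental L τ) :
    AlgebraicIndependent (Subalgebra.algebraicClosure (Algebra.adjoin ℂ {τ}) K) ![a, b] := by
  have h1 : AlgebraicIndependent (Algebra.adjoin ℂ (Set.range ![a, b])) (fun _ : Unit => τ) := by
    rw [algebraicIndependent_unique_type_iff]
    refine h.of_adjoin_le ?_
    rintro _ ⟨i, rfl⟩
    fin_cases i <;> assumption
  have h2 := hab.sumElim h1
  have h3 : AlgebraicIndependent ℂ (Sum.elim ![a, b] (fun _ : Unit => τ)) := by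
    refine (algebraicIndependent_equiv' (Equiv.sumComm Unit (Fin 2)) ?_).1 h2
    ext (_ | _) <;> rfl
  have h4 := (AlgebraicIndependent.sumElim_iff.1 h3).2
  rw [Set.range_const] at h4
  exact h4.subalgebraAlgebraicClosure

namespace QuadEquation

theorem edgeForm_vec_left (E : QuadEquation) (α β : ℂ) {R : Type*} [CommRing R] [Algebra ℂ R] (s : R)
    (y : Fin 2 → R) (k l : Fin 2) : E.edgeForm α β (vec s) y k l
      = E.edgeForm α β (Pi.single 0 1) y k l + s * E.edgeForm α β (Pi.single 1 1) y k l := by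
  simp [edgeForm, Fin.sum_univ_two]
  ring

theorem edgeForm_vec_right (E : QuadEquation) (α β : ℂ) {R : Type*} [CommRing R] [Algebra ℂ R]
    (x : Fin 2 → R) (t : R) (k l : Fin 2) : E.edgeForm α β x (vec t) k l
      = E.edgeForm α β x (Pi.single 0 1) k l + t * E.edgeForm α β x (Pi.single 1 1) k l := by
  simp [edgeForm, Fin.sum_univ_two]
  ring

theorem comp_single {R S : Type*} [CommRing R] [Algebra ℂ R] [CommRing S] [Algebra ℂ S]
    (f : R →ₐ[ℂ] S) (k : Fin 2) : f ∘ (Pi.single k 1) = (Pi.single k 1) := by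
  ext i
  fin_cases i <;> fin_cases k <;> simp

theorem edgeForm_eq_form (E : QuadEquation) (α β : ℂ) {R : Type*} [CommRing R] [Algebra ℂ R]
    (x y : Fin 2 → R) (k l : Fin 2) :
    E.edgeForm α β x y k l = E.form α β x y (Pi.single k 1) (Pi.single l 1) := by
  fin_cases k <;> fin_cases l <;> simp [form]

open MvPolynomial in
/-- A nondegenerate equation cannot hold identically in `v₂, v₁₂` for fields `v, v₁` the second of
which is not a constant: otherwise the coefficients of `v` and the terms without `v` would be
proportional. -/
theorem exists_edgeForm_ne_zero {E : QuadEquation} {α β : ℂ} (h : E.Nondegenerate α β) {τ τ' : K}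
    (hτ : Transcendental ℂ τ) : ∃ k l, E.edgeForm α β (vec τ') (vec τ) k l ≠ 0 := by
  by_contra! hall
  apply biaffineDisc_ne_zero h 0 3
  have hprop : ∀ k l k' l', E.edgeForm α β (Pi.single 0 1) (vec τ) k l * E.edgeForm α β (Pi.single 1 1) (vec τ) k' l'
      = E.edgeForm α β (Pi.single 0 1) (vec τ) k' l' * E.edgeForm α β (Pi.single 1 1) (vec τ) k l := by
    intro k l k' l'
    have h1 := hall k l
    have h2 := hall k' l'
    rw [edgeForm_vec_left] at h1 h2
    linear_combination E.edgeForm α β (Pi.single 1 1) (vec τ) k' l' * h1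
      - E.edgeForm α β (Pi.single 1 1) (vec τ) k l * h2
  have hpoly : ∀ k l k' l', E.edgeForm α β (Pi.single 0 1) (vec (Polynomial.X : Polynomial ℂ)) k l
        * E.edgeForm α β (Pi.single 1 1) (vec Polynomial.X) k' l'
      = E.edgeForm α β (Pi.single 0 1) (vec Polynomial.X) k' l'
        * E.edgeForm α β (Pi.single 1 1) (vec Polynomial.X) k l := by
    intro k l k' l'
    apply transcendental_iff_injective.1 hτ
    simp only [map_mul, map_edgeForm, comp_vec, Polynomial.aeval_X, comp_single]
    exact hprop k l k' l'
  have hmv : ∀ k l k' l', E.edgeForm α β (Pi.single 0 1) (vec (X 1 : MvPolynomial (Fin 4) ℂ)) k l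
        * E.edgeForm α β (Pi.single 1 1) (vec (X 1)) k' l'
      = E.edgeForm α β (Pi.single 0 1) (vec (X 1)) k' l' * E.edgeForm α β (Pi.single 1 1) (vec (X 1)) k l := by
    intro k l k' l'
    have := congrArg (Polynomial.aeval (R := ℂ) (X 1 : MvPolynomial (Fin 4) ℂ)) (hpoly k l k' l')
    simpa only [map_mul, map_edgeForm, comp_vec, Polynomial.aeval_X, comp_single] using this
  have hd : ∀ (x : Fin 2 → MvPolynomial (Fin 4) ℂ), (x = (Pi.single 0 1) ∨ x = (Pi.single 1 1)) → ∀ k l,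
      pderiv 0 (E.edgeForm α β x (vec (X 1)) k l) = 0 ∧
      pderiv 3 (E.edgeForm α β x (vec (X 1)) k l) = 0 := by
    rintro x (rfl | rfl) k l <;> simp [edgeForm, pderiv_X, algebraMap_eq]
  rw [biaffineDisc, Q_eq_form]
  simp only [form, edgeForm_vec_left, Fin.sum_univ_two, map_add, pderiv_mul, hd _ (Or.inl rfl),
    hd _ (Or.inr rfl), vec_zero, vec_one, pderiv_X_self,
    pderiv_X_of_ne (R := ℂ) (show (3 : Fin 4) ≠ 0 by decide),
    pderiv_X_of_ne (R := ℂ) (show (0 : Fin 4) ≠ 3 by decide),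
    pderiv_X_of_ne (R := ℂ) (show (2 : Fin 4) ≠ 0 by decide),
    pderiv_X_of_ne (R := ℂ) (show (2 : Fin 4) ≠ 3 by decide), pderiv_one, map_zero]
  have p1 := hmv 0 0 0 1
  have p2 := hmv 0 0 1 1
  have p3 := hmv 1 0 0 1
  have p4 := hmv 1 0 1 1
  linear_combination (p1 + X 2 * p2 + X 2 * p3 + X 2 ^ 2 * p4)

open MvPolynomial in
/-- If the equation holds for fields `v, v₁` that are independent of `v₂, v₁₂`, then it holds
identically in `v, v₁`. -/
theorem form_single_eq_zero_of_independent {E : QuadEquation} {α β : ℂ} {F : Type*} [CommRing F]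
    [Algebra ℂ F] [Algebra F K] [IsScalarTower ℂ F K] {a b : K}
    (hind : AlgebraicIndependent F ![a, b]) (t t' : F)
    (hQ : E.form α β (vec a) (vec b) (vec (algebraMap F K t)) (vec (algebraMap F K t')) = 0)
    (i j : Fin 2) : E.form α β (R := K) (Pi.single i 1) (Pi.single j 1) (vec (algebraMap F K t))
      (vec (algebraMap F K t')) = 0 := by
  let f : F →ₐ[ℂ] K := IsScalarTower.toAlgHom ℂ F K
  obtain ⟨e, he⟩ : ∃ e : Fin 2 → Fin 2 → F, ∀ i j, f (e i j)
      = E.form α β (Pi.single i 1) (Pi.single j 1) (vec (f t)) (vec (f t')) := by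
    refine ⟨fun i j => E.form α β (Pi.single i 1) (Pi.single j 1) (vec t) (vec t'), fun i j => ?_⟩
    rw [map_form, comp_vec, comp_vec, comp_single, comp_single]
  have hp0 : (C (e 0 0) + C (e 1 0) * X 0 + C (e 0 1) * X 1 + C (e 1 1) * (X 0 * X 1)
      : MvPolynomial (Fin 2) F) = 0 := by
    apply algebraicIndependent_iff.1 hind
    have hC : ∀ c : F, aeval ![a, b] (C c : MvPolynomial (Fin 2) F) = f c := fun c => aeval_C _ c
    simp only [map_add, map_mul, hC, aeval_X, he]
    rw [← hQ]
    simp only [form, edgeForm_vec_left, edgeForm_vec_right, Fin.sum_univ_two, Matrix.cons_val_zero,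
      Matrix.cons_val_one, Matrix.cons_val_fin_one, f, IsScalarTower.coe_toAlgHom']
    ring
  have hz : e i j = 0 := by
    have h00 := congrArg (eval ![0, 0]) hp0
    have h10 := congrArg (eval ![1, 0]) hp0
    have h01 := congrArg (eval ![0, 1]) hp0
    have h11 := congrArg (eval ![1, 1]) hp0
    simp only [map_add, map_mul, eval_C, eval_X, Matrix.cons_val_zero, Matrix.cons_val_one,
      Matrix.cons_val_fin_one, map_zero, mul_zero, mul_one, add_zero] at h00 h10 h01 h11
    rw [h00, zero_add] at h10 h01 h11
    rw [h10, h01, zero_add, zero_add] at h11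
    fin_cases i <;> fin_cases j <;> assumption
  have := he i j
  rw [hz, map_zero] at this
  exact this.symm

/-- If `v, v₁` are independent constants and `v₂` is transcendental over a field that contains them,
then `v₂, v₁₂` are independent as well. -/
theorem algebraicIndependent_transfer {E : QuadEquation} {α β : ℂ} (h : E.Nondegenerate α β)
    {L : IntermediateField ℂ K} {a b τ τ' : K} (hab : AlgebraicIndependent ℂ ![a, b]) (ha : a ∈ L)
    (hb : b ∈ L) (hτ : Transcendental L τ)
    (hQ : E.form α β (vec a) (vec b) (vec τ) (vec τ') = 0) : AlgebraicIndependent ℂ ![τ, τ'] := by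
  rw [algebraicIndependent_pair_iff]
  refine ⟨hτ.of_intermediateField, fun hτ' => ?_⟩
  have hτF : τ ∈ Subalgebra.algebraicClosure (Algebra.adjoin ℂ {τ}) K :=
    isAlgebraic_algebraMap (⟨τ, Algebra.subset_adjoin rfl⟩ : Algebra.adjoin ℂ {τ})
  have hz := form_single_eq_zero_of_independent (hab.of_transcendental ha hb hτ)
    ⟨τ, hτF⟩ ⟨τ', hτ'⟩ hQ
  obtain ⟨ρ, hρ, hrot⟩ := E.exists_form_rotate (R := K)
  obtain ⟨k, l, hkl⟩ := exists_edgeForm_ne_zero h (τ' := τ') hτ.of_intermediateField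
  apply hkl
  rw [edgeForm_eq_form, hrot, hrot]
  have := hz l k
  change E.form α β (Pi.single l 1) (Pi.single k 1) (vec τ) (vec τ') = 0 at this
  rw [this, mul_zero, mul_zero]

end QuadEquation

end

/-! ### Consistency as polynomial identities -/

theorem wedge_smul_smul {R : Type*} [CommRing R] (a b : R) (u w : Fin 2 → R) :
    wedge (a • u) (b • w) = a * b * wedge u w := by
  simp only [wedge, Pi.smul_apply, smul_eq_mul]; ring

theorem map_wedge {R S : Type*} [CommRing R] [Algebra ℂ R] [CommRing S] [Algebra ℂ S]
    (f : R →ₐ[ℂ] S) (u w : Fin 2 → R) : f (wedge u w) = wedge (f ∘ u) (f ∘ w) := by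
  simp [wedge]

theorem wedge_self {R : Type*} [CommRing R] (u : Fin 2 → R) : wedge u u = 0 := by
  simp only [wedge]; ring

theorem wedge_vec_right {R : Type*} [CommRing R] (u : Fin 2 → R) (y : R) :
    wedge u (vec y) = u 0 * y - u 1 := by
  simp [wedge]

theorem eq_smul_vec_of_wedge_eq_zero {R : Type*} [CommRing R] {u : Fin 2 → R} {y : R}
    (h : wedge u (vec y) = 0) : u = u 0 • vec y := by
  rw [wedge_vec_right] at h
  ext i
  fin_cases i
  · simp
  · simp only [Fin.mk_one, Pi.smul_apply, vec_one, smul_eq_mul]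
    linear_combination -h

/-- Two matrices of which the first is invertible are proportional if they define the same map of
the projective line. -/
theorem exists_eq_smul_of_wedge_eq_zero {K : Type*} [Field K] [CharZero K]
    {A B : Matrix (Fin 2) (Fin 2) K} (hA : A.det ≠ 0)
    (h : ∀ c : K, wedge (A.mulVec (vec c)) (B.mulVec (vec c)) = 0) : ∃ s : K, B = s • A := by
  have h0 := h 0
  have h1 := h 1
  have h2 := h (-1)
  simp only [wedge, Matrix.mulVec, dotProduct, Fin.sum_univ_two, vec_zero, vec_one] at h0 h1 h2
  rw [Matrix.det_fin_two] at hA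
  refine ⟨(A 1 1 * B 0 0 - A 0 1 * B 1 0) / (A 0 0 * A 1 1 - A 0 1 * A 1 0), ?_⟩
  have h3 : A 0 1 * B 1 1 - A 1 1 * B 0 1 = 0 := by
    have : (2 : K) ≠ 0 := two_ne_zero
    apply mul_left_cancel₀ this
    linear_combination h1 + h2 - 2 * h0
  have h4 : A 0 0 * B 1 1 + A 0 1 * B 1 0 - A 1 0 * B 0 1 - A 1 1 * B 0 0 = 0 := by
    have : (2 : K) ≠ 0 := two_ne_zero
    apply mul_left_cancel₀ this
    linear_combination h1 - h2
  ext i j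
  rw [Matrix.smul_apply, smul_eq_mul, div_mul_eq_mul_div, eq_div_iff hA]
  fin_cases i <;> fin_cases j <;>
    simp only [Fin.zero_eta, Fin.mk_one, Fin.isValue]
  · linear_combination A 0 1 * h0
  · linear_combination A 0 1 * h4 - A 0 0 * h3
  · linear_combination A 1 1 * h0
  · linear_combination A 1 1 * h4 - A 1 0 * h3

namespace QuadEquation

theorem determines_iff (E : QuadEquation) (α β a b c y : ℂ) : E.Determines α β a b c y ↔
    E.form α β (vec a) (vec b) (vec c) (vec y) = 0 ∧
      E.form α β (vec a) (vec b) (vec c) ![0, 1] ≠ 0 := by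
  have hval : ∀ t, E.val α β a b c t = (E.transfer α β (vec a) (vec b)).mulVec (vec c) 0 * t
      - (E.transfer α β (vec a) (vec b)).mulVec (vec c) 1 := fun t => by
    rw [val_eq_form, form_eq_wedge, wedge_vec_right]
  rw [← transfer_mulVec_zero, form_eq_wedge, wedge_vec_right]
  simp only [Determines, hval]
  generalize (E.transfer α β (vec a) (vec b)).mulVec (vec c) 0 = m
  generalize (E.transfer α β (vec a) (vec b)).mulVec (vec c) 1 = m'
  refine ⟨fun h => ⟨(h y).2 rfl, ?_⟩, fun ⟨h1, h2⟩ t => ⟨fun ht => ?_, fun ht => ht ▸ h1⟩⟩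
  · rintro rfl
    have h1 := (h y).2 rfl
    have h2 := (h (y + 1)).1 (by linear_combination h1)
    exact one_ne_zero (add_eq_left.1 h2)
  · apply mul_left_cancel₀ h2
    linear_combination ht - h1

theorem Determines.mulVec_eq {E : QuadEquation} {α β a b c y : ℂ} (h : E.Determines α β a b c y) :
    ∃ m : ℂ, m ≠ 0 ∧ (E.transfer α β (vec a) (vec b)).mulVec (vec c) = m • vec y := by
  rw [determines_iff, form_eq_wedge, ← transfer_mulVec_zero] at h
  exact ⟨_, h.2, eq_smul_vec_of_wedge_eq_zero h.1⟩

section Consistency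

variable {E : QuadEquation}

open MvPolynomial in
/-- A polynomial expression in four fields vanishes identically if it vanishes for generic
complex values of the fields. -/
theorem eq_zero_of_generic {f : MvPolynomial (Fin 4) ℂ} {g : MvPolynomial (Fin 4) ℂ} (hg : g ≠ 0)
    (h : ∀ a b c d : ℂ, eval ![a, b, c, d] g ≠ 0 → eval ![a, b, c, d] f = 0) : f = 0 := by
  have : f * g = 0 := by
    refine MvPolynomial.funext fun p => ?_
    have hp : p = ![p 0, p 1, p 2, p 3] := by ext i; fin_cases i <;> rfl
    rw [map_mul, map_zero, mul_eq_zero]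
    by_cases hgp : eval p g = 0
    · exact Or.inr hgp
    · left
      rw [hp] at hgp ⊢
      exact h _ _ _ _ hgp
  exact (mul_eq_zero.1 this).resolve_right hg

variable {α β γ : ℂ} (hE : E.Consistent3D) (h12 : E.Nondegenerate α β) (h13 : E.Nondegenerate α γ)
  (h23 : E.Nondegenerate β γ)

include hE h12 h13 h23

open MvPolynomial in
/-- The two values of `v₁₂₃` obtained through `v₁` and through `v₂` agree, as a polynomial
identity in homogeneous coordinates. -/
theorem consistency_wedge {R : Type*} [CommRing R] [Algebra ℂ R] (a b c d : R) :
    wedge ((E.transfer β γ (vec b) ((E.transfer α β (vec a) (vec b)).mulVec (vec c))).mulVec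
        ((E.transfer α γ (vec a) (vec b)).mulVec (vec d)))
      ((E.transfer α γ (vec c) ((E.transfer α β (vec a) (vec b)).mulVec (vec c))).mulVec
        ((E.transfer β γ (vec a) (vec c)).mulVec (vec d))) = 0 := by
  obtain ⟨g, hg, hgen⟩ := hE α β γ h12 h13 h23
  have key : wedge ((E.transfer β γ (vec (X 1 : MvPolynomial (Fin 4) ℂ))
        ((E.transfer α β (vec (X 0)) (vec (X 1))).mulVec (vec (X 2)))).mulVec
        ((E.transfer α γ (vec (X 0)) (vec (X 1))).mulVec (vec (X 3))))
      ((E.transfer α γ (vec (X 2)) ((E.transfer α β (vec (X 0)) (vec (X 1))).mulVec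
        (vec (X 2)))).mulVec ((E.transfer β γ (vec (X 0)) (vec (X 2))).mulVec (vec (X 3)))) = 0 := by
    refine eq_zero_of_generic hg fun a b c d hp => ?_
    obtain ⟨y12, y13, y23, y123, d1, d2, d3, -, d5, d6⟩ := hgen a b c d hp
    rw [← MvPolynomial.coe_aeval_eq_eval]
    change aeval (R := ℂ) ![a, b, c, d] _ = 0
    simp only [map_wedge, comp_transfer_mulVec, comp_vec, aeval_X, Matrix.cons_val]
    obtain ⟨m1, -, e1⟩ := d1.mulVec_eq
    obtain ⟨m2, -, e2⟩ := d2.mulVec_eq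
    obtain ⟨m3, -, e3⟩ := d3.mulVec_eq
    obtain ⟨m5, -, e5⟩ := d5.mulVec_eq
    obtain ⟨m6, -, e6⟩ := d6.mulVec_eq
    rw [e1, e2, e3, transfer_smul_right, transfer_smul_right, Matrix.mulVec_smul,
      Matrix.mulVec_smul, Matrix.smul_mulVec, Matrix.smul_mulVec, e5, e6]
    simp only [smul_smul, wedge_smul_smul, wedge_self, mul_zero]
  have := congrArg (aeval (R := ℂ) ![a, b, c, d]) key
  simpa only [map_wedge, comp_transfer_mulVec, comp_vec, aeval_X, Matrix.cons_val, map_zero]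
    using this

open MvPolynomial in
/-- The values `v₃, v₁₃, v₂₃, v₁₂₃` satisfy the equation again, as a polynomial identity in
homogeneous coordinates. -/
theorem consistency_form {R : Type*} [CommRing R] [Algebra ℂ R] (a b c d : R) :
    E.form α β (vec d) ((E.transfer α γ (vec a) (vec b)).mulVec (vec d))
      ((E.transfer β γ (vec a) (vec c)).mulVec (vec d))
      ((E.transfer β γ (vec b) ((E.transfer α β (vec a) (vec b)).mulVec (vec c))).mulVec
        ((E.transfer α γ (vec a) (vec b)).mulVec (vec d))) = 0 := by
  obtain ⟨g, hg, hgen⟩ := hE α β γ h12 h13 h23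
  have key : E.form α β (vec (X 3 : MvPolynomial (Fin 4) ℂ))
      ((E.transfer α γ (vec (X 0)) (vec (X 1))).mulVec (vec (X 3)))
      ((E.transfer β γ (vec (X 0)) (vec (X 2))).mulVec (vec (X 3)))
      ((E.transfer β γ (vec (X 1)) ((E.transfer α β (vec (X 0)) (vec (X 1))).mulVec
        (vec (X 2)))).mulVec ((E.transfer α γ (vec (X 0)) (vec (X 1))).mulVec (vec (X 3)))) = 0 := by
    refine eq_zero_of_generic hg fun a b c d hp => ?_
    obtain ⟨y12, y13, y23, y123, d1, d2, d3, d4, d5, d6⟩ := hgen a b c d hp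
    rw [← MvPolynomial.coe_aeval_eq_eval]
    change aeval (R := ℂ) ![a, b, c, d] _ = 0
    simp only [map_form, comp_transfer_mulVec, comp_vec, aeval_X, Matrix.cons_val]
    obtain ⟨m1, -, e1⟩ := d1.mulVec_eq
    obtain ⟨m2, -, e2⟩ := d2.mulVec_eq
    obtain ⟨m3, -, e3⟩ := d3.mulVec_eq
    obtain ⟨m6, -, e6⟩ := d6.mulVec_eq
    have e4 := ((E.determines_iff _ _ _ _ _ _).1 d4).1
    rw [e1, e2, e3, transfer_smul_right, Matrix.mulVec_smul, Matrix.smul_mulVec, e6, smul_smul,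
      smul_smul, ← one_smul ℂ (vec d), form_smul_smul_smul_smul, e4, mul_zero]
  have := congrArg (aeval (R := ℂ) ![a, b, c, d]) key
  simpa only [map_form, comp_transfer_mulVec, comp_vec, aeval_X, Matrix.cons_val, map_zero]
    using this

variable {K : Type*} [Field K] [Algebra ℂ K]

/-- The transfer matrices around a quadrilateral of a solution are flat, up to a scalar. -/
theorem transfer_flat {v v₁ v₂ v₁₂ : K} (hQ : E.form α β (vec v) (vec v₁) (vec v₂) (vec v₁₂) = 0)
    (hQ' : E.form α β (vec v) (vec v₁) (vec v₂) ![0, 1] ≠ 0)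
    (h1 : (E.transfer α γ (vec v) (vec v₁)).det ≠ 0)
    (h2 : (E.transfer β γ (vec v₁) (vec v₁₂)).det ≠ 0) :
    ∃ s : K, E.transfer α γ (vec v₂) (vec v₁₂) * E.transfer β γ (vec v) (vec v₂)
      = s • (E.transfer β γ (vec v₁) (vec v₁₂) * E.transfer α γ (vec v) (vec v₁)) := by
  have : CharZero K := charZero_of_injective_algebraMap (algebraMap ℂ K).injective
  refine exists_eq_smul_of_wedge_eq_zero (by rw [Matrix.det_mul]; exact mul_ne_zero h2 h1)
    fun c => ?_
  rw [form_eq_wedge] at hQ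
  rw [← transfer_mulVec_zero] at hQ'
  have h := consistency_wedge hE h12 h13 h23 v v₁ v₂ c
  rw [eq_smul_vec_of_wedge_eq_zero hQ, transfer_smul_right, transfer_smul_right,
    Matrix.smul_mulVec, Matrix.smul_mulVec, wedge_smul_smul] at h
  rw [← Matrix.mulVec_mulVec, ← Matrix.mulVec_mulVec]
  exact (mul_eq_zero.1 h).resolve_left (mul_ne_zero hQ' hQ')

/-- The image of a quadrilateral of a solution under the transfer matrices solves the equation
again. -/
theorem form_transfer_eq_zero {v v₁ v₂ v₁₂ w w₁ w₂ w₁₂ m₁ m₂ m₁₂ : K}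
    (hQ : E.form α β (vec v) (vec v₁) (vec v₂) (vec v₁₂) = 0)
    (hQ' : E.form α β (vec v) (vec v₁) (vec v₂) ![0, 1] ≠ 0)
    (h1 : (E.transfer α γ (vec v) (vec v₁)).mulVec (vec w) = m₁ • vec w₁) (hm1 : m₁ ≠ 0)
    (h2 : (E.transfer β γ (vec v) (vec v₂)).mulVec (vec w) = m₂ • vec w₂) (hm2 : m₂ ≠ 0)
    (h3 : (E.transfer β γ (vec v₁) (vec v₁₂)).mulVec (vec w₁) = m₁₂ • vec w₁₂) (hm12 : m₁₂ ≠ 0) :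
    E.form α β (vec w) (vec w₁) (vec w₂) (vec w₁₂) = 0 := by
  rw [form_eq_wedge] at hQ
  rw [← transfer_mulVec_zero] at hQ'
  have h := consistency_form hE h12 h13 h23 v v₁ v₂ w
  rw [eq_smul_vec_of_wedge_eq_zero hQ, transfer_smul_right, Matrix.smul_mulVec, h1, h2,
    Matrix.mulVec_smul, h3, smul_smul, smul_smul, ← one_smul K (vec w),
    form_smul_smul_smul_smul] at h
  refine (mul_eq_zero.1 h).resolve_left ?_
  exact mul_ne_zero (mul_ne_zero (mul_ne_zero one_ne_zero hm1) hm2)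
    (mul_ne_zero (mul_ne_zero hQ' hm1) hm12)

end Consistency

end QuadEquation

/-! ### Transport along the edges -/

/-- A finite combination of elements of a complex algebra with coefficients that depend continuously
on a parameter. -/
inductive ContinuousCombination {K : Type*} [AddCommMonoid K] [Module ℂ K] : (ℂ → K) → Prop
  | smul (c : ℂ → ℂ) (hc : Continuous c) (k : K) : ContinuousCombination fun γ => c γ • k
  | add {f g : ℂ → K} (hf : ContinuousCombination f) (hg : ContinuousCombination g) :
      ContinuousCombination fun γ => f γ + g γ

namespace ContinuousCombination

theorem const {K : Type*} [AddCommMonoid K] [Module ℂ K] (k : K) :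
    ContinuousCombination fun _ => k := by
  simpa using ContinuousCombination.smul (fun _ => 1) continuous_const k

theorem sum {K : Type*} [AddCommMonoid K] [Module ℂ K] {ι : Type*} (t : Finset ι) {f : ι → ℂ → K}
    (h : ∀ i ∈ t, ContinuousCombination (f i)) : ContinuousCombination fun γ => ∑ i ∈ t, f i γ := by
  classical
  induction t using Finset.induction_on with
  | empty => simpa using const (0 : K)
  | insert i t hi ih =>
    simp only [Finset.sum_insert hi]
    exact (h i (Finset.mem_insert_self _ _)).add
      (ih fun j hj => h j (Finset.mem_insert_of_mem hj))

theorem mul {K : Type*} [Field K] [Algebra ℂ K] {f g : ℂ → K} (hf : ContinuousCombination f)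
    (hg : ContinuousCombination g) : ContinuousCombination fun γ => f γ * g γ := by
  induction hf with
  | smul c hc k =>
    induction hg with
    | smul c' hc' k' =>
      simpa only [smul_mul_smul_comm] using
        ContinuousCombination.smul (fun γ => c γ * c' γ) (hc.mul hc') (k * k')
    | add _ _ h1 h2 => simpa only [mul_add] using h1.add h2
  | add _ _ h1 h2 => simpa only [add_mul] using h1.add h2

theorem neg {K : Type*} [Field K] [Algebra ℂ K] {f : ℂ → K} (hf : ContinuousCombination f) :
    ContinuousCombination fun γ => -f γ := by
  simpa using (const (-1 : K)).mul hf

theorem sub {K : Type*} [Field K] [Algebra ℂ K] {f g : ℂ → K} (hf : ContinuousCombination f)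
    (hg : ContinuousCombination g) : ContinuousCombination fun γ => f γ - g γ := by
  simpa only [sub_eq_add_neg] using hf.add hg.neg

/-- No topology on `K` is needed for passing to a limit: linear functionals turn such a combination
into a continuous function. -/
theorem continuous_dual {K : Type*} [AddCommMonoid K] [Module ℂ K] {f : ℂ → K}
    (hf : ContinuousCombination f) (φ : K →ₗ[ℂ] ℂ) : Continuous fun γ => φ (f γ) := by
  induction hf with
  | smul c hc k =>
    simp only [map_smul, smul_eq_mul]
    exact hc.mul continuous_const
  | add _ _ h1 h2 =>
    simp only [map_add]
    exact h1.add h2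

open Filter Topology in
theorem eq_zero_of_frequently {K : Type*} [Field K] [Algebra ℂ K] {f : ℂ → K}
    (hf : ContinuousCombination f) {a : ℂ} (h : ∃ᶠ γ in 𝓝[≠] a, f γ = 0) : f a = 0 := by
  rw [← Module.forall_dual_apply_eq_zero_iff ℂ]
  intro φ
  by_contra hne
  have := (hf.continuous_dual φ).continuousAt.eventually_ne hne
  obtain ⟨γ, h1, h2⟩ := (h.and_eventually (this.filter_mono nhdsWithin_le_nhds)).exists
  exact h2 (by rw [h1, map_zero])

end ContinuousCombination

theorem QuadEquation.continuousCombination_transfer (E : QuadEquation) {K : Type*} [Field K]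
    [Algebra ℂ K] (α : ℂ) (x y : Fin 2 → K) (i j : Fin 2) :
    ContinuousCombination fun γ => E.transfer α γ x y i j := by
  have key : ∀ k l, ContinuousCombination fun γ => E.edgeForm α γ x y k l := fun k l =>
    .sum _ fun i _ => .sum _ fun j _ => by
      simpa only [Algebra.smul_def] using
        ContinuousCombination.smul _ (E.differentiable_coef α i j k l).continuous (x i * y j)
  fin_cases i <;> fin_cases j
  exacts [key 0 1, key 1 1, (key 0 0).neg, (key 1 0).neg]

/-- Two matrices are nonzero multiples of each other, so that they define the same map of the
projective line. -/
def ProjEq {K : Type*} [Field K] (A B : Matrix (Fin 2) (Fin 2) K) : Prop :=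
  ∃ c : K, c ≠ 0 ∧ B = c • A

namespace ProjEq

variable {K : Type*} [Field K] {A B C A' B' : Matrix (Fin 2) (Fin 2) K}

theorem refl (A : Matrix (Fin 2) (Fin 2) K) : ProjEq A A := ⟨1, one_ne_zero, (one_smul _ _).symm⟩

theorem symm (h : ProjEq A B) : ProjEq B A := by
  obtain ⟨c, hc, rfl⟩ := h
  exact ⟨c⁻¹, inv_ne_zero hc, by rw [smul_smul, inv_mul_cancel₀ hc, one_smul]⟩

theorem trans (h : ProjEq A B) (h' : ProjEq B C) : ProjEq A C := by
  obtain ⟨c, hc, rfl⟩ := h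
  obtain ⟨c', hc', rfl⟩ := h'
  exact ⟨c' * c, mul_ne_zero hc' hc, by rw [smul_smul]⟩

theorem mul (h : ProjEq A B) (h' : ProjEq A' B') : ProjEq (A * A') (B * B') := by
  obtain ⟨c, hc, rfl⟩ := h
  obtain ⟨c', hc', rfl⟩ := h'
  exact ⟨c * c', mul_ne_zero hc hc', by rw [Matrix.smul_mul, Matrix.mul_smul, smul_smul]⟩

theorem cancel_right (hC : C.det ≠ 0) (h : ProjEq (A * C) (B * C)) : ProjEq A B := by
  obtain ⟨c, hc, h⟩ := h
  refine ⟨c, hc, ?_⟩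
  have hu : IsUnit C.det := isUnit_iff_ne_zero.2 hC
  have := congrArg (· * C⁻¹) h
  simpa only [Matrix.smul_mul, Matrix.mul_nonsing_inv_cancel_right _ _ hu] using this

theorem adjugate_mul (h : A.det ≠ 0) : ProjEq 1 (A.adjugate * A) := ⟨_, h, Matrix.adjugate_mul A⟩

theorem apply_mul_apply (h : ProjEq A B) (i j k l : Fin 2) : A i j * B k l - A k l * B i j = 0 := by
  obtain ⟨c, -, rfl⟩ := h
  simp only [Matrix.smul_apply, smul_eq_mul]
  ring

theorem of_apply_mul_apply (hA : A.det ≠ 0) (hB : B.det ≠ 0)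
    (h : ∀ i j k l, A i j * B k l - A k l * B i j = 0) : ProjEq A B := by
  obtain ⟨i, j, hij⟩ : ∃ i j, A i j ≠ 0 := by
    by_contra! h0
    exact hA (by simp [Matrix.det_fin_two, h0])
  have hBA : B = (B i j / A i j) • A := by
    ext k l
    rw [Matrix.smul_apply, smul_eq_mul, div_mul_eq_mul_div, eq_div_iff hij]
    linear_combination h i j k l
  refine ⟨_, fun h0 => hB ?_, hBA⟩
  rw [hBA, h0, zero_smul, Matrix.det_zero]

open Matrix in
theorem iff_mk_eq (A B : GL (Fin 2) K) : ProjEq A.val B.val ↔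
    (QuotientGroup.mk A : GL (Fin 2) K ⧸ Subgroup.center (GL (Fin 2) K)) = QuotientGroup.mk B := by
  rw [QuotientGroup.eq, GeneralLinearGroup.mem_center_iff_val_mem_range_scalar]
  constructor
  · rintro ⟨c, hc, h⟩
    refine ⟨c, ?_⟩
    rw [Units.val_mul, h, Matrix.mul_smul, Units.inv_mul]
    ext i j; simp [Matrix.smul_apply, Matrix.scalar_apply, Matrix.diagonal_apply, Matrix.one_apply]
  · rintro ⟨c, h⟩
    have hB : B.val = A.val * Matrix.scalar (Fin 2) c := by
      rw [h, Units.val_mul, ← mul_assoc, Units.mul_inv, one_mul]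
    have hB' : B.val = c • A.val := by
      rw [hB, Matrix.scalar_apply, ← Matrix.smul_one_eq_diagonal, Matrix.mul_smul, mul_one]
    refine ⟨c, ?_, hB'⟩
    rintro rfl
    have := B.isUnit.ne_zero
    rw [zero_smul] at hB'
    exact this hB'

end ProjEq

namespace PlaneQuadGraph

variable {V D : Type*} (G : PlaneQuadGraph V D) {K : Type*} [Field K]

/-- The matrices `T x` are invertible and are carried into each other by the matrices `m d` along the
darts `d`, up to scalar factors. -/
structure IsTransport (m : D → Matrix (Fin 2) (Fin 2) K) (T : V → Matrix (Fin 2) (Fin 2) K) :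
    Prop where
  det_ne_zero : ∀ x, (T x).det ≠ 0
  step : ∀ d, ProjEq (m d * T (G.src d)) (T (G.tgt d))

open Matrix in
/-- Matrices along the darts that are flat around the quadrilaterals, up to scalar factors, come from
matrices at the vertices, by the Poincaré lemma for the projective linear group. -/
theorem exists_isTransport [Finite V] [Finite D] {m : D → Matrix (Fin 2) (Fin 2) K}
    (hdet : ∀ d, (m d).det ≠ 0) (hrev : ∀ d, ProjEq 1 (m (G.rev d) * m d))
    (hflat : ∀ d, G.Inner d →
      ProjEq 1 (m (G.next (G.next (G.next d))) * m (G.next (G.next d)) * m (G.next d) * m d)) :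
    ∃ T, G.IsTransport m T := by
  let g : D → GL (Fin 2) K := fun d => GeneralLinearGroup.mkOfDetNeZero (m d) (hdet d)
  obtain ⟨φ, hφ⟩ := G.exists_potential
    (fun d => (QuotientGroup.mk (g d) : GL (Fin 2) K ⧸ Subgroup.center (GL (Fin 2) K)))
    (fun d => by
      rw [eq_inv_iff_mul_eq_one, ← QuotientGroup.mk_mul, ← QuotientGroup.mk_one, eq_comm,
        ← ProjEq.iff_mk_eq]
      exact hrev d)
    (fun d hd => by
      simp only [← QuotientGroup.mk_mul]
      rw [← QuotientGroup.mk_one, eq_comm, ← ProjEq.iff_mk_eq]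
      exact hflat d hd)
  refine ⟨fun x => (φ x).out.val, fun x => ?_, fun d => ?_⟩
  · exact (Matrix.isUnit_iff_isUnit_det _).1 (φ x).out.isUnit |>.ne_zero
  · change ProjEq ((g d * (φ (G.src d)).out : GL (Fin 2) K).val) _
    rw [ProjEq.iff_mk_eq, QuotientGroup.mk_mul, QuotientGroup.out_eq', QuotientGroup.out_eq', hφ]

end PlaneQuadGraph

namespace PlaneQuadGraph

variable {V D : Type*} (G : PlaneQuadGraph V D) {K : Type*} [Field K] [Algebra ℂ K]

/-! ### Bäcklund transformations -/

/-- A solution for a part of the strips, the one with the edges `act`: the equation holds, and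
determines `v₁₂`, on the quadrilaterals where two of these strips cross, and the function is
constant along the other edges of quadrilaterals. -/
structure IsPartialSolution (E : QuadEquation) (a : G.Strip → ℂ) (act : D → Prop) (u : V → K) :
    Prop where
  rev_iff : ∀ d, act (G.rev d) ↔ act d
  next_next_iff : ∀ d, G.Inner d → (act (G.next (G.next d)) ↔ act d)
  const : ∀ d, G.Inner d → ¬ act d → u (G.tgt d) = u (G.src d)
  form_eq : ∀ d, G.Inner d → act d → act (G.next d) →
    E.form (a (G.strip d)) (a (G.strip (G.next d))) (vec (u (G.src d))) (vec (u (G.tgt d)))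
      (vec (u (G.src (G.next (G.next (G.next d)))))) (vec (u (G.tgt (G.next d)))) = 0
  form_ne : ∀ d, G.Inner d → act d → act (G.next d) →
    E.form (a (G.strip d)) (a (G.strip (G.next d))) (vec (u (G.src d))) (vec (u (G.tgt d)))
      (vec (u (G.src (G.next (G.next (G.next d)))))) ![0, 1] ≠ 0

open Classical in
/-- The map of the projective line by which a Bäcklund transformation with parameter `γ` continues
along a dart: the equation on the vertical face over the dart of a cube.  It is the identity along the
edges that are not in use. -/
noncomputable def backlund (E : QuadEquation) (a : G.Strip → ℂ) (act : D → Prop) (u : V → K) (γ : ℂ)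
    (d : D) : Matrix (Fin 2) (Fin 2) K :=
  if act d then E.transfer (a (G.strip d)) γ (vec (u (G.src d))) (vec (u (G.tgt d))) else 1

section

variable {G} {E : QuadEquation} {a : G.Strip → ℂ} {act : D → Prop} {u : V → K}

theorem backlund_of_act {d : D} (h : act d) (γ : ℂ) : G.backlund E a act u γ d =
    E.transfer (a (G.strip d)) γ (vec (u (G.src d))) (vec (u (G.tgt d))) := if_pos h

theorem backlund_of_not {d : D} (h : ¬ act d) (γ : ℂ) : G.backlund E a act u γ d = 1 := if_neg h

theorem continuousCombination_backlund (d : D) (i j : Fin 2) :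
    ContinuousCombination fun γ => G.backlund E a act u γ d i j := by
  by_cases h : act d
  · simp only [backlund_of_act h]; exact E.continuousCombination_transfer _ _ _ _ _
  · simp only [backlund_of_not h]; exact .const _

theorem backlund_rev (hrev : ∀ d, act (G.rev d) ↔ act d) (γ : ℂ) (d : D) :
    ProjEq (G.backlund E a act u γ d).adjugate (G.backlund E a act u γ (G.rev d)) := by
  by_cases h : act d
  · obtain ⟨σ, hσ, hσ'⟩ := E.exists_transfer_swap (R := K)
    refine ⟨algebraMap ℂ K σ, by simpa using hσ, ?_⟩
    rw [backlund_of_act h, backlund_of_act ((hrev d).2 h), G.strip_rev, G.src_rev, G.tgt_rev, hσ']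
  · rw [backlund_of_not h, backlund_of_not (mt (hrev d).1 h), Matrix.adjugate_one]
    exact .refl _

theorem det_backlund_ne_zero {γ : ℂ} (hdet : ∀ d, act d →
    (E.transfer (a (G.strip d)) γ (vec (u (G.src d))) (vec (u (G.tgt d)))).det ≠ 0) (d : D) :
    (G.backlund E a act u γ d).det ≠ 0 := by
  by_cases h : act d
  · rw [backlund_of_act h]; exact hdet d h
  · rw [backlund_of_not h, Matrix.det_one]; exact one_ne_zero

/-- Both ways around a quadrilateral give the same map. -/
theorem IsPartialSolution.backlund_flat (hE : E.Consistent3D)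
    (ha : G.Admissible E a) (hu : G.IsPartialSolution E a act u) {γ : ℂ}
    (hnd : ∀ d, act d → E.Nondegenerate (a (G.strip d)) γ)
    (hdet : ∀ d, act d →
      (E.transfer (a (G.strip d)) γ (vec (u (G.src d))) (vec (u (G.tgt d)))).det ≠ 0) {d : D}
    (hd : G.Inner d) :
    ProjEq (G.backlund E a act u γ (G.next d) * G.backlund E a act u γ d)
      (G.backlund E a act u γ (G.rev (G.next (G.next d))) *
        G.backlund E a act u γ (G.rev (G.next (G.next (G.next d))))) := by
  have hd1 := G.inner_next hd
  have hd2 := G.inner_next hd1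
  have hd3 := G.inner_next hd2
  have hdet' := det_backlund_ne_zero hdet
  have r2 : act (G.rev (G.next (G.next d))) ↔ act d :=
    (hu.rev_iff _).trans (hu.next_next_iff d hd)
  have r3 : act (G.rev (G.next (G.next (G.next d)))) ↔ act (G.next d) :=
    (hu.rev_iff _).trans (hu.next_next_iff _ hd1)
  have s2 : G.strip (G.rev (G.next (G.next d))) = G.strip d := by
    rw [G.strip_rev, G.strip_next_next hd]
  have s3 : G.strip (G.rev (G.next (G.next (G.next d)))) = G.strip (G.next d) := by
    rw [G.strip_rev, G.strip_next_next hd1]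
  by_cases h : act d <;> by_cases h' : act (G.next d)
  · obtain ⟨s, hs⟩ := E.transfer_flat hE (ha d hd) (hnd d h) (hnd _ h') (hu.form_eq d hd h h')
      (hu.form_ne d hd h h') (hdet d h) (by have := hdet _ h'; rwa [G.src_next] at this)
    have e : G.backlund E a act u γ (G.rev (G.next (G.next d))) *
        G.backlund E a act u γ (G.rev (G.next (G.next (G.next d)))) =
        s • (G.backlund E a act u γ (G.next d) * G.backlund E a act u γ d) := by
      rw [backlund_of_act h, backlund_of_act h', backlund_of_act (r2.2 h), backlund_of_act (r3.2 h'),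
        s2, s3]
      simp only [G.src_rev, G.tgt_rev, G.src_next, G.tgt_next_three hd] at hs ⊢
      exact hs
    refine ⟨s, fun h0 => ?_, e⟩
    have := mul_ne_zero (hdet' (G.rev (G.next (G.next d))))
      (hdet' (G.rev (G.next (G.next (G.next d)))))
    rw [← Matrix.det_mul, e, h0, zero_smul, Matrix.det_zero] at this
    exact this rfl
  · rw [backlund_of_not h', backlund_of_not (mt r3.1 h'), one_mul, mul_one, backlund_of_act h,
      backlund_of_act (r2.2 h), s2]
    have c1 := hu.const _ hd1 h'
    have c3 := hu.const _ hd3 (mt (hu.next_next_iff _ hd1).1 h')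
    simp only [G.src_rev, G.tgt_rev, G.src_next, G.tgt_next_three hd] at c1 c3 ⊢
    rw [c1, c3]
    exact .refl _
  · rw [backlund_of_not h, backlund_of_not (mt r2.1 h), one_mul, mul_one, backlund_of_act h',
      backlund_of_act (r3.2 h'), s3]
    have c1 := hu.const _ hd h
    have c3 := hu.const _ hd2 (mt (hu.next_next_iff _ hd).1 h)
    simp only [G.src_rev, G.tgt_rev, G.src_next, G.tgt_next_three hd] at c1 c3 ⊢
    rw [c1, c3]
    exact .refl _
  · rw [backlund_of_not h, backlund_of_not h', backlund_of_not (mt r2.1 h),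
      backlund_of_not (mt r3.1 h')]
    exact .refl _

/-- The Bäcklund transformations of a partial solution are independent of the path if the
parameter `γ` is generic. -/
theorem IsPartialSolution.exists_isTransport [Finite V] [Finite D] (hE : E.Consistent3D)
    (ha : G.Admissible E a) (hu : G.IsPartialSolution E a act u) {γ : ℂ}
    (hnd : ∀ d, act d → E.Nondegenerate (a (G.strip d)) γ)
    (hdet : ∀ d, act d →
      (E.transfer (a (G.strip d)) γ (vec (u (G.src d))) (vec (u (G.tgt d)))).det ≠ 0) :
    ∃ T, G.IsTransport (G.backlund E a act u γ) T := by
  have hdet' := det_backlund_ne_zero hdet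
  have hrev := fun d => backlund_rev (E := E) (a := a) (u := u) hu.rev_iff γ d
  have hinv : ∀ d, ProjEq 1 (G.backlund E a act u γ (G.rev d) * G.backlund E a act u γ d) :=
    fun d => (ProjEq.adjugate_mul (hdet' d)).trans ((hrev d).mul (.refl _))
  refine G.exists_isTransport hdet' hinv fun d hd => ?_
  have h2 := hinv (G.rev (G.next (G.next d)))
  have h3 := hinv (G.rev (G.next (G.next (G.next d))))
  rw [G.rev_rev] at h2 h3
  have hf := (hu.backlund_flat hE ha hnd hdet hd).symm
  have key := ((ProjEq.refl (G.backlund E a act u γ (G.next (G.next (G.next d))))).mul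
    (((ProjEq.refl (G.backlund E a act u γ (G.next (G.next d)))).mul hf)))
  simp only [← mul_assoc] at key
  refine ProjEq.trans ?_ key
  refine h3.trans ?_
  refine ProjEq.mul ?_ (.refl _)
  conv => arg 1; rw [← mul_one (G.backlund E a act u γ (G.next (G.next (G.next d))))]
  rw [mul_assoc]
  exact (ProjEq.refl _).mul h2

/-! ### Matrices of a Bäcklund transformation between two vertices -/

/-- A product of matrices of Bäcklund transformations along some path from `x` to `y`, as a function of
the parameter. -/
structure IsParallel (G : PlaneQuadGraph V D) (M : ℂ → D → Matrix (Fin 2) (Fin 2) K) (x y : V)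
    (W : ℂ → Matrix (Fin 2) (Fin 2) K) : Prop where
  continuousCombination : ∀ i j, ContinuousCombination fun γ => W γ i j
  transport : ∀ γ T, G.IsTransport (M γ) T → ProjEq (W γ * T x) (T y)

namespace IsParallel

variable {M : ℂ → D → Matrix (Fin 2) (Fin 2) K} {x y z : V} {W W' : ℂ → Matrix (Fin 2) (Fin 2) K}

theorem refl (x : V) : G.IsParallel M x x fun _ => 1 :=
  ⟨fun _ _ => .const _, fun _ _ _ => by rw [one_mul]; exact .refl _⟩

theorem of_dart (hM : ∀ d i j, ContinuousCombination fun γ => M γ d i j) (d : D) :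
    G.IsParallel M (G.src d) (G.tgt d) fun γ => M γ d :=
  ⟨hM d, fun _ _ h => h.step d⟩

theorem trans (h : G.IsParallel M x y W) (h' : G.IsParallel M y z W') :
    G.IsParallel M x z fun γ => W' γ * W γ := by
  refine ⟨fun i j => ?_, fun γ T hT => ?_⟩
  · simp only [Matrix.mul_apply]
    exact .sum _ fun k _ => (h'.continuousCombination i k).mul (h.continuousCombination k j)
  · rw [mul_assoc]
    exact ((ProjEq.refl _).mul (h.transport γ T hT)).trans (h'.transport γ T hT)

theorem det_ne_zero (h : G.IsParallel M x y W) {γ : ℂ} {T : V → Matrix (Fin 2) (Fin 2) K}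
    (hT : G.IsTransport (M γ) T) : (W γ).det ≠ 0 := by
  obtain ⟨c, hc, h1⟩ := h.transport γ T hT
  intro h0
  have := hT.det_ne_zero y
  rw [h1, Matrix.det_smul, Matrix.det_mul, h0] at this
  simp at this

theorem symm (h : G.IsParallel M x y W) : G.IsParallel M y x fun γ => (W γ).adjugate := by
  refine ⟨fun i j => ?_, fun γ T hT => ?_⟩
  · simp only [Matrix.adjugate_fin_two]
    fin_cases i <;> fin_cases j
    exacts [h.continuousCombination _ _, (h.continuousCombination _ _).neg,
      (h.continuousCombination _ _).neg, h.continuousCombination _ _]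
  · have h1 := (ProjEq.refl (W γ).adjugate).mul (h.transport γ T hT)
    refine h1.symm.trans ?_
    rw [← mul_assoc]
    have := ((ProjEq.adjugate_mul (h.det_ne_zero hT)).mul (.refl (T x))).symm
    rwa [one_mul] at this

theorem projEq (h : G.IsParallel M x y W) (h' : G.IsParallel M x y W') {γ : ℂ}
    {T : V → Matrix (Fin 2) (Fin 2) K} (hT : G.IsTransport (M γ) T) : ProjEq (W γ) (W' γ) :=
  ProjEq.cancel_right (hT.det_ne_zero x) ((h.transport γ T hT).trans (h'.transport γ T hT).symm)

open Filter Topology in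
/-- Matrices along two paths are proportional also at those values of the parameter where some
Bäcklund matrices are singular, by passing to the limit. -/
theorem _root_.ProjEq.of_frequently {a : ℂ}
    (hW : ∀ i j, ContinuousCombination fun γ => W γ i j)
    (hW' : ∀ i j, ContinuousCombination fun γ => W' γ i j)
    (h : ∃ᶠ γ in 𝓝[≠] a, ProjEq (W γ) (W' γ)) (hdet : (W a).det ≠ 0) (hdet' : (W' a).det ≠ 0) :
    ProjEq (W a) (W' a) := by
  refine ProjEq.of_apply_mul_apply hdet hdet' fun i j k l => ?_
  exact (((hW i j).mul (hW' k l)).sub ((hW k l).mul (hW' i j))).eq_zero_of_frequently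
    (h.mono fun γ hγ => hγ.apply_mul_apply i j k l)

/-- Along a path on whose darts two families of Bäcklund matrices agree, they have a common product. -/
theorem exists_common {M' : ℂ → D → Matrix (Fin 2) (Fin 2) K}
    (hM : ∀ d i j, ContinuousCombination fun γ => M γ d i j)
    (h : Relation.ReflTransGen (fun z w => ∃ d, G.src d = z ∧ G.tgt d = w ∧ ∀ γ, M γ d = M' γ d) x y) :
    ∃ W, G.IsParallel M x y W ∧ G.IsParallel M' x y W := by
  induction h with
  | refl => exact ⟨_, refl x, refl x⟩
  | tail _ hd ih =>
    obtain ⟨W, h1, h2⟩ := ih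
    obtain ⟨d, rfl, rfl, hd⟩ := hd
    refine ⟨_, h1.trans (of_dart hM d), h2.trans ?_⟩
    exact ⟨hM d, fun γ T hT => by rw [hd]; exact hT.step d⟩

end IsParallel

end

end PlaneQuadGraph

namespace PlaneQuadGraph

variable {V D : Type*} {G : PlaneQuadGraph V D} {E : QuadEquation} {a : G.Strip → ℂ} {u : V → ℂ}

/-! ### Bäcklund transformations of a solution along its strips -/

theorem IsSolution.form_eq (hu : G.IsSolution E a u) {d : D} (hd : G.Inner d) :
    E.form (a (G.strip d)) (a (G.strip (G.next d))) (vec (u (G.src d))) (vec (u (G.tgt d)))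
      (vec (u (G.src (G.next (G.next (G.next d)))))) (vec (u (G.tgt (G.next d)))) = 0 := by
  have := ((E.determines_iff _ _ _ _ _ _).1 (hu d hd)).1
  rwa [G.src_next, G.src_next (G.next d)] at this

theorem IsSolution.form_ne (hu : G.IsSolution E a u) {d : D} (hd : G.Inner d) :
    E.form (a (G.strip d)) (a (G.strip (G.next d))) (vec (u (G.src d))) (vec (u (G.tgt d)))
      (vec (u (G.src (G.next (G.next (G.next d)))))) ![0, 1] ≠ 0 := by
  have := ((E.determines_iff _ _ _ _ _ _).1 (hu d hd)).2
  rwa [G.src_next] at this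

theorem IsSolution.isPartialSolution (hu : G.IsSolution E a u) :
    G.IsPartialSolution E a G.Bordering u where
  rev_iff _ := G.bordering_rev
  next_next_iff _ hd := iff_of_true (G.inner_next (G.inner_next hd)).bordering hd.bordering
  const _ hd h := absurd hd.bordering h
  form_eq _ hd _ _ := hu.form_eq hd
  form_ne _ hd _ _ := hu.form_ne hd

/-- The transfer matrix is invertible as `v₂` and `v₁₂` determine each other. -/
theorem IsSolution.det_transfer_ne_zero (hu : G.IsSolution E a u) {d : D} (hd : G.Inner d) :
    (E.transfer (a (G.strip d)) (a (G.strip (G.next d)))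
      (vec (u (G.src d))) (vec (u (G.tgt d)))).det ≠ 0 := by
  rw [E.det_transfer_vec _ _ _ _ (u (G.src (G.next (G.next (G.next d))))) (u (G.tgt (G.next d))),
    hu.form_eq hd, zero_mul, zero_sub, neg_ne_zero]
  refine mul_ne_zero (hu.form_ne hd) fun h0 => hu.form_ne (G.inner_next hd) ?_
  obtain ⟨τ, -, hτ⟩ := E.exists_form_rotate (R := ℂ)
  rw [G.next_four hd, G.strip_next_next hd, G.src_next, hτ, h0, mul_zero]

open Filter Topology

theorem IsSolution.eventually_exists_isTransport [Finite V] [Finite D] (hE : E.Consistent3D)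
    (ha : G.Admissible E a) (hu : G.IsSolution E a u) (b : ℂ) :
    ∀ᶠ γ in 𝓝[≠] b, ∃ T, G.IsTransport (G.backlund E a G.Bordering u γ) T := by
  have h1 : ∀ d, ∃ β, G.Bordering d → E.Nondegenerate (a (G.strip d)) β ∧
      (E.transfer (a (G.strip d)) β (vec (u (G.src d))) (vec (u (G.tgt d)))).det ≠ 0 := by
    intro d
    by_cases hd : G.Inner d
    · exact ⟨_, fun _ => ⟨ha d hd, hu.det_transfer_ne_zero hd⟩⟩
    by_cases hd' : G.Inner (G.rev d)
    · refine ⟨a (G.strip (G.next (G.rev d))), fun _ => ?_⟩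
      have e1 := ha _ hd'
      have e2 := hu.det_transfer_ne_zero hd'
      rw [G.strip_rev] at e1 e2
      refine ⟨e1, ?_⟩
      obtain ⟨σ, hσ, hσ'⟩ := E.exists_transfer_swap (R := ℂ)
      rw [← G.tgt_rev, ← G.src_rev, hσ', Matrix.det_smul, Matrix.det_adjugate]
      exact mul_ne_zero (pow_ne_zero _ (by simpa using hσ)) (pow_ne_zero _ e2)
    · exact ⟨0, fun h => absurd h (not_or.2 ⟨hd, hd'⟩)⟩
  choose β hβ using h1
  have h2 : ∀ d, ∀ᶠ γ in 𝓝[≠] b, G.Bordering d → E.Nondegenerate (a (G.strip d)) γ ∧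
      (E.transfer (a (G.strip d)) γ (vec (u (G.src d))) (vec (u (G.tgt d)))).det ≠ 0 := by
    intro d
    by_cases hd : G.Bordering d
    · have hdiff : Differentiable ℂ fun γ =>
          (E.transfer (a (G.strip d)) γ (vec (u (G.src d))) (vec (u (G.tgt d)))).det := by
        have := E.differentiable_coef (a (G.strip d))
        simp only [E.det_transfer, QuadEquation.edgeForm, Algebra.algebraMap_self, RingHom.id_apply]
        fun_prop
      filter_upwards [E.eventually_nondegenerate (hβ d hd).1 b,
        hdiff.eventually_ne_zero (hβ d hd).2 b] with γ e1 e2 _ using ⟨e1, e2⟩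
    · exact .of_forall fun γ h => absurd h hd
  filter_upwards [eventually_all.2 h2] with γ hγ
  exact hu.isPartialSolution.exists_isTransport hE ha (fun d hd => (hγ d hd).1)
    (fun d hd => (hγ d hd).2)

/-- A Bäcklund transformation along a strip, with the parameter of the strip, carries the values of the
solution on one side of the strip to each other if it is started on the other side. -/
theorem IsSolution.exists_rail (hu : G.IsSolution E a u) {d d' : D} (h : G.Coherent d d') :
    ∃ S, G.IsParallel (G.backlund E a G.Bordering u) (G.tgt d) (G.tgt d') S ∧
      (S (a (G.strip d))).det ≠ 0 ∧
      ∃ c : ℂ, c ≠ 0 ∧ (S (a (G.strip d))).mulVec (vec (u (G.src d))) = c • vec (u (G.src d')) := by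
  induction h with
  | rel d d' h =>
    obtain ⟨hd, rfl⟩ := h
    have hd1 := G.inner_next hd
    have hs := G.strip_next_next hd
    refine ⟨fun γ => G.backlund E a G.Bordering u γ (G.next d), ?_, ?_⟩
    · have := IsParallel.of_dart (G := G) (M := G.backlund E a G.Bordering u)
        continuousCombination_backlund (G.next d)
      rwa [G.src_next, ← G.src_next (G.next d), ← G.tgt_rev] at this
    · beta_reduce
      rw [backlund_of_act hd1.bordering, ← hs]
      refine ⟨hu.det_transfer_ne_zero hd1, ?_⟩
      have := (hu _ hd1).mulVec_eq
      rwa [G.next_four hd, G.src_next (G.next d), G.src_next (G.next (G.next d))] at this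
  | refl d =>
    refine ⟨_, .refl _, by simp, 1, one_ne_zero, ?_⟩
    rw [Matrix.one_mulVec, one_smul]
  | symm d d' h ih =>
    obtain ⟨S, h1, h2, c, hc, h3⟩ := ih
    rw [Coherent.strip_eq G h] at h2 h3
    refine ⟨_, h1.symm, ?_, (S (a (G.strip d'))).det / c, div_ne_zero h2 hc, ?_⟩
    · rw [Matrix.det_adjugate]; exact pow_ne_zero _ h2
    · have := congrArg (S (a (G.strip d'))).adjugate.mulVec h3
      rw [Matrix.mulVec_mulVec, Matrix.adjugate_mul, Matrix.smul_mulVec, Matrix.one_mulVec,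
        Matrix.mulVec_smul] at this
      rw [div_eq_inv_mul, mul_smul, this, smul_smul, inv_mul_cancel₀ hc, one_smul]
  | trans d d' d'' h h' ih ih' =>
    obtain ⟨S, h1, h2, c, hc, h3⟩ := ih
    obtain ⟨S', h1', h2', c', hc', h3'⟩ := ih'
    rw [← Coherent.strip_eq G h] at h2' h3'
    refine ⟨_, h1.trans h1', ?_, c * c', mul_ne_zero hc hc', ?_⟩
    · rw [Matrix.det_mul]; exact mul_ne_zero h2' h2
    · rw [← Matrix.mulVec_mulVec, h3, Matrix.mulVec_smul, h3', smul_smul]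

/-! ### Uniqueness -/

/-- Two solutions that agree on a connected set of vertices which contains the edge `d` agree also
where another edge `f` of the same strip leads out of this set. Both values at the end of `f`
are obtained by a Bäcklund transformation along the strip, and as it does not depend on the
path, it may be computed within the set, where the solutions agree. -/
theorem IsSolution.eq_tgt_of_reachable [Finite V] [Finite D] (hE : E.Consistent3D)
    (hG : G.NoSelfIntersection) (ha : G.Admissible E a) {u' : V → ℂ} (hu : G.IsSolution E a u)
    (hu' : G.IsSolution E a u') {d f : D} (hdf : G.strip d = G.strip f)
    (hside : G.side (G.strip d) (G.tgt d) = G.side (G.strip d) (G.src f))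
    (hwalk : Relation.ReflTransGen (fun z w => ∃ e, G.src e = z ∧ G.tgt e = w ∧ u z = u' z ∧ u w = u' w)
      (G.tgt d) (G.src f)) (hsrc : u (G.src d) = u' (G.src d)) : u (G.tgt f) = u' (G.tgt f) := by
  have hco : G.Coherent d (G.rev f) := by
    refine coherent_of_side hG (by rw [hdf, G.strip_rev]) ?_
    refine G.side_eq_of_ne_of_ne (z := G.src f) ?_ ?_
    · rw [← hside]; exact (G.side_tgt_ne rfl).symm
    · rw [G.src_rev]; exact G.side_tgt_ne hdf.symm
  obtain ⟨S, h1, h2, c, hc, h3⟩ := hu.exists_rail hco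
  obtain ⟨S', h1', h2', c', hc', h3'⟩ := hu'.exists_rail hco
  obtain ⟨N, hN, hN'⟩ := IsParallel.exists_common (G := G) (M := G.backlund E a G.Bordering u)
    (M' := G.backlund E a G.Bordering u') continuousCombination_backlund
    (Relation.ReflTransGen.mono (fun z w ⟨e, e1, e2, e3, e4⟩ => ⟨e, e1, e2, fun γ => by
      subst e1 e2
      simp only [backlund, e3, e4]⟩) _ _ hwalk)
  rw [G.tgt_rev] at h1 h1'
  rw [G.src_rev] at h3 h3'
  have hev := ((hu.eventually_exists_isTransport hE ha (a (G.strip d))).and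
    (hu'.eventually_exists_isTransport hE ha (a (G.strip d)))).mono fun γ ⟨⟨T, hT⟩, ⟨T', hT'⟩⟩ =>
      (h1.projEq hN hT).trans (hN'.projEq h1' hT')
  obtain ⟨m, hm, hS⟩ := ProjEq.of_frequently h1.continuousCombination h1'.continuousCombination
    hev.frequently h2 h2'
  rw [hS, ← hsrc, Matrix.smul_mulVec, h3, smul_smul] at h3'
  have e0 := congrFun h3' 0
  have e1 := congrFun h3' 1
  simp only [Pi.smul_apply, vec_zero, vec_one, smul_eq_mul, mul_one] at e0 e1
  rw [e0] at e1
  exact mul_left_cancel₀ hc' e1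

/-- A solution is determined by its values on a path that meets every strip. -/
theorem SolvesCauchy.unique [Finite V] [Finite D] (hE : E.Consistent3D)
    (hG : G.NoSelfIntersection) (ha : G.Admissible E a) {n : ℕ} {P : G.SimplePath n}
    (hP : ∀ s, ∃ i, G.strip (P.edge i) = s) {p : Fin (n + 1) → ℂ} {u' : V → ℂ}
    (hu : G.SolvesCauchy E a P p u) (hu' : G.SolvesCauchy E a P p u') : u = u' := by
  set r : V → V → Prop :=
    fun z w => ∃ e, G.src e = z ∧ G.tgt e = w ∧ u z = u' z ∧ u w = u' w with hr
  have : Std.Symm r := ⟨fun z w ⟨e, e1, e2, e3, e4⟩ =>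
    ⟨G.rev e, e2 ▸ rfl, by rw [G.tgt_rev, e1], e4, e3⟩⟩
  have hsymm : ∀ x y, Relation.ReflTransGen r x y → Relation.ReflTransGen r y x := fun x y h =>
    symm h
  have hvert : ∀ i, u (P.vert i) = u' (P.vert i) := fun i => by rw [hu.2, hu'.2]
  have hpath : ∀ i, Relation.ReflTransGen r (P.vert 0) (P.vert i) := by
    intro i
    induction i using Fin.induction with
    | zero => exact .refl
    | succ i ih => exact ih.tail ⟨P.edge i, P.src_edge i, P.tgt_edge i, hvert _, hvert _⟩
  have key : ∀ z, Relation.ReflTransGen r (P.vert 0) z ∧ u z = u' z := by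
    intro z
    induction G.reflTransGen_to (P.vert 0) z with
    | refl => exact ⟨.refl, hvert 0⟩
    | tail _ hd ih =>
      obtain ⟨f, rfl, rfl⟩ := hd
      obtain ⟨i, hi⟩ := hP (G.strip f)
      have hval : u (G.tgt f) = u' (G.tgt f) := by
        by_cases hs : G.side (G.strip f) (P.vert i.succ) = G.side (G.strip f) (G.src f)
        · refine hu.1.eq_tgt_of_reachable (d := P.edge i) hE hG ha hu'.1 hi ?_ ?_ ?_
          · rw [hi, P.tgt_edge, hs]
          · rw [P.tgt_edge]; exact (hsymm _ _ (hpath _)).trans ih.1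
          · rw [P.src_edge, hvert]
        · refine hu.1.eq_tgt_of_reachable (d := G.rev (P.edge i)) hE hG ha hu'.1
            (by rw [G.strip_rev, hi]) ?_ ?_ ?_
          · rw [G.strip_rev, hi, G.tgt_rev]
            refine G.side_eq_of_ne_of_ne (z := P.vert i.succ) ?_ (Ne.symm hs)
            rw [← P.tgt_edge]; exact (G.side_tgt_ne hi).symm
          · rw [G.tgt_rev, P.src_edge]; exact (hsymm _ _ (hpath _)).trans ih.1
          · rw [G.src_rev, P.tgt_edge, hvert]
      exact ⟨ih.1.tail ⟨f, rfl, rfl, ih.2, hval⟩, hval⟩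
  exact funext fun z => (key z).2

end PlaneQuadGraph

/-! ### Paths that meet a strip twice -/

/-- The product of the transfer matrices with parameter `γ` along `m` edges that start with the `i`-th
one, where `x` are the values of the field along the path and `b` the parameters of its edges. -/
noncomputable def QuadEquation.pathTransfer (E : QuadEquation) {R : Type*} [CommRing R] [Algebra ℂ R]
    (b : ℕ → ℂ) (γ : ℂ) (x : ℕ → R) (i : ℕ) : ℕ → Matrix (Fin 2) (Fin 2) R
  | 0 => 1
  | m + 1 => E.transfer (b (i + m)) γ (vec (x (i + m))) (vec (x (i + m + 1))) *
      E.pathTransfer b γ x i m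

namespace QuadEquation

variable {E : QuadEquation}

theorem map_pathTransfer {R S : Type*} [CommRing R] [Algebra ℂ R] [CommRing S] [Algebra ℂ S]
    (f : R →ₐ[ℂ] S) (b : ℕ → ℂ) (γ : ℂ) (x : ℕ → R) (i m : ℕ) :
    (E.pathTransfer b γ x i m).map f = E.pathTransfer b γ (f ∘ x) i m := by
  induction m with
  | zero => simp [pathTransfer]
  | succ m ih =>
    rw [pathTransfer, Matrix.map_mul, ih, map_transfer, comp_vec, comp_vec]
    rfl

theorem pathTransfer_congr {R : Type*} [CommRing R] [Algebra ℂ R] (b : ℕ → ℂ) (γ : ℂ) {x y : ℕ → R}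
    (i m : ℕ) (h : ∀ k, i ≤ k → k ≤ i + m → x k = y k) :
    E.pathTransfer b γ x i m = E.pathTransfer b γ y i m := by
  induction m with
  | zero => rfl
  | succ m ih =>
    rw [pathTransfer, pathTransfer, ih fun k h1 h2 => h k h1 (by omega), h (i + m) (by omega) (by omega),
      h (i + m + 1) (by omega) (by omega)]

theorem det_pathTransfer_X_ne_zero {n : ℕ} (b : ℕ → ℂ) (γ : ℂ) (i m : ℕ) (hm : i + m < n + 1)
    (hb : ∀ k, i ≤ k → k < i + m → E.Nondegenerate (b k) γ) :
    (E.pathTransfer b γ (fun k => (MvPolynomial.X (Fin.ofNat (n + 1) k) :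
      MvPolynomial (Fin (n + 1)) ℂ)) i m).det ≠ 0 := by
  induction m with
  | zero => simp [pathTransfer]
  | succ m ih =>
    rw [pathTransfer, Matrix.det_mul]
    refine mul_ne_zero (det_transfer_X_ne_zero (hb _ (by omega) (by omega)) fun f hf h0 => hf ?_)
      (ih (by omega) fun k h1 h2 => hb k h1 (by omega))
    have hinj : Function.Injective ![Fin.ofNat (n + 1) (i + m), Fin.ofNat (n + 1) (i + m + 1)] := by
      have : Fin.ofNat (n + 1) (i + m) ≠ Fin.ofNat (n + 1) (i + m + 1) := by
        intro h
        have := congrArg Fin.val h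
        simp only [Fin.ofNat, Nat.mod_eq_of_lt (show i + m < n + 1 by omega),
          Nat.mod_eq_of_lt (show i + m + 1 < n + 1 by omega)] at this
        omega
      intro k l hkl
      fin_cases k <;> fin_cases l <;>
        first | rfl | exact absurd hkl this | exact absurd hkl.symm this
    refine (map_eq_zero_iff _ (MvPolynomial.rename_injective _ hinj)).1 ?_
    rw [← h0]
    refine congrArg (fun φ : _ →ₐ[ℂ] _ => φ f) (MvPolynomial.algHom_ext fun k => ?_)
    rw [MvPolynomial.rename_X, MvPolynomial.aeval_X]
    fin_cases k <;> rfl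

/-- The condition on the data of a path which comes from a strip that is met by its edges `i` and
`i + m + 1` is not trivial: as long as the product of the transfer matrices is invertible, the other
values leave at most one possibility for the last one. -/
theorem wedge_pathTransfer_X_ne_zero {n : ℕ} (b : ℕ → ℂ) (γ : ℂ) (i m : ℕ) (hm : i + m + 2 < n + 1)
    (hb : ∀ k, i + 1 ≤ k → k < i + 1 + m → E.Nondegenerate (b k) γ) :
    wedge ((E.pathTransfer b γ (fun k => (MvPolynomial.X (Fin.ofNat (n + 1) k) :
        MvPolynomial (Fin (n + 1)) ℂ)) (i + 1) m).mulVec (vec (MvPolynomial.X (Fin.ofNat (n + 1) i))))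
      (vec (MvPolynomial.X (Fin.ofNat (n + 1) (i + m + 2)))) ≠ 0 := by
  have hdet := det_pathTransfer_X_ne_zero (E := E) (n := n) b γ (i + 1) m (by omega) hb
  intro hw
  obtain ⟨p, hp⟩ : ∃ p, MvPolynomial.eval p (E.pathTransfer b γ (fun k =>
      (MvPolynomial.X (Fin.ofNat (n + 1) k) : MvPolynomial (Fin (n + 1)) ℂ)) (i + 1) m).det ≠ 0 := by
    by_contra! hall
    exact hdet (MvPolynomial.funext fun p => by rw [hall p, map_zero])
  have hN : ∀ q : Fin (n + 1) → ℂ, (E.pathTransfer b γ (fun k =>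
      (MvPolynomial.X (Fin.ofNat (n + 1) k) : MvPolynomial (Fin (n + 1)) ℂ)) (i + 1) m).map
        (MvPolynomial.aeval (R := ℂ) q) =
      E.pathTransfer b γ (fun k => q (Fin.ofNat (n + 1) k)) (i + 1) m := by
    intro q
    rw [map_pathTransfer]
    congr 1
    ext k
    exact MvPolynomial.aeval_X _ _
  rw [← MvPolynomial.coe_aeval_eq_eval] at hp
  change MvPolynomial.aeval (R := ℂ) p _ ≠ 0 at hp
  rw [AlgHom.map_det, AlgHom.mapMatrix_apply, hN] at hp
  set N := E.pathTransfer b γ (fun k => p (Fin.ofNat (n + 1) k)) (i + 1) m with hNdef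
  have hne : ∀ k, k ≤ i + m + 1 → Fin.ofNat (n + 1) k ≠ Fin.ofNat (n + 1) (i + m + 2) := by
    intro k hk h
    have := congrArg Fin.val h
    simp only [Fin.ofNat, Nat.mod_eq_of_lt (show k < n + 1 by omega),
      Nat.mod_eq_of_lt (show i + m + 2 < n + 1 by omega)] at this
    omega
  -- the last value may be chosen freely
  have key : ∀ t : ℂ, wedge (N.mulVec (vec (p (Fin.ofNat (n + 1) i)))) (vec t) = 0 := by
    intro t
    set q := Function.update p (Fin.ofNat (n + 1) (i + m + 2)) t with hq
    have hqp : ∀ k, k ≤ i + m + 1 → q (Fin.ofNat (n + 1) k) = p (Fin.ofNat (n + 1) k) :=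
      fun k hk => Function.update_of_ne (hne k hk) _ _
    have h1 := congrArg (MvPolynomial.aeval (R := ℂ) q) hw
    rw [map_zero, map_wedge, comp_vec, MvPolynomial.aeval_X] at h1
    have h2 : (MvPolynomial.aeval (R := ℂ) q) ∘ (E.pathTransfer b γ (fun k =>
        (MvPolynomial.X (Fin.ofNat (n + 1) k) : MvPolynomial (Fin (n + 1)) ℂ)) (i + 1) m).mulVec
          (vec (MvPolynomial.X (Fin.ofNat (n + 1) i))) =
        (E.pathTransfer b γ (fun k => q (Fin.ofNat (n + 1) k)) (i + 1) m).mulVec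
          (vec (q (Fin.ofNat (n + 1) i))) := by
      rw [← hN]
      have := RingHom.map_mulVec (MvPolynomial.aeval (R := ℂ) q).toRingHom
        (E.pathTransfer b γ (fun k => (MvPolynomial.X (Fin.ofNat (n + 1) k) :
          MvPolynomial (Fin (n + 1)) ℂ)) (i + 1) m) (vec (MvPolynomial.X (Fin.ofNat (n + 1) i)))
      rw [show vec (q (Fin.ofNat (n + 1) i)) = (MvPolynomial.aeval (R := ℂ) q) ∘
        vec (MvPolynomial.X (Fin.ofNat (n + 1) i)) by rw [comp_vec, MvPolynomial.aeval_X]]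
      exact funext fun k => this k
    rw [h2, hqp i (by omega)] at h1
    rw [pathTransfer_congr (y := fun k => p (Fin.ofNat (n + 1) k)) b γ (i + 1) m
      (fun k _ hk => hqp k (by omega))] at h1
    rwa [hq, Function.update_self] at h1
  have k0 := key 0
  have k1 := key 1
  simp only [wedge_vec_right] at k0 k1
  have hz : N.mulVec (vec (p (Fin.ofNat (n + 1) i))) = 0 := by
    ext k
    fin_cases k
    · simp only [Fin.zero_eta, Pi.zero_apply]; linear_combination k1 - k0
    · simp only [Fin.mk_one, Pi.zero_apply]; linear_combination -k0
  have := congrFun (Matrix.eq_zero_of_mulVec_eq_zero hp hz) 0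
  simp at this

end QuadEquation

namespace PlaneQuadGraph

variable {V D : Type*} {G : PlaneQuadGraph V D} {E : QuadEquation} {a : G.Strip → ℂ} {u : V → ℂ}

open Filter Topology

theorem isParallel_pathTransfer {v : ℕ → V} {e : ℕ → D} (i m : ℕ)
    (h : ∀ k, i ≤ k → k < i + m → G.src (e k) = v k ∧ G.tgt (e k) = v (k + 1) ∧ G.Bordering (e k)) :
    G.IsParallel (G.backlund E a G.Bordering u) (v i) (v (i + m)) fun γ =>
      E.pathTransfer (fun k => a (G.strip (e k))) γ (u ∘ v) i m := by
  induction m with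
  | zero => exact .refl _
  | succ m ih =>
    obtain ⟨h1, h2, h3⟩ := h (i + m) (by omega) (by omega)
    have := IsParallel.of_dart (G := G) (M := G.backlund E a G.Bordering u)
        continuousCombination_backlund (e (i + m))
    simp only [backlund_of_act h3, h1, h2] at this
    exact (ih fun k hk hk' => h k hk (by omega)).trans this

/-- If a path crosses a strip with its first and its last edge, and otherwise different strips, then
the values of a solution along the path satisfy a relation. -/
theorem IsSolution.wedge_pathTransfer [Finite V] [Finite D] (hE : E.Consistent3D)
    (hG : G.NoSelfIntersection) (ha : G.Admissible E a) (hu : G.IsSolution E a u)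
    {v : ℕ → V} {e : ℕ → D} {i m : ℕ}
    (he : ∀ k, i ≤ k → k ≤ i + m + 1 → G.src (e k) = v k ∧ G.tgt (e k) = v (k + 1))
    (hs : G.strip (e i) = G.strip (e (i + m + 1)))
    (hne : ∀ k, i < k → k < i + m + 1 → G.strip (e k) ≠ G.strip (e i))
    (hbord : ∀ k, i < k → k < i + m + 1 → G.Bordering (e k)) :
    wedge ((E.pathTransfer (fun k => a (G.strip (e k))) (a (G.strip (e i))) (u ∘ v) (i + 1) m).mulVec
      (vec (u (v i)))) (vec (u (v (i + m + 2)))) = 0 := by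
  obtain ⟨hsi, hti⟩ := he i le_rfl (by omega)
  obtain ⟨hsj, htj⟩ := he (i + m + 1) (by omega) le_rfl
  have hside : ∀ l, l ≤ m →
      G.side (G.strip (e i)) (v (i + 1 + l)) = G.side (G.strip (e i)) (v (i + 1)) := by
    intro l
    induction l with
    | zero => exact fun _ => rfl
    | succ l ih =>
      intro hl
      obtain ⟨h1, h2⟩ := he (i + 1 + l) (by omega) (by omega)
      rw [← ih (by omega), ← h1, ← add_assoc, ← h2]
      exact G.side_tgt_of_ne (hne _ (by omega) (by omega))
  have hco : G.Coherent (e i) (G.rev (e (i + m + 1))) := by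
    refine coherent_of_side hG (by rw [hs, G.strip_rev]) ?_
    refine G.side_eq_of_ne_of_ne (z := v (i + 1)) ?_ ?_
    · rw [← hti]; exact (G.side_tgt_ne rfl).symm
    · rw [← hside m le_rfl, G.src_rev, show i + 1 + m = i + m + 1 by omega, ← hsj]
      exact G.side_tgt_ne hs.symm
  obtain ⟨S, h1, h2, c, hc, h3⟩ := hu.exists_rail hco
  rw [hti, G.tgt_rev, hsj] at h1
  rw [hsi, G.src_rev, htj] at h3
  have hN := isParallel_pathTransfer (G := G) (E := E) (a := a) (u := u) (v := v) (e := e) (i + 1) m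
    fun k hk hk' => ⟨(he k (by omega) (by omega)).1, (he k (by omega) (by omega)).2,
      hbord k (by omega) (by omega)⟩
  rw [show i + 1 + m = i + m + 1 by omega] at hN
  set N := fun γ => E.pathTransfer (fun k => a (G.strip (e k))) γ (u ∘ v) (i + 1) m with hNdef
  have hev := (hu.eventually_exists_isTransport hE ha (a (G.strip (e i)))).mono fun γ ⟨T, hT⟩ =>
      h1.projEq hN hT
  have hcross : ∀ j k j' k', S (a (G.strip (e i))) j k * N (a (G.strip (e i))) j' k'
      - S (a (G.strip (e i))) j' k' * N (a (G.strip (e i))) j k = 0 := fun j k j' k' =>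
    (((h1.continuousCombination j k).mul (hN.continuousCombination j' k')).sub
      ((h1.continuousCombination j' k').mul (hN.continuousCombination j k))).eq_zero_of_frequently
      (hev.mono fun γ hγ => hγ.apply_mul_apply j k j' k').frequently
  obtain ⟨j, k, hjk⟩ : ∃ j k, S (a (G.strip (e i))) j k ≠ 0 := by
    by_contra! h0
    exact h2 (by simp [Matrix.det_fin_two, h0])
  have hNS : N (a (G.strip (e i)))
      = (N (a (G.strip (e i))) j k / S (a (G.strip (e i))) j k) • S (a (G.strip (e i))) := by
    ext j' k'
    rw [Matrix.smul_apply, smul_eq_mul, div_mul_eq_mul_div, eq_div_iff hjk]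
    linear_combination hcross j k j' k'
  change wedge ((N (a (G.strip (e i)))).mulVec (vec (u (v i)))) (vec (u (v (i + m + 2)))) = 0
  rw [hNS, Matrix.smul_mulVec, h3, smul_smul, ← one_smul ℂ (vec (u (v (i + m + 2)))), wedge_smul_smul,
    one_smul]
  exact mul_eq_zero_of_right _ (wedge_self _)

/-- A path with no repeated strip in its interior which starts and ends on a strip `s` crosses
only strips that intersect `s`. -/
theorem exists_inner_of_strip_eq [Finite V] [Finite D] {v : ℕ → V} {e : ℕ → D} {i m : ℕ}
    (he : ∀ k, i ≤ k → k ≤ i + m + 1 → G.src (e k) = v k ∧ G.tgt (e k) = v (k + 1))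
    (hs : G.strip (e i) = G.strip (e (i + m + 1)))
    (hne : ∀ k l, i ≤ k → k < l → l < i + m + 1 → G.strip (e k) ≠ G.strip (e l)) {k : ℕ} (hk : i < k)
    (hk' : k < i + m + 1) : ∃ f, G.Inner f ∧ G.strip f = G.strip (e k) ∧
      G.strip (G.next f) = G.strip (e i) := by
  have h1 : ∀ l, i + l ≤ k → G.side (G.strip (e k)) (v (i + l)) = G.side (G.strip (e k)) (v i) := by
    intro l
    induction l with
    | zero => exact fun _ => rfl
    | succ l ih =>
      intro hl
      obtain ⟨h1, h2⟩ := he (i + l) (by omega) (by omega)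
      rw [← ih (by omega), ← h1, ← add_assoc, ← h2]
      exact G.side_tgt_of_ne (hne _ _ (by omega) (by omega) (by omega))
  have h2 : ∀ l, k + 1 + l ≤ i + m + 1 →
      G.side (G.strip (e k)) (v (k + 1 + l)) = G.side (G.strip (e k)) (v (k + 1)) := by
    intro l
    induction l with
    | zero => exact fun _ => rfl
    | succ l ih =>
      intro hl
      obtain ⟨h1, h2⟩ := he (k + 1 + l) (by omega) (by omega)
      rw [← ih (by omega), ← h1, ← add_assoc, ← h2]
      exact G.side_tgt_of_ne (hne k _ (by omega) (by omega) (by omega)).symm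
  obtain ⟨f, hf, hf1, hf2⟩ := G.exists_crossing (s := G.strip (e k)) hs
    (hne i k le_rfl hk hk') (by
      have e1 := h1 (k - i) (by omega)
      have e2 := h2 (i + m - k) (by omega)
      rw [show i + (k - i) = k by omega] at e1
      rw [show k + 1 + (i + m - k) = i + m + 1 by omega] at e2
      rw [(he i le_rfl (by omega)).1, (he _ (by omega) le_rfl).1, e2, ← e1,
        ← (he k (by omega) (by omega)).1, ← (he k (by omega) (by omega)).2]
      exact (G.side_tgt_ne rfl).symm)
  refine ⟨G.next f, G.inner_next hf, hf2, ?_⟩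
  rw [G.strip_next_next hf, hf1]

theorem Inner.bordering_of_strip_eq {f d : D} (hf : G.Inner f) (h : G.strip f = G.strip d) :
    G.Bordering d := by
  by_contra hd
  rcases G.eq_or_eq_rev_of_not_bordering hd h.symm with rfl | rfl
  · exact hd hf.bordering
  · exact hd (G.bordering_rev.1 hf.bordering)

/-- If a strip meets the path in two edges, generic initial data do not belong to a solution. -/
theorem SimplePath.not_solvesCauchy [Finite V] [Finite D] (hE : E.Consistent3D)
    (hG : G.NoSelfIntersection) (ha : G.Admissible E a) {n : ℕ} (P : G.SimplePath n)
    (h : ¬ Function.Injective fun i => G.strip (P.edge i)) :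
    HoldsGenerically fun p => ¬ ∃ u : V → ℂ, G.SolvesCauchy E a P p u := by
  classical
  let v : ℕ → V := fun k => P.vert (Fin.ofNat (n + 1) k)
  let e : ℕ → D := fun k => if h : k < n then P.edge ⟨k, h⟩ else G.outer
  have he : ∀ k, k < n → G.src (e k) = v k ∧ G.tgt (e k) = v (k + 1) := by
    intro k hk
    simp only [e, v, dif_pos hk, P.src_edge, P.tgt_edge]
    constructor
    · congr 1; ext; simp [Fin.ofNat, Nat.mod_eq_of_lt (show k < n + 1 by omega)]
    · congr 1; ext; simp [Fin.ofNat, Nat.mod_eq_of_lt (show k + 1 < n + 1 by omega)]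
  have hex : ∃ m, ∃ i, i + m + 1 < n ∧ G.strip (e i) = G.strip (e (i + m + 1)) := by
    rw [Function.Injective] at h
    push Not at h
    obtain ⟨i, j, hij, hne⟩ := h
    wlog hlt : i < j generalizing i j
    · exact this j i hij.symm hne.symm (lt_of_le_of_ne (not_lt.1 hlt) hne.symm)
    refine ⟨j - i - 1, i, ?_, ?_⟩
    · have : (i : ℕ) < j := hlt
      omega
    · have : (i : ℕ) + (j - i - 1) + 1 = j := by have : (i : ℕ) < j := hlt; omega
      rw [this]
      simpa [e] using hij
  obtain ⟨i, hi, hs⟩ := Nat.find_spec hex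
  have hmin := fun m' => Nat.find_min (m := m') hex
  set m := Nat.find hex
  have hne : ∀ k l, i ≤ k → k < l → l ≤ i + m + 1 → l - k ≠ m + 1 → G.strip (e k) ≠ G.strip (e l) := by
    intro k l h1 h2 h3 h4 h5
    exact hmin (l - k - 1) (by omega) ⟨k, by omega, by rwa [show k + (l - k - 1) + 1 = l by omega]⟩
  have hcross : ∀ k, i < k → k < i + m + 1 → ∃ f, G.Inner f ∧ G.strip f = G.strip (e k) ∧
      G.strip (G.next f) = G.strip (e i) := fun k => exists_inner_of_strip_eq (v := v)
    (fun k h1 h2 => he k (by omega)) hs (fun k l h1 h2 h3 => hne k l h1 h2 (by omega) (by omega))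
  refine ⟨_, E.wedge_pathTransfer_X_ne_zero (n := n) (fun k => a (G.strip (e k))) (a (G.strip (e i)))
    i m (by omega) fun k h1 h2 => ?_, fun p hp ⟨u, hu, hup⟩ => hp ?_⟩
  · obtain ⟨f, hf, hf1, hf2⟩ := hcross k (by omega) (by omega)
    have := ha f hf
    rwa [hf1, hf2] at this
  · have := hu.wedge_pathTransfer hE hG ha (v := v) (i := i) (m := m) (fun k h1 h2 => he k (by omega)) hs
      (fun k h1 h2 => (hne i k le_rfl h1 (by omega) (by omega)).symm)
      (fun k h1 h2 => by
        obtain ⟨f, hf, hf1, -⟩ := hcross k h1 h2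
        exact hf.bordering_of_strip_eq hf1)
    have hx : (MvPolynomial.aeval (R := ℂ) p) ∘ (fun k => (MvPolynomial.X (Fin.ofNat (n + 1) k) :
        MvPolynomial (Fin (n + 1)) ℂ)) = u ∘ v := by
      ext k
      simp only [Function.comp, MvPolynomial.aeval_X, v, hup]
    rw [← MvPolynomial.coe_aeval_eq_eval]
    change MvPolynomial.aeval (R := ℂ) p _ = 0
    rw [map_wedge, QuadEquation.comp_vec, MvPolynomial.aeval_X, ← hup, ← this]
    congr 1
    rw [← hx, ← QuadEquation.map_pathTransfer]
    have h2 := RingHom.map_mulVec (MvPolynomial.aeval (R := ℂ) p).toRingHom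
      (E.pathTransfer (fun k => a (G.strip (e k))) (a (G.strip (e i)))
        (fun k => (MvPolynomial.X (Fin.ofNat (n + 1) k) : MvPolynomial (Fin (n + 1)) ℂ)) (i + 1) m)
      (vec (MvPolynomial.X (Fin.ofNat (n + 1) i)))
    rw [show vec (u (v i)) = (MvPolynomial.aeval (R := ℂ) p) ∘
        vec (MvPolynomial.X (Fin.ofNat (n + 1) i)) by
      rw [QuadEquation.comp_vec, MvPolynomial.aeval_X, ← hup]]
    exact funext fun k => h2 k

end PlaneQuadGraph

/-! ### Generic solutions for a part of the strips -/

section Mobius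

variable {K : Type*} [Field K] [Algebra ℂ K] {L : IntermediateField ℂ K}
  {A : Matrix (Fin 2) (Fin 2) K} {τ : K}

theorem Transcendental.mulVec_vec_ne_zero (hτ : Transcendental L τ) (hA : ∀ i j, A i j ∈ L)
    (hdet : A.det ≠ 0) : A.mulVec (vec τ) 0 ≠ 0 := by
  intro h
  simp only [Matrix.mulVec, dotProduct, Fin.sum_univ_two, vec_zero, vec_one, mul_one] at h
  by_cases h1 : A 0 1 = 0
  · rw [h1, zero_mul, add_zero] at h
    exact hdet (by rw [Matrix.det_fin_two, h, h1]; ring)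
  · refine hτ ?_
    have : τ = -A 0 0 / A 0 1 := by rw [eq_div_iff h1]; linear_combination h
    rw [this]
    exact isAlgebraic_algebraMap (⟨_, div_mem (neg_mem (hA 0 0)) (hA 0 1)⟩ : L)

/-- The image of a transcendental element under an invertible fractional linear map is
transcendental. -/
theorem Transcendental.of_mulVec_vec (hτ : Transcendental L τ) (hA : ∀ i j, A i j ∈ L)
    (hdet : A.det ≠ 0) {m τ' : K} (h : A.mulVec (vec τ) = m • vec τ') : Transcendental L τ' := by
  intro halg
  refine hτ ?_
  have h1 := congrArg A.adjugate.mulVec h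
  rw [Matrix.mulVec_mulVec, Matrix.adjugate_mul, Matrix.smul_mulVec, Matrix.one_mulVec,
    Matrix.mulVec_smul, Matrix.adjugate_fin_two] at h1
  have e0 := congrFun h1 0
  have e1 := congrFun h1 1
  simp only [Matrix.mulVec, dotProduct, Fin.sum_univ_two, Pi.smul_apply, vec_zero, vec_one, mul_one,
    smul_eq_mul, Matrix.of_apply, Matrix.cons_val', Matrix.cons_val_zero, Matrix.cons_val_one,
    Matrix.cons_val_fin_one] at e0 e1
  have hne : A 1 1 + -A 0 1 * τ' ≠ 0 := by
    intro h0
    rw [h0, mul_zero] at e0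
    exact hdet e0
  have hm : m ≠ 0 := by
    rintro rfl
    rw [zero_mul] at e0
    exact hdet e0
  have : τ = (-A 1 0 + A 0 0 * τ') / (A 1 1 + -A 0 1 * τ') := by
    rw [eq_div_iff hne]
    apply mul_left_cancel₀ hm
    linear_combination e1 - τ * e0
  have hL : ∀ i j, IsAlgebraic L (A i j) := fun i j =>
    isAlgebraic_algebraMap (⟨_, hA i j⟩ : L)
  rw [this, div_eq_mul_inv]
  exact ((hL _ _).neg.add ((hL _ _).mul halg)).mul ((hL _ _).add ((hL _ _).neg.mul halg)).inv

theorem AlgebraicIndependent.pair_swap {a b : K} (h : AlgebraicIndependent ℂ ![a, b]) :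
    AlgebraicIndependent ℂ ![b, a] := by
  have := h.comp ![1, 0] (by intro i j; fin_cases i <;> fin_cases j <;> simp)
  convert this using 1
  ext i
  fin_cases i <;> rfl

theorem QuadEquation.form_ne_zero_of_det (E : QuadEquation) {α β : ℂ} {x y : Fin 2 → K} {c d : K}
    (hdet : (E.transfer α β x y).det ≠ 0) (h : E.form α β x y (vec c) (vec d) = 0) :
    E.form α β x y (vec c) ![0, 1] ≠ 0 := by
  intro h0
  rw [E.det_transfer_vec α β x y c d, h, h0, zero_mul, zero_mul, sub_zero] at hdet
  exact hdet rfl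

theorem QuadEquation.transfer_apply_mem (E : QuadEquation) {α β : ℂ} {b c : K} (hb : b ∈ L)
    (hc : c ∈ L) (i j : Fin 2) : E.transfer α β (vec b) (vec c) i j ∈ L := by
  have hv : ∀ {t : K}, t ∈ L → ∀ i, vec t i ∈ L := by
    intro t ht i
    fin_cases i
    exacts [one_mem _, ht]
  have key : ∀ k l, E.edgeForm α β (vec b) (vec c) k l ∈ L := fun k l =>
    sum_mem fun i _ => sum_mem fun j _ =>
      mul_mem (L.algebraMap_mem _) (mul_mem (hv hb i) (hv hc j))
  fin_cases i <;> fin_cases j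
  exacts [key 0 1, key 1 1, neg_mem (key 0 0), neg_mem (key 1 0)]

end Mobius

namespace PlaneQuadGraph

variable {V D : Type*} (G : PlaneQuadGraph V D) {K : Type*} [Field K] [Algebra ℂ K]

/-- A function with values in the field `L` that solves the equation on the quadrilaterals where two
strips of the set `A` cross and is constant along the other strips, in general position. -/
structure IsGenericSolution (E : QuadEquation) (a : G.Strip → ℂ) (A : Set G.Strip)
    (L : IntermediateField ℂ K) (u : V → K) : Prop where
  const : ∀ d, G.strip d ∉ A → u (G.tgt d) = u (G.src d)
  form_eq : ∀ d, G.Inner d → G.strip d ∈ A → G.strip (G.next d) ∈ A →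
    E.form (a (G.strip d)) (a (G.strip (G.next d))) (vec (u (G.src d))) (vec (u (G.tgt d)))
      (vec (u (G.src (G.next (G.next (G.next d)))))) (vec (u (G.tgt (G.next d)))) = 0
  independent : ∀ d, G.strip d ∈ A → AlgebraicIndependent ℂ ![u (G.src d), u (G.tgt d)]
  transcendental : ∀ x, Transcendental ℂ (u x)
  mem : ∀ x, u x ∈ L

variable {G} {E : QuadEquation} {a : G.Strip → ℂ} {A : Set G.Strip} {L : IntermediateField ℂ K}
  {u : V → K}

namespace IsGenericSolution

theorem det_transfer_ne_zero (hu : G.IsGenericSolution E a A L u) {d : D} (hd : G.strip d ∈ A) {γ : ℂ}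
    (h : E.Nondegenerate (a (G.strip d)) γ) :
    (E.transfer (a (G.strip d)) γ (vec (u (G.src d))) (vec (u (G.tgt d)))).det ≠ 0 :=
  E.det_transfer_X_ne_zero h (hu.independent d hd).aeval_pair_ne_zero

theorem isPartialSolution (ha : G.Admissible E a) (hu : G.IsGenericSolution E a A L u) :
    G.IsPartialSolution E a (fun d => G.strip d ∈ A ∧ G.Bordering d) u where
  rev_iff d := by rw [G.strip_rev, G.bordering_rev]
  next_next_iff d hd := by
    rw [G.strip_next_next hd]
    exact and_congr_right fun _ =>
      iff_of_true (G.inner_next (G.inner_next hd)).bordering hd.bordering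
  const d hd h := hu.const d fun hA => h ⟨hA, hd.bordering⟩
  form_eq d hd h h' := hu.form_eq d hd h.1 h'.1
  form_ne d hd h h' := E.form_ne_zero_of_det (hu.det_transfer_ne_zero h.1 (ha d hd))
    (hu.form_eq d hd h.1 h'.1)

open Filter Topology in
theorem eventually_exists_isTransport [Finite V] [Finite D] (hE : E.Consistent3D)
    (ha : G.Admissible E a) (hu : G.IsGenericSolution E a A L u) (b : ℂ) :
    ∀ᶠ γ in 𝓝[≠] b, ∃ T,
      G.IsTransport (G.backlund E a (fun d => G.strip d ∈ A ∧ G.Bordering d) u γ) T := by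
  have h : ∀ d, ∀ᶠ γ in 𝓝[≠] b, G.Bordering d → E.Nondegenerate (a (G.strip d)) γ := by
    intro d
    by_cases hd : G.Inner d
    · exact (E.eventually_nondegenerate (ha d hd) b).mono fun γ h _ => h
    by_cases hd' : G.Inner (G.rev d)
    · have := E.eventually_nondegenerate (ha _ hd') b
      rw [G.strip_rev] at this
      exact this.mono fun γ h _ => h
    · exact .of_forall fun γ h => absurd h (not_or.2 ⟨hd, hd'⟩)
  filter_upwards [eventually_all.2 h] with γ hγ
  exact (hu.isPartialSolution ha).exists_isTransport hE ha (fun d hd => hγ d hd.2)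
    (fun d hd => hu.det_transfer_ne_zero hd.1 (hγ d hd.2))

end IsGenericSolution

/-- The vertices on one side of a strip are connected on this side: where a path crosses the strip and
returns, it is replaced by a path along the strip. -/
theorem reachable_side [Finite V] [Finite D] (hG : G.NoSelfIntersection) (e : D) {z : V}
    (hz : G.side (G.strip e) z = G.side (G.strip e) (G.tgt e)) :
    Relation.ReflTransGen (fun x y => ∃ d, G.src d = x ∧ G.tgt d = y ∧ G.strip d ≠ G.strip e)
      (G.tgt e) z := by
  set r : V → V → Prop := fun x y => ∃ d, G.src d = x ∧ G.tgt d = y ∧ G.strip d ≠ G.strip e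
  have hr : Std.Symm r := ⟨fun x y ⟨d, h1, h2, h3⟩ =>
    ⟨G.rev d, h2 ▸ rfl, by rw [G.tgt_rev, h1], by rwa [G.strip_rev]⟩⟩
  have hrail : ∀ {d d'}, G.Coherent d d' → G.strip d = G.strip e →
      Relation.ReflTransGen r (G.tgt d) (G.tgt d') := by
    intro d d' h
    induction h with
    | rel d d' h =>
      obtain ⟨hd, rfl⟩ := h
      refine fun hs => .single ⟨G.next d, G.src_next d, ?_, ?_⟩
      · rw [G.tgt_rev, G.src_next]
      · rw [← hs]; exact (hG d hd).symm
    | refl => exact fun _ => .refl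
    | symm d d' h ih => exact fun hs => symm (ih ((Coherent.strip_eq G h).trans hs))
    | trans d d' d'' h h' ih ih' =>
      exact fun hs => (ih hs).trans (ih' ((Coherent.strip_eq G h).symm.trans hs))
  revert hz
  induction G.reflTransGen_to (G.tgt e) z with
  | refl => exact fun _ => .refl
  | tail _ hd ih =>
    obtain ⟨d, rfl, rfl⟩ := hd
    intro hz
    by_cases hs : G.strip d = G.strip e
    · refine hrail (coherent_of_side hG hs.symm (G.side_eq_of_ne_of_ne (z := G.tgt e) ?_ ?_)) rfl
      · exact (G.side_tgt_ne rfl).symm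
      · rw [← hz]; exact (G.side_tgt_ne hs).symm
    · exact (ih (by rw [← hz, G.side_tgt_of_ne hs])).tail ⟨d, rfl, rfl, hs⟩

namespace IsGenericSolution

section Extend

variable [Finite V] [Finite D] (hE : E.Consistent3D) (hG : G.NoSelfIntersection)
  (ha : G.Admissible E a) (hu : G.IsGenericSolution E a A L u) {e : D} (he : G.strip e ∉ A)
  (hA : ∀ t ∈ A, ∃ d, G.strip d = t ∧
    G.side (G.strip e) (G.src d) = G.side (G.strip e) (G.src e))

include ha he hA in
/-- The strips in use on the far side of a new strip cross it. -/
theorem nondegenerate_of_side {d : D} (hd : G.strip d ∈ A)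
    (hs : G.side (G.strip e) (G.src d) ≠ G.side (G.strip e) (G.src e)) :
    G.Bordering d ∧ E.Nondegenerate (a (G.strip d)) (a (G.strip e)) := by
  obtain ⟨d', h1, h2⟩ := hA _ hd
  obtain ⟨f, hf, hf1, hf2⟩ := G.exists_crossing (s := G.strip e) h1.symm (fun h => he (h ▸ hd))
    (by rw [h2]; exact hs)
  refine ⟨hf.bordering_of_strip_eq hf1, ?_⟩
  have := ha f hf
  rwa [hf1, hf2] at this

include hE hG ha hu he hA in
open Filter Topology in
/-- The values on the far side of a new strip are obtained from one of them by the Bäcklund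
transformation with the parameter of this strip. -/
theorem exists_far_side {τ : K} (hτ : Transcendental L τ) {L' : IntermediateField ℂ K} (hL : L ≤ L')
    (hτL : τ ∈ L') : ∃ w : V → K, w (G.tgt e) = τ ∧
      ∀ x, G.side (G.strip e) x = G.side (G.strip e) (G.tgt e) →
        Transcendental L (w x) ∧ w x ∈ L' ∧
        ∀ d, G.src d = x → G.strip d ≠ G.strip e → ∃ m : K, m ≠ 0 ∧
          (G.backlund E a (fun d => G.strip d ∈ A ∧ G.Bordering d) u (a (G.strip e)) d).mulVec
            (vec (w x)) = m • vec (w (G.tgt d)) := by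
  set act := fun d => G.strip d ∈ A ∧ G.Bordering d
  set M := G.backlund E a act u with hM
  set b := a (G.strip e) with hb
  have hMc : ∀ d i j, ContinuousCombination fun γ => M γ d i j := continuousCombination_backlund
  have hside : ∀ {x}, G.side (G.strip e) x = G.side (G.strip e) (G.tgt e) →
      G.side (G.strip e) x ≠ G.side (G.strip e) (G.src e) := fun h => by
    rw [h]; exact G.side_tgt_ne rfl
  have hMd : ∀ d, G.side (G.strip e) (G.src d) = G.side (G.strip e) (G.tgt e) →
      G.strip d ≠ G.strip e → (M b d).det ≠ 0 ∧ ∀ i j, M b d i j ∈ L := by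
    intro d hd hs
    by_cases h : act d
    · rw [hM, backlund_of_act h]
      exact ⟨hu.det_transfer_ne_zero h.1 (nondegenerate_of_side ha he hA h.1 (hside hd)).2,
        E.transfer_apply_mem (hu.mem _) (hu.mem _)⟩
    · rw [hM, backlund_of_not h, Matrix.det_one]
      refine ⟨one_ne_zero, fun i j => ?_⟩
      rw [Matrix.one_apply]
      split_ifs
      exacts [one_mem _, zero_mem _]
  have hW : ∀ x, ∃ W : ℂ → Matrix (Fin 2) (Fin 2) K,
      G.side (G.strip e) x = G.side (G.strip e) (G.tgt e) →
        G.IsParallel M (G.tgt e) x W ∧ (W b).det ≠ 0 ∧ ∀ i j, W b i j ∈ L := by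
    intro x
    by_cases hx : G.side (G.strip e) x = G.side (G.strip e) (G.tgt e)
    · have hwalk := reachable_side hG e hx
      suffices h : ∃ W : ℂ → Matrix (Fin 2) (Fin 2) K, G.IsParallel M (G.tgt e) x W ∧
          (W b).det ≠ 0 ∧ ∀ i j, W b i j ∈ L from ⟨h.choose, fun _ => h.choose_spec⟩
      induction hwalk with
      | refl =>
        refine ⟨_, .refl _, by simp, fun i j => ?_⟩
        rw [Matrix.one_apply]
        split_ifs
        exacts [one_mem _, zero_mem _]
      | tail _ hd ih =>
        obtain ⟨d, rfl, rfl, hd⟩ := hd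
        have hsrc := hx
        rw [G.side_tgt_of_ne hd] at hsrc
        obtain ⟨W, h1, h2, h3⟩ := ih hsrc
        obtain ⟨h4, h5⟩ := hMd d hsrc hd
        refine ⟨_, h1.trans (.of_dart hMc d), ?_, fun i j => ?_⟩
        · rw [Matrix.det_mul]; exact mul_ne_zero h4 h2
        · rw [Matrix.mul_apply]
          exact sum_mem fun k _ => mul_mem (h5 i k) (h3 k j)
    · exact ⟨fun _ => 1, fun h => absurd h hx⟩
  choose W hW using hW
  have hev := hu.eventually_exists_isTransport hE ha b
  set w : V → K := fun x => (W x b).mulVec (vec τ) 1 / (W x b).mulVec (vec τ) 0 with hw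
  have hwx : ∀ x, G.side (G.strip e) x = G.side (G.strip e) (G.tgt e) →
      (W x b).mulVec (vec τ) 0 ≠ 0 ∧
        (W x b).mulVec (vec τ) = (W x b).mulVec (vec τ) 0 • vec (w x) := by
    intro x hx
    have h0 := hτ.mulVec_vec_ne_zero (hW x hx).2.2 (hW x hx).2.1
    refine ⟨h0, ?_⟩
    ext i
    fin_cases i
    · simp
    · simp only [Fin.mk_one, Pi.smul_apply, vec_one, smul_eq_mul, hw]
      rw [mul_div_cancel₀ _ h0]
  refine ⟨w, ?_, fun x hx => ⟨?_, ?_, ?_⟩⟩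
  · obtain ⟨h1, h2, h3⟩ := hW _ rfl
    obtain ⟨c, hc, h4⟩ := ProjEq.of_frequently (a := b) (IsParallel.refl (G := G) (M := M) (G.tgt e)).continuousCombination
      h1.continuousCombination (hev.mono fun γ ⟨T, hT⟩ => (IsParallel.refl _).projEq h1 hT).frequently
      (by simp) h2
    simp only [hw, h4, Matrix.smul_mulVec, Matrix.one_mulVec, Pi.smul_apply, vec_zero, vec_one,
      smul_eq_mul, mul_one]
    rw [mul_div_cancel_left₀ _ hc]
  · exact hτ.of_mulVec_vec (hW x hx).2.2 (hW x hx).2.1 (hwx x hx).2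
  · have hm : ∀ i, (W x b).mulVec (vec τ) i ∈ L' := fun i => by
      simp only [Matrix.mulVec, dotProduct, Fin.sum_univ_two, vec_zero, vec_one, mul_one]
      exact add_mem (hL ((hW x hx).2.2 _ _)) (mul_mem (hL ((hW x hx).2.2 _ _)) hτL)
    exact div_mem (hm 1) (hm 0)
  · rintro d rfl hd
    have hx' := hx
    rw [← G.side_tgt_of_ne hd] at hx'
    obtain ⟨h1, h2, h3⟩ := hW _ hx
    obtain ⟨h1', h2', h3'⟩ := hW _ hx'
    have hp := h1.trans (.of_dart hMc d)
    obtain ⟨c, hc, h4⟩ := ProjEq.of_frequently (a := b) hp.continuousCombination h1'.continuousCombination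
      (hev.mono fun γ ⟨T, hT⟩ => hp.projEq h1' hT).frequently
      (by rw [Matrix.det_mul]; exact mul_ne_zero (hMd d hx hd).1 h2) h2'
    obtain ⟨e0, e1⟩ := hwx _ hx
    obtain ⟨e0', e1'⟩ := hwx _ hx'
    generalize (W (G.tgt d) b).mulVec (vec τ) 0 = k at e0' e1'
    rw [h4, Matrix.smul_mulVec, ← Matrix.mulVec_mulVec, e1, Matrix.mulVec_smul, smul_smul] at e1'
    have hne := mul_ne_zero hc e0
    refine ⟨(c * (W (G.src d) b).mulVec (vec τ) 0)⁻¹ * k,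
      mul_ne_zero (inv_ne_zero hne) e0', ?_⟩
    rw [mul_smul, ← e1', smul_smul, inv_mul_cancel₀ hne, one_smul]

end Extend

end IsGenericSolution

end PlaneQuadGraph

namespace PlaneQuadGraph

variable {V D : Type*} {G : PlaneQuadGraph V D} {K : Type*} [Field K] [Algebra ℂ K]
  {E : QuadEquation} {a : G.Strip → ℂ} {A : Set G.Strip} {L : IntermediateField ℂ K} {u : V → K}

namespace IsGenericSolution

/-- A generic solution for some strips extends to a new strip that contains the dart `e`, with a given
transcendental value at the end of `e` and no change on the side of its beginning. -/
theorem exists_insert [Finite V] [Finite D] (hE : E.Consistent3D) (hG : G.NoSelfIntersection)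
    (ha : G.Admissible E a) (hu : G.IsGenericSolution E a A L u) {e : D} (he : G.strip e ∉ A)
    (hA : ∀ t ∈ A, ∃ d, G.strip d = t ∧
      G.side (G.strip e) (G.src d) = G.side (G.strip e) (G.src e))
    {τ : K} (hτ : Transcendental L τ) {L' : IntermediateField ℂ K} (hL : L ≤ L') (hτL : τ ∈ L') :
    ∃ u' : V → K, G.IsGenericSolution E a (insert (G.strip e) A) L' u' ∧ u' (G.tgt e) = τ ∧
      ∀ x, G.side (G.strip e) x = G.side (G.strip e) (G.src e) → u' x = u x := by
  classical
  obtain ⟨w, hwe, hw⟩ := hu.exists_far_side hE hG ha he hA hτ hL hτL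
  set s := G.strip e with hs
  set u' : V → K := fun x => if G.side s x = G.side s (G.src e) then u x else w x with hu'
  have near : ∀ {x}, G.side s x = G.side s (G.src e) → u' x = u x := fun h => if_pos h
  have far : ∀ {x}, G.side s x ≠ G.side s (G.src e) → u' x = w x := fun h => if_neg h
  have hw' : ∀ {x}, G.side s x ≠ G.side s (G.src e) → G.side s x = G.side s (G.tgt e) := fun h =>
    G.side_eq_of_ne_of_ne h (G.side_tgt_ne hs.symm)
  have cross : ∀ {d}, G.strip d = s → (G.side s (G.src d) = G.side s (G.src e) ∧
      G.side s (G.tgt d) ≠ G.side s (G.src e)) ∨ (G.side s (G.src d) ≠ G.side s (G.src e) ∧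
      G.side s (G.tgt d) = G.side s (G.src e)) := by
    intro d hd
    by_cases h : G.side s (G.src d) = G.side s (G.src e)
    · exact Or.inl ⟨h, by rw [← h]; exact G.side_tgt_ne hd⟩
    · exact Or.inr ⟨h, G.side_eq_of_ne_of_ne (G.side_tgt_ne hd) (Ne.symm h)⟩
  -- a Bäcklund step along an edge of the far side
  have step : ∀ d, G.side s (G.src d) ≠ G.side s (G.src e) → G.strip d ≠ s → G.strip d ∈ A →
      E.Nondegenerate (a (G.strip d)) (a s) ∧ ∃ m : K, m ≠ 0 ∧
        (E.transfer (a (G.strip d)) (a s) (vec (u (G.src d))) (vec (u (G.tgt d)))).mulVec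
          (vec (w (G.src d))) = m • vec (w (G.tgt d)) := by
    intro d h1 h2 h3
    obtain ⟨h4, h5⟩ := nondegenerate_of_side ha he hA h3 h1
    obtain ⟨m, hm, h6⟩ := (hw _ (hw' h1)).2.2 d rfl h2
    rw [backlund_of_act ⟨h3, h4⟩] at h6
    exact ⟨h5, m, hm, h6⟩
  have stepForm : ∀ d, G.side s (G.src d) ≠ G.side s (G.src e) → G.strip d ≠ s → G.strip d ∈ A →
      E.form (a (G.strip d)) (a s) (vec (u (G.src d))) (vec (u (G.tgt d))) (vec (w (G.src d)))
        (vec (w (G.tgt d))) = 0 := by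
    intro d h1 h2 h3
    obtain ⟨-, m, -, h⟩ := step d h1 h2 h3
    rw [E.form_eq_wedge, h, ← one_smul K (vec (w (G.tgt d))), smul_smul, wedge_smul_smul]
    exact mul_eq_zero_of_right _ (wedge_self _)
  have hne : ∀ {d}, G.strip d ∈ A → G.strip d ≠ s := fun h h' => he (h' ▸ h)
  -- the equation on a quadrilateral of the new strip
  have key : ∀ d, G.Inner d → G.strip d = s → G.strip (G.next d) ∈ A →
      E.form (a (G.strip d)) (a (G.strip (G.next d))) (vec (u' (G.src d))) (vec (u' (G.tgt d)))
      (vec (u' (G.src (G.next (G.next (G.next d)))))) (vec (u' (G.tgt (G.next d)))) = 0 := by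
    intro d hd hds hdA
    have hd1 := G.inner_next hd
    have hr : G.strip (G.rev (G.next (G.next (G.next d)))) = G.strip (G.next d) := by
      rw [G.strip_rev, G.strip_next_next hd1]
    have c0 := hu.const d (by rwa [hds])
    have c2 := hu.const (G.next (G.next d)) (by rwa [G.strip_next_next hd, hds])
    rw [G.src_next (G.next d), ← G.src_next (G.next (G.next d))] at c2
    have side1 := G.side_tgt_of_ne (hne hdA)
    have side3 := G.side_tgt_of_ne (hne (hr.symm ▸ hdA))
    rw [G.src_next] at side1
    rw [G.tgt_rev, G.src_rev, G.tgt_next_three hd] at side3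
    obtain ⟨ε, -, hdiag⟩ := E.exists_form_diag (R := K)
    obtain ⟨σ, -, hsd⟩ := E.exists_form_side (R := K)
    rcases cross hds with ⟨h0, h1⟩ | ⟨h0, h1⟩
    · have := stepForm (G.next d) (by rwa [G.src_next]) (hne hdA) hdA
      rw [G.src_next, c0, ← c2] at this
      rw [near h0, far h1, near (side3.trans h0), far (by rwa [side1]), hdiag, hds, this, mul_zero]
    · have := stepForm (G.rev (G.next (G.next (G.next d)))) (by rwa [G.src_rev, G.tgt_next_three hd])
        (hne (hr.symm ▸ hdA)) (hr.symm ▸ hdA)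
      rw [hr, G.src_rev, G.tgt_rev, G.tgt_next_three hd, c2, ← c0] at this
      rw [far h0, near h1, far (by rwa [side3]), near (by rwa [side1]), hsd, hdiag, hds, this,
        mul_zero, mul_zero]
  refine ⟨u', ⟨fun d hd => ?_, fun d hd h h' => ?_, fun d hd => ?_, fun x => ?_, fun x => ?_⟩, ?_,
    fun x hx => near hx⟩
  · rw [Set.mem_insert_iff, not_or] at hd
    have hside := G.side_tgt_of_ne hd.1
    by_cases h : G.side s (G.src d) = G.side s (G.src e)
    · rw [near h, near (hside.trans h), hu.const d hd.2]
    · rw [far h, far (by rwa [hside])]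
      obtain ⟨m, -, h1⟩ := (hw _ (hw' h)).2.2 d rfl hd.1
      rw [backlund_of_not (fun h => hd.2 h.1), Matrix.one_mulVec] at h1
      have e0 := congrFun h1 0
      have e1 := congrFun h1 1
      simp only [Pi.smul_apply, vec_zero, vec_one, smul_eq_mul, mul_one] at e0 e1
      rw [e1, ← e0, one_mul]
  · have hd1 := G.inner_next hd
    rcases h with h | h <;> rcases h' with h' | h'
    · exact absurd (h.trans h'.symm) (hG d hd)
    · exact key d hd h h'
    · have := key (G.next d) hd1 h' (by rwa [G.strip_next_next hd])
      obtain ⟨ρ, hρ, hrot⟩ := E.exists_form_rotate (R := K)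
      rw [G.next_four hd, G.strip_next_next hd, G.src_next, ← G.src_next (G.next (G.next d)),
        hrot] at this
      exact (mul_eq_zero.1 this).resolve_left (by simpa using hρ)
    · have hr : G.strip (G.rev (G.next (G.next (G.next d)))) = G.strip (G.next d) := by
        rw [G.strip_rev, G.strip_next_next hd1]
      have side0 := G.side_tgt_of_ne (hne h)
      have side1 := G.side_tgt_of_ne (hne h')
      have side3 := G.side_tgt_of_ne (hne (hr.symm ▸ h'))
      rw [G.src_next, side0] at side1
      rw [G.tgt_rev, G.src_rev, G.tgt_next_three hd] at side3
      by_cases h0 : G.side s (G.src d) = G.side s (G.src e)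
      · rw [near h0, near (side0.trans h0), near (side3.trans h0), near (side1.trans h0)]
        exact hu.form_eq d hd h h'
      · obtain ⟨n1, m1, hm1, e1⟩ := step d h0 (hne h) h
        obtain ⟨n2, m2, hm2, e2⟩ := step (G.next d) (by rwa [G.src_next, side0]) (hne h') h'
        obtain ⟨-, m3, hm3, e3⟩ := step (G.rev (G.next (G.next (G.next d))))
          (by rwa [G.src_rev, G.tgt_next_three hd]) (hne (hr.symm ▸ h')) (hr.symm ▸ h')
        rw [far h0, far (by rwa [side0]), far (by rwa [side3]), far (by rwa [side1])]
        rw [hr, G.src_rev, G.tgt_rev, G.tgt_next_three hd] at e3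
        rw [G.src_next] at e2
        exact E.form_transfer_eq_zero hE (ha d hd) n1 n2 (hu.form_eq d hd h h')
          (E.form_ne_zero_of_det (hu.det_transfer_ne_zero h (ha d hd)) (hu.form_eq d hd h h'))
          e1 hm1 e3 hm3 e2 hm2
  · rcases hd with hd | hd
    · have c0 := hu.const d (by rwa [hd])
      rcases cross hd with ⟨h0, h1⟩ | ⟨h0, h1⟩
      · rw [near h0, far h1]
        exact algebraicIndependent_pair_of_transcendental (hu.mem _) (hu.transcendental _)
          (hw _ (hw' h1)).1
      · rw [far h0, near h1]
        exact (algebraicIndependent_pair_of_transcendental (hu.mem _) (hu.transcendental _)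
          (hw _ (hw' h0)).1).pair_swap
    · have hside := G.side_tgt_of_ne (hne hd)
      by_cases h : G.side s (G.src d) = G.side s (G.src e)
      · rw [near h, near (hside.trans h)]
        exact hu.independent d hd
      · rw [far h, far (by rwa [hside])]
        exact E.algebraicIndependent_transfer (step d h (hne hd) hd).1 (hu.independent d hd) (hu.mem _)
          (hu.mem _) (hw _ (hw' h)).1 (stepForm d h (hne hd) hd)
  · by_cases h : G.side s x = G.side s (G.src e)
    · rw [near h]; exact hu.transcendental x
    · rw [far h]; exact (hw _ (hw' h)).1.of_intermediateField
  · by_cases h : G.side s x = G.side s (G.src e)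
    · rw [near h]; exact hL (hu.mem x)
    · rw [far h]; exact (hw _ (hw' h)).2.1
  · rw [far (G.side_tgt_ne hs.symm), hwe]

end IsGenericSolution

end PlaneQuadGraph

/-! ### Existence of generic solutions -/

section

variable {K : Type*} [Field K] [Algebra ℂ K]

open scoped IntermediateField.algebraAdjoinAdjoin in
theorem AlgebraicIndependent.transcendental_adjoin_Iic {X : ℕ → K} (hX : AlgebraicIndependent ℂ X)
    (m : ℕ) : Transcendental (IntermediateField.adjoin ℂ (X '' Set.Iic m)) (X (m + 1)) := by
  have h := hX.transcendental_adjoin (s := Set.Iic m) (i := m + 1) (by simp)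
  rwa [Transcendental, IsFractionRing.isAlgebraic_iff (Algebra.adjoin ℂ (X '' Set.Iic m))
    (IntermediateField.adjoin ℂ (X '' Set.Iic m)) K] at h

end

namespace PlaneQuadGraph

variable {V D : Type*} (G : PlaneQuadGraph V D) {K : Type*} [Field K] [Algebra ℂ K]

/-- A vertex can be reached from another one along edges of the strips in `A` only. -/
def Reachable (A : Set G.Strip) : V → V → Prop :=
  Relation.ReflTransGen fun z w => ∃ d, G.src d = z ∧ G.tgt d = w ∧ G.strip d ∈ A

/-- A generic solution for the strips in `A` with prescribed values `X 0, …, X m` at the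
vertices `y 0, …, y m` of a tree whose edges belong to different strips, all those in `A`. -/
structure IsStage (E : QuadEquation) (a : G.Strip → ℂ) (X : ℕ → K) (y : ℕ → V) (m : ℕ)
    (A : Set G.Strip) (u : V → K) : Prop where
  generic : G.IsGenericSolution E a A (IntermediateField.adjoin ℂ (X '' Set.Iic m)) u
  eq : ∀ i ≤ m, u (y i) = X i
  reachable : ∀ i ≤ m, G.Reachable A (y 0) (y i)
  strips : ∀ t ∈ A, ∃ d, G.strip d = t ∧ G.Reachable A (y 0) (G.src d)

variable {G} {E : QuadEquation} {a : G.Strip → ℂ} {X : ℕ → K}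

theorem Reachable.mono {A B : Set G.Strip} (h : A ⊆ B) {x y : V} (hxy : G.Reachable A x y) :
    G.Reachable B x y :=
  Relation.ReflTransGen.mono (fun _ _ ⟨d, h1, h2, h3⟩ => ⟨d, h1, h2, h h3⟩) _ _ hxy

theorem Reachable.side_eq [Finite V] [Finite D] {A : Set G.Strip} {x y : V} (h : G.Reachable A x y)
    {s : G.Strip} (hs : s ∉ A) : G.side s y = G.side s x := by
  induction h with
  | refl => rfl
  | tail _ hd ih =>
    obtain ⟨d, rfl, rfl, hd⟩ := hd
    rw [G.side_tgt_of_ne (ne_of_mem_of_not_mem hd hs), ih]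

/-- If some strip is not in `A`, the edges of such strips can be reached along strips in `A`. -/
theorem exists_reachable_src {A : Set G.Strip} {s : G.Strip} (hs : s ∉ A) (x : V) :
    ∃ d, G.strip d ∉ A ∧ G.Reachable A x (G.src d) := by
  by_contra! h
  have hall : ∀ z, G.Reachable A x z := by
    intro z
    induction G.reflTransGen_to x z with
    | refl => exact .refl
    | tail _ hd ih =>
      obtain ⟨d, rfl, rfl⟩ := hd
      refine ih.tail ⟨d, rfl, rfl, ?_⟩
      by_contra hd
      exact h d hd ih
  obtain ⟨d, rfl⟩ := Quotient.exists_rep s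
  exact h d hs (hall _)

namespace IsStage

theorem zero (hX : AlgebraicIndependent ℂ X) (y : ℕ → V) :
    G.IsStage E a X y 0 ∅ fun _ => X 0 where
  generic :=
    { const := fun _ _ => rfl
      form_eq := fun _ _ h => absurd h (Set.notMem_empty _)
      independent := fun _ h => absurd h (Set.notMem_empty _)
      transcendental := fun _ => hX.transcendental 0
      mem := fun _ => IntermediateField.subset_adjoin _ _ ⟨0, Set.self_mem_Iic, rfl⟩ }
  eq i hi := by rw [Nat.le_zero.1 hi]
  reachable i hi := by rw [Nat.le_zero.1 hi]; exact .refl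
  strips _ h := absurd h (Set.notMem_empty _)

theorem congr {y y' : ℕ → V} {m : ℕ} {A : Set G.Strip} {u : V → K} (h : G.IsStage E a X y m A u)
    (hy : ∀ i ≤ m, y' i = y i) : G.IsStage E a X y' m A u where
  generic := h.generic
  eq i hi := by rw [hy i hi, h.eq i hi]
  reachable i hi := by rw [hy i hi, hy 0 (Nat.zero_le _)]; exact h.reachable i hi
  strips t ht := by rw [hy 0 (Nat.zero_le _)]; exact h.strips t ht

variable [Finite V] [Finite D] (hE : E.Consistent3D) (hG : G.NoSelfIntersection)
  (ha : G.Admissible E a) (hX : AlgebraicIndependent ℂ X)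

include hE hG ha hX

/-- The next strip to be added starts at a vertex that is reached along the strips in use, so that all
of these, as well as the vertices with prescribed values, are found on the side of the new strip where
nothing is changed. -/
theorem succ {y : ℕ → V} {m : ℕ} {A : Set G.Strip} {u : V → K} (h : G.IsStage E a X y m A u) {e : D}
    (he : G.strip e ∉ A) (hsrc : G.Reachable A (y 0) (G.src e)) (hy : y (m + 1) = G.tgt e) :
    ∃ u', G.IsStage E a X y (m + 1) (insert (G.strip e) A) u' := by
  obtain ⟨u', h1, h2, h3⟩ := h.generic.exists_insert hE hG ha he (fun t ht => by
      obtain ⟨d, hd, hd'⟩ := h.strips t ht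
      exact ⟨d, hd, by rw [hd'.side_eq he, hsrc.side_eq he]⟩)
    (hX.transcendental_adjoin_Iic m) (L' := IntermediateField.adjoin ℂ (X '' Set.Iic (m + 1)))
    (IntermediateField.adjoin.mono _ _ _ (Set.image_mono (Set.Iic_subset_Iic.2 (Nat.le_succ m))))
    (IntermediateField.subset_adjoin _ _ ⟨m + 1, Set.self_mem_Iic, rfl⟩)
  have hsub : A ⊆ insert (G.strip e) A := Set.subset_insert _ _
  have hsrc' := hsrc.mono hsub
  refine ⟨u', h1, fun i hi => ?_, fun i hi => ?_, fun t ht => ?_⟩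
  · rcases Nat.le_succ_iff.1 hi with hi | rfl
    · rw [h3 _ (by rw [(h.reachable i hi).side_eq he, hsrc.side_eq he]), h.eq i hi]
    · rw [hy, h2]
  · rcases Nat.le_succ_iff.1 hi with hi | rfl
    · exact (h.reachable i hi).mono hsub
    · rw [hy]; exact hsrc'.tail ⟨e, rfl, rfl, Set.mem_insert _ _⟩
  · rcases ht with rfl | ht
    · exact ⟨e, rfl, hsrc'⟩
    · obtain ⟨d, hd, hd'⟩ := h.strips t ht
      exact ⟨d, hd, hd'.mono hsub⟩

theorem of_path {v : ℕ → V} {e : ℕ → D} (n : ℕ)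
    (he : ∀ k < n, G.src (e k) = v k ∧ G.tgt (e k) = v (k + 1))
    (hinj : ∀ k l, k < l → l < n → G.strip (e k) ≠ G.strip (e l)) :
    ∃ u : V → K, G.IsStage E a X v n {s | ∃ k < n, G.strip (e k) = s} u := by
  induction n with
  | zero =>
    refine ⟨fun _ => X 0, ?_⟩
    convert zero hX v
    ext s
    simp
  | succ n ih =>
    obtain ⟨u, hu⟩ := ih (fun k hk => he k (by omega)) (fun k l h h' => hinj k l h (by omega))
    obtain ⟨u', hu'⟩ := hu.succ hE hG ha hX (e := e n)
      (by rintro ⟨k, hk, h⟩; exact hinj k n hk (Nat.lt_succ_self n) h)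
      (by rw [(he n (Nat.lt_succ_self n)).1]; exact hu.reachable n le_rfl)
      (he n (Nat.lt_succ_self n)).2.symm
    refine ⟨u', ?_⟩
    convert hu' using 1
    ext s
    simp only [Nat.lt_succ_iff_lt_or_eq, Set.mem_ofPred_eq, Set.mem_insert_iff]
    constructor
    · rintro ⟨k, hk | rfl, rfl⟩
      exacts [Or.inr ⟨k, hk, rfl⟩, Or.inl rfl]
    · rintro (rfl | ⟨k, hk, rfl⟩)
      exacts [⟨n, Or.inr rfl, rfl⟩, ⟨k, Or.inl hk, rfl⟩]

/-- Strips can be added until all of them are in use, each with a variable of its own. -/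
theorem complete {y : ℕ → V} {m : ℕ} {A : Set G.Strip} {u : V → K} (h : G.IsStage E a X y m A u) :
    ∃ (m' : ℕ) (y' : ℕ → V) (u' : V → K), G.IsStage E a X y' m' Set.univ u' ∧ m ≤ m' ∧
      (∀ i ≤ m, y' i = y i) ∧ (A ≠ Set.univ → m < m') := by
  have : Finite G.Strip := Quotient.finite _
  induction hk : Aᶜ.ncard using Nat.strong_induction_on generalizing y m A u with
  | _ k ih =>
    by_cases hA : A = Set.univ
    · subst hA
      exact ⟨m, y, u, h, le_rfl, fun _ _ => rfl, fun h => absurd rfl h⟩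
    · obtain ⟨s, hs⟩ := (Set.ne_univ_iff_exists_notMem A).1 hA
      obtain ⟨e, he, hsrc⟩ := exists_reachable_src hs (y 0)
      set y₁ := Function.update y (m + 1) (G.tgt e)
      have hy : ∀ i ≤ m, y₁ i = y i := fun i hi => Function.update_of_ne (by omega) _ _
      obtain ⟨u₁, hu₁⟩ := (h.congr hy).succ hE hG ha hX he (by rwa [hy 0 (Nat.zero_le _)])
        (Function.update_self _ _ _)
      have hlt : (insert (G.strip e) A)ᶜ.ncard < k := by
        rw [← hk]
        refine Set.ncard_lt_ncard ?_ (Set.toFinite _)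
        exact compl_lt_compl_iff_lt.2 (Set.ssubset_insert he)
      obtain ⟨m', y', u', h1, h2, h3, -⟩ := ih _ hlt hu₁ rfl
      exact ⟨m', y', u', h1, by omega, fun i hi => by rw [h3 i (by omega), hy i hi], fun _ => by omega⟩

end IsStage

end PlaneQuadGraph

/-! ### Specialisation of the parameters -/

section

open MvPolynomial

theorem QuadEquation.form_div (E : QuadEquation) (α β : ℂ) {K : Type*} [Field K] [Algebra ℂ K]
    {q : K} (hq : q ≠ 0) (x y z w : K) :
    E.form α β (vec (x / q)) (vec (y / q)) (vec (z / q)) (vec (w / q)) =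
      (q⁻¹) ^ 4 * E.form α β ![q, x] ![q, y] ![q, z] ![q, w] ∧
    E.form α β (vec (x / q)) (vec (y / q)) (vec (z / q)) ![0, 1] =
      (q⁻¹) ^ 3 * E.form α β ![q, x] ![q, y] ![q, z] ![0, 1] := by
  have h : ∀ x : K, vec (x / q) = q⁻¹ • ![q, x] := by
    intro x
    ext i
    fin_cases i
    · simp [hq]
    · simp [div_eq_inv_mul]
  constructor
  · rw [h, h, h, h, E.form_smul_smul_smul_smul]; ring
  · rw [h, h, h, ← one_smul K ![(0 : K), 1], E.form_smul_smul_smul_smul, one_smul]; ring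

namespace PlaneQuadGraph

variable {V D : Type*} {G : PlaneQuadGraph V D} {E : QuadEquation} {a : G.Strip → ℂ}

/-- A generic solution over a field of rational functions can be specialised to almost all values of the
variables. -/
theorem IsGenericSolution.exists_specialization [Finite V] [Finite D] (ha : G.Admissible E a)
    {L : IntermediateField ℂ (FractionRing (MvPolynomial ℕ ℂ))}
    {u : V → FractionRing (MvPolynomial ℕ ℂ)} (hu : G.IsGenericSolution E a Set.univ L u) :
    ∃ g : MvPolynomial ℕ ℂ, g ≠ 0 ∧ ∀ p : ℕ → ℂ, eval p g ≠ 0 → ∃ u' : V → ℂ, G.IsSolution E a u' ∧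
      ∀ x i, u x = algebraMap _ _ (X i : MvPolynomial ℕ ℂ) → u' x = p i := by
  classical
  set φ : MvPolynomial ℕ ℂ →ₐ[ℂ] FractionRing (MvPolynomial ℕ ℂ) := IsScalarTower.toAlgHom ℂ _ _ with hφ
  have hinj : Function.Injective φ := IsFractionRing.injective _ _
  obtain ⟨⟨q, hq⟩, hr⟩ := IsLocalization.exist_integer_multiples_of_finite
    (nonZeroDivisors (MvPolynomial ℕ ℂ)) u
  choose r hr using hr
  have hq0 : q ≠ 0 := nonZeroDivisors.ne_zero hq
  have hφq : φ q ≠ 0 := (map_ne_zero_iff φ hinj).2 hq0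
  have hur : ∀ x, u x = φ (r x) / φ q := by
    intro x
    rw [eq_div_iff hφq]
    have := hr x
    rw [Algebra.smul_def] at this
    change φ (r x) = φ q * u x at this
    rw [this, mul_comm]
  have hcomp : ∀ {S : Type} [CommRing S] [Algebra ℂ S] (ψ : MvPolynomial ℕ ℂ →ₐ[ℂ] S) (s t : MvPolynomial ℕ ℂ),
      ψ ∘ ![s, t] = ![ψ s, ψ t] := by
    intro S _ _ ψ s t
    ext i
    fin_cases i <;> rfl
  -- the two conditions on a quadrilateral, with the denominators cleared
  set F : D → (Fin 2 → MvPolynomial ℕ ℂ) → MvPolynomial ℕ ℂ := fun d w =>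
    E.form (a (G.strip d)) (a (G.strip (G.next d))) ![q, r (G.src d)] ![q, r (G.tgt d)]
      ![q, r (G.src (G.next (G.next (G.next d))))] w with hF
  have h1 : ∀ d, G.Inner d → F d ![q, r (G.tgt (G.next d))] = 0 := by
    intro d hd
    apply hinj
    rw [map_zero, hF, E.map_form, hcomp, hcomp, hcomp, hcomp]
    have := hu.form_eq d hd (Set.mem_univ _) (Set.mem_univ _)
    rw [hur, hur, hur, hur, (E.form_div _ _ hφq _ _ _ _).1] at this
    exact (mul_eq_zero.1 this).resolve_left (pow_ne_zero _ (inv_ne_zero hφq))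
  have h2 : ∀ d, G.Inner d → F d ![0, 1] ≠ 0 := by
    intro d hd h0
    have := E.form_ne_zero_of_det (hu.det_transfer_ne_zero (Set.mem_univ _) (ha d hd))
      (hu.form_eq d hd (Set.mem_univ _) (Set.mem_univ _))
    apply this
    have h0' := congrArg φ h0
    rw [map_zero, hF, E.map_form, hcomp, hcomp, hcomp, hcomp, map_zero, map_one] at h0'
    rw [hur, hur, hur, (E.form_div _ _ hφq _ _ _ (φ q)).2, h0', mul_zero]
  have := Fintype.ofFinite D
  refine ⟨q * ∏ d, if G.Inner d then F d ![0, 1] else 1, mul_ne_zero hq0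
    (Finset.prod_ne_zero_iff.2 fun d _ => ?_), fun p hp => ⟨fun x => eval p (r x) / eval p q, ?_, ?_⟩⟩
  · split_ifs with hd
    exacts [h2 d hd, one_ne_zero]
  · intro d hd
    rw [map_mul, map_prod] at hp
    have hq' : eval p q ≠ 0 := left_ne_zero_of_mul hp
    have hd' := Finset.prod_ne_zero_iff.1 (right_ne_zero_of_mul hp) d (Finset.mem_univ _)
    rw [if_pos hd] at hd'
    have e1 := congrArg (aeval (R := ℂ) p) (h1 d hd)
    rw [map_zero, hF, E.map_form, hcomp, hcomp, hcomp, hcomp] at e1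
    rw [← coe_aeval_eq_eval] at hd'
    change aeval (R := ℂ) p _ ≠ 0 at hd'
    rw [hF, E.map_form, hcomp, hcomp, hcomp, hcomp, map_zero, map_one] at hd'
    rw [E.determines_iff, G.src_next, G.src_next (G.next d)]
    simp only [← coe_aeval_eq_eval] at hq' ⊢
    change aeval (R := ℂ) p q ≠ 0 at hq'
    change E.form _ _ (vec (aeval (R := ℂ) p _ / aeval (R := ℂ) p _)) (vec (aeval (R := ℂ) p _ / aeval (R := ℂ) p _))
      (vec (aeval (R := ℂ) p _ / aeval (R := ℂ) p _)) (vec (aeval (R := ℂ) p _ / aeval (R := ℂ) p _)) = 0 ∧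
      E.form _ _ (vec (aeval (R := ℂ) p _ / aeval (R := ℂ) p _)) (vec (aeval (R := ℂ) p _ / aeval (R := ℂ) p _))
      (vec (aeval (R := ℂ) p _ / aeval (R := ℂ) p _)) ![0, 1] ≠ 0
    rw [(E.form_div _ _ hq' _ _ _ _).1, (E.form_div _ _ hq' _ _ _ (aeval (R := ℂ) p q)).2, e1, mul_zero]
    exact ⟨rfl, mul_ne_zero (pow_ne_zero _ (inv_ne_zero hq')) hd'⟩
  · intro x i hx
    rw [map_mul] at hp
    have hq' : eval p q ≠ 0 := left_ne_zero_of_mul hp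
    rw [hur, div_eq_iff hφq] at hx
    change φ (r x) = φ (X i) * φ q at hx
    rw [← map_mul] at hx
    change eval p (r x) / eval p q = p i
    rw [hinj hx, map_mul, eval_X, mul_div_cancel_right₀ _ hq']

end PlaneQuadGraph

/-- A condition on infinitely many variables holds, with suitable fixed values of the other ones,
for generic values of the first ones. -/
theorem MvPolynomial.exists_ne_zero_of_extend {g : MvPolynomial ℕ ℂ} {p₀ : ℕ → ℂ} (h : eval p₀ g ≠ 0)
    (n : ℕ) : ∃ g' : MvPolynomial (Fin n) ℂ, g' ≠ 0 ∧ ∀ p : Fin n → ℂ, eval p g' ≠ 0 →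
      eval (fun i => if hi : i < n then p ⟨i, hi⟩ else p₀ i) g ≠ 0 := by
  set ψ := aeval (R := ℂ) (fun i => if hi : i < n then (X ⟨i, hi⟩ : MvPolynomial (Fin n) ℂ)
    else C (p₀ i)) with hψ
  have key : ∀ p : Fin n → ℂ, eval p (ψ g) =
      eval (fun i => if hi : i < n then p ⟨i, hi⟩ else p₀ i) g := by
    intro p
    rw [← coe_aeval_eq_eval, ← coe_aeval_eq_eval]
    change ((aeval (R := ℂ) p).comp ψ) g = aeval (R := ℂ) _ g
    refine congrArg (fun φ : _ →ₐ[ℂ] _ => φ g) (algHom_ext fun i => ?_)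
    rw [AlgHom.comp_apply, hψ, aeval_X, aeval_X]
    split_ifs
    · rw [aeval_X]
    · rw [← algebraMap_eq, AlgHom.commutes]; rfl
  refine ⟨ψ g, fun h0 => h ?_, fun p hp => by rwa [← key]⟩
  have := key fun i => p₀ i
  rw [h0, map_zero] at this
  rw [this]
  congr 1
  congr 1
  ext i
  split_ifs <;> rfl

theorem MvPolynomial.exists_eval_ne_zero {g : MvPolynomial ℕ ℂ} (hg : g ≠ 0) : ∃ p, eval p g ≠ 0 := by
  by_contra! h
  exact hg (MvPolynomial.funext fun p => by rw [h p, map_zero])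

namespace PlaneQuadGraph

variable {V D : Type*} {G : PlaneQuadGraph V D} {E : QuadEquation} {a : G.Strip → ℂ}

/-- If the edges of a path belong to different strips, the Cauchy problem is solvable for generic
data; if the path does not meet all the strips, the value at another vertex may be prescribed
as well. -/
theorem SimplePath.exists_solution [Finite V] [Finite D] (hE : E.Consistent3D)
    (hG : G.NoSelfIntersection) (ha : G.Admissible E a) {n : ℕ} (P : G.SimplePath n)
    (hP : Function.Injective fun i => G.strip (P.edge i)) :
    ∃ (z : V) (g : MvPolynomial ℕ ℂ), g ≠ 0 ∧ ∀ p : ℕ → ℂ, eval p g ≠ 0 →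
      ∃ u : V → ℂ, G.SolvesCauchy E a P (fun i => p i) u ∧
        ((∃ s, ∀ i, G.strip (P.edge i) ≠ s) → u z = p (n + 1)) := by
  let v : ℕ → V := fun k => P.vert (Fin.ofNat (n + 1) k)
  let e : ℕ → D := fun k => if h : k < n then P.edge ⟨k, h⟩ else G.outer
  have he : ∀ k, k < n → G.src (e k) = v k ∧ G.tgt (e k) = v (k + 1) := by
    intro k hk
    simp only [e, v, dif_pos hk, P.src_edge, P.tgt_edge]
    constructor
    · congr 1; ext; simp [Fin.ofNat, Nat.mod_eq_of_lt (show k < n + 1 by omega)]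
    · congr 1; ext; simp [Fin.ofNat, Nat.mod_eq_of_lt (show k + 1 < n + 1 by omega)]
  have hX : AlgebraicIndependent ℂ (fun i =>
      algebraMap _ (FractionRing (MvPolynomial ℕ ℂ)) (X i : MvPolynomial ℕ ℂ)) :=
    (algebraicIndependent_X ℕ ℂ).map' (f := IsScalarTower.toAlgHom ℂ (MvPolynomial ℕ ℂ)
      (FractionRing (MvPolynomial ℕ ℂ))) (IsFractionRing.injective _ _)
  obtain ⟨u₀, hu₀⟩ := IsStage.of_path hE hG ha hX n he (by
    intro k l hkl hl h
    simp only [e, dif_pos hl, dif_pos (hkl.trans hl)] at h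
    have := congrArg Fin.val (hP h)
    simp only at this
    omega)
  obtain ⟨m, y, u, hu, hnm, hy, hlt⟩ := hu₀.complete hE hG ha hX
  obtain ⟨g, hg, hgp⟩ := hu.generic.exists_specialization ha
  refine ⟨y (n + 1), g, hg, fun p hp => ?_⟩
  obtain ⟨u', h1, h2⟩ := hgp p hp
  refine ⟨u', ⟨h1, fun i => h2 _ _ ?_⟩, fun ⟨s, hs⟩ => h2 _ _ (hu.eq _ (hlt fun hA => ?_))⟩
  · rw [← hu.eq i (by omega), hy i (by omega)]
    congr 2
    ext
    simp [Fin.ofNat, Nat.mod_eq_of_lt i.2]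
  · have : s ∈ {s | ∃ k < n, G.strip (e k) = s} := hA ▸ Set.mem_univ s
    obtain ⟨k, hk, rfl⟩ := this
    refine hs ⟨k, hk⟩ ?_
    simp only [e, dif_pos hk]

end PlaneQuadGraph

end

theorem theorem2 {V D : Type*} [Finite V] [Finite D] (E : QuadEquation) (hE : E.Consistent3D)
    (G : PlaneQuadGraph V D) (hG : G.NoSelfIntersection)
    (a : G.Strip → ℂ) (ha : G.Admissible E a) {n : ℕ} (P : G.SimplePath n) :
    ((∀ s : G.Strip, ∃! i : Fin n, G.strip (P.edge i) = s) →
      HoldsGenerically fun p => ∃! u : V → ℂ, G.SolvesCauchy E a P p u) ∧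
    ((∃ s : G.Strip, ∃ i j : Fin n,
        i ≠ j ∧ G.strip (P.edge i) = s ∧ G.strip (P.edge j) = s) →
      HoldsGenerically fun p => ¬ ∃ u : V → ℂ, G.SolvesCauchy E a P p u) ∧
    ((∃ s : G.Strip, ∀ i : Fin n, G.strip (P.edge i) ≠ s) →
      HoldsGenerically fun p => ∀ u : V → ℂ, G.SolvesCauchy E a P p u →
        ∃ u' : V → ℂ, u' ≠ u ∧ G.SolvesCauchy E a P p u') := by
  have hext : ∀ (p : Fin (n + 1) → ℂ) (p₀ : ℕ → ℂ),
      (fun i : Fin (n + 1) => (fun k : ℕ => if hk : k < n + 1 then p ⟨k, hk⟩ else p₀ k) i) = p := by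
    intro p p₀
    ext i
    simp only [i.2, dif_pos]
  refine ⟨fun h => ?_, fun ⟨s, i, j, hij, hi, hj⟩ => ?_, fun h => ?_⟩
  · have hP : Function.Injective fun i => G.strip (P.edge i) := fun i j hij =>
      (h (G.strip (P.edge j))).unique hij rfl
    obtain ⟨z, g, hg, hgp⟩ := P.exists_solution hE hG ha hP
    obtain ⟨p₀, hp₀⟩ := MvPolynomial.exists_eval_ne_zero hg
    obtain ⟨g', hg', hgp'⟩ := MvPolynomial.exists_ne_zero_of_extend hp₀ (n + 1)
    refine ⟨g', hg', fun p hp => ?_⟩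
    obtain ⟨u, hu, -⟩ := hgp _ (hgp' p hp)
    rw [hext] at hu
    exact ⟨u, hu, fun u' hu' => hu'.unique hE hG ha (fun s => (h s).exists) hu⟩
  · exact P.not_solvesCauchy hE hG ha fun hP => hij (hP (hi.trans hj.symm))
  · by_cases hP : Function.Injective fun i => G.strip (P.edge i)
    · obtain ⟨z, g, hg, hgp⟩ := P.exists_solution hE hG ha hP
      -- two choices of the other variables which differ in the value of the solution at `z`
      obtain ⟨p₀, hp₀⟩ := MvPolynomial.exists_eval_ne_zero hg
      have hne : (MvPolynomial.X (n + 1) - MvPolynomial.C (p₀ (n + 1)) : MvPolynomial ℕ ℂ) ≠ 0 := by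
        intro h0
        have := congrArg (MvPolynomial.eval fun _ => p₀ (n + 1) + 1) h0
        simp at this
      obtain ⟨p₁, hp₁⟩ := MvPolynomial.exists_eval_ne_zero (mul_ne_zero hg hne)
      rw [map_mul, map_sub, MvPolynomial.eval_X, MvPolynomial.eval_C] at hp₁
      obtain ⟨g₀, hg₀, hgp₀⟩ := MvPolynomial.exists_ne_zero_of_extend hp₀ (n + 1)
      obtain ⟨g₁, hg₁, hgp₁⟩ := MvPolynomial.exists_ne_zero_of_extend (left_ne_zero_of_mul hp₁) (n + 1)
      refine ⟨g₀ * g₁, mul_ne_zero hg₀ hg₁, fun p hp u hu => ?_⟩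
      rw [map_mul] at hp
      obtain ⟨u₀, hu₀, hz₀⟩ := hgp _ (hgp₀ p (left_ne_zero_of_mul hp))
      obtain ⟨u₁, hu₁, hz₁⟩ := hgp _ (hgp₁ p (right_ne_zero_of_mul hp))
      rw [hext] at hu₀ hu₁
      have hz₀ := hz₀ h
      have hz₁ := hz₁ h
      simp only [lt_irrefl, dif_neg, not_false_eq_true] at hz₀ hz₁
      by_cases hu0 : u₀ = u
      · refine ⟨u₁, fun hu1 => right_ne_zero_of_mul hp₁ ?_, hu₁⟩
        rw [← hz₀, ← hz₁, hu0, hu1, sub_self]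
      · exact ⟨u₀, hu0, hu₀⟩
    -- if the path also meets a strip twice, there is no solution for generic data
    · obtain ⟨g, hg, hgp⟩ := P.not_solvesCauchy hE hG ha hP
      exact ⟨g, hg, fun p hp u hu => absurd ⟨u, hu⟩ (hgp p hp)⟩
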